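/- Let $\mathbb K$ be a field of characteristic $0$. A 3-Lie algebra is a $\mathbb K$-vector space $\mathfrak g$ with an alternating trilinear map $[\cdot,\cdot,\cdot]_{\mathfrak g}$ satisfying, for all $x_1,\dots,x_5\in\mathfrak g$, $$[x_1,x_2,[x_3,x_4,x_5]]=[[x_1,x_2,x_3],x_4,x_5]+[x_3,[x_1,x_2,x_4],x_5]+[x_3,x_4,[x_1,x_2,x_5]].$$ An action of a 3-Lie algebra $(\mathfrak g,\pi)$ on a 3-Lie algebra $(\mathfrak h,\mu)$ is a linear map $\rho:\wedge^2\mathfrak g\to\mathfrak{gl}(\mathfrak h)$ such that, for all $x_i,x,y\in\mathfrak g$ and $u,v,w\in\mathfrak h$, $$\rho(x_1,x_2)\rho(x_3,x_4)=\rho(\pi(x_1,x_2,x_3),x_4)+\rho(x_3,\pi(x_1,x_2,x_4))+\rho(x_3,x_4)\rho(x_1,x_2),$$ $$\rho(x_1,\pi(x_2,x_3,x_4))=\rho(x_3,x_4)\rho(x_1,x_2)-\rho(x_2,x_4)\rho(x_1,x_3)+\rho(x_2,x_3)\rho(x_1,x_4),$$ $\mu(\rho(x,y)u,v,w)=0$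 and $\rho(x,y)\mu(u,v,w)=0$. For vector spaces $V,W$ let $C^n(V,W)=\mathrm{Hom}(\wedge^2V\otimes\cdots\otimes\wedge^2V\wedge V,W)$ with $n\ge 0$ factors $\wedge^2V$, i.e. the linear maps $f(\mathfrak X_1,\dots,\mathfrak X_n,x)$ on $(\wedge^2V)^{\otimes n}\otimes V$ that, for $n\ge1$ and $\mathfrak X_n=x_n\wedge y_n$, are alternating in $x_n,y_n,x$; let $C^*(V,W)=\bigoplus_{n\ge0}C^n(V,W)$, graded by $n$. On $C^*(V,V)$ put $[P,Q]=P\circ Q-(-1)^{pq}Q\circ P$ for $P\in C^p(V,V)$, $Q\in C^q(V,V)$, where, with $S(a,b)$ the $(a,b)$-unshuffles and $\mathfrak X_i=x_i\wedge y_i$, $$\begin{aligned}(P\circ Q)(\mathfrak X_1,\dots,\mathfrak X_{p+q},x)={}&\sum_{k=1}^{p}(-1)^{(k-1)q}\sum_{\sigma\in S(k-1,q)}(-1)^\sigma P\big(\mathfrak X_{\sigma(1)},\dots,\mathfrak X_{\sigma(k-1)},Q_{k,\sigma}(x_{k+q})\wedge y_{k+q}+x_{k+q}\wedge Q_{k,\sigma}(y_{k+q}),\mathfrak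 X_{k+q+1},\dots,\mathfrak X_{p+q},x\big)\\&+(-1)^{pq}\sum_{\sigma\in S(p,q)}(-1)^\sigma P\big(\mathfrak X_{\sigma(1)},\dots,\mathfrak X_{\sigma(p)},Q(\mathfrak X_{\sigma(p+1)},\dots,\mathfrak X_{\sigma(p+q)},x)\big),\end{aligned}$$ with $Q_{k,\sigma}(z)=Q(\mathfrak X_{\sigma(k)},\dots,\mathfrak X_{\sigma(k+q-1)},z)$. Let $\rho$ be an action of $(\mathfrak g,\pi)$ on $(\mathfrak h,\mu)$, let $L=C^*(\mathfrak g\oplus\mathfrak h,\mathfrak g\oplus\mathfrak h)$, and let $F=C^*(\mathfrak g,\mathfrak h)\subset L$, a cochain being extended by $0$ to arguments in $\mathfrak h$. Let $\mathcal P:L\to L$ be the projection onto $F$ that restricts the arguments to $\mathfrak g$ and takes the $\mathfrak h$-component of the value. Let $\Delta=\pi+\rho+\mu\in C^1(\mathfrak g\oplus\mathfrak h,\mathfrak g\oplus\mathfrak h)$, $$\Delta(x+u,y+v,z+w)=\pi(x,y,z)+\rho(x,y)w+\rho(y,z)u+\rho(z,x)v+\mu(u,v,w).$$ Then $(L,F,\mathcal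 P,\Delta)$ is a V-data: $(L,[\cdot,\cdot])$ is a graded Lie algebra, $F$ is an abelian graded Lie subalgebra, $\mathcal P^2=\mathcal P$ has image $F$, $\ker\mathcal P$ is a graded Lie subalgebra, $\Delta\in\ker\mathcal P$ has degree $1$, and $[\Delta,\Delta]=0$. Consequently, the higher derived brackets $l_k(a_1,\dots,a_k)=\mathcal P[\cdots[[\Delta,a_1],a_2],\cdots,a_k]$, $k\ge1$, make $C^*(\mathfrak g,\mathfrak h)$ an $L_\infty$-algebra: each $l_k$ is multilinear of degree $1$ and graded symmetric, $l_n(x_{\sigma(1)},\dots,x_{\sigma(n)})=\varepsilon(\sigma)l_n(x_1,\dots,x_n)$ with the Koszul sign $\varepsilon(\sigma)$, and for all $n\ge1$ and homogeneous $x_1,\dots,x_n$ $$\sum_{i=1}^{n}\sum_{\sigma\in S(i,n-i)}\varepsilon(\sigma)\,l_{n-i+1}\big(l_i(x_{\sigma(1)},\dots,x_{\sigma(i)}),x_{\sigma(i+1)},\dots,x_{\sigma(n)}\big)=0.$$ Moreover, for all $P,Q,R\in C^*(\mathfrak g,\mathfrak h)$: $l_1(P)=\mathcal P[\Delta,P]$,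 and $l_1(P)$ agrees with $[\Delta,P]$ on arguments in $\mathfrak g$; $l_3(P,Q,R)=[[[\Delta,P],Q],R]$; and $l_k=0$ for all $k\ne1,3$. -/

import Mathlib

namespace ThreeLie

section Brackets

variable {K g h V : Type*} [Field K] [AddCommGroup g] [Module K g] [AddCommGroup h] [Module K h]
  [AddCommGroup V] [Module K V]

/-- A skew-symmetric trilinear map is a 3-Lie bracket if it satisfies the Fundamental Identity. -/
def IsThreeLieBracket (π : g [⋀^Fin 3]→ₗ[K] g) : Prop :=
  ∀ x₁ x₂ x₃ x₄ x₅ : g,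
    π ![x₁, x₂, π ![x₃, x₄, x₅]] =
      π ![π ![x₁, x₂, x₃], x₄, x₅] + π ![x₃, π ![x₁, x₂, x₄], x₅] + π ![x₃, x₄, π ![x₁, x₂, x₅]]

/-- A representation of the 3-Lie algebra `(g, π)` on the vector space `V`. -/
structure IsRepresentation (π : g [⋀^Fin 3]→ₗ[K] g) (ρ : g [⋀^Fin 2]→ₗ[K] Module.End K V) :
    Prop where
  rep₁ : ∀ x₁ x₂ x₃ x₄ : g,
    ρ ![x₁, x₂] * ρ ![x₃, x₄] =
      ρ ![π ![x₁, x₂, x₃], x₄] + ρ ![x₃, π ![x₁, x₂, x₄]] + ρ ![x₃, x₄] * ρ ![x₁, x₂]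
  rep₂ : ∀ x₁ x₂ x₃ x₄ : g,
    ρ ![x₁, π ![x₂, x₃, x₄]] =
      ρ ![x₃, x₄] * ρ ![x₁, x₂] - ρ ![x₂, x₄] * ρ ![x₁, x₃] + ρ ![x₂, x₃] * ρ ![x₁, x₄]

/-- The center of the 3-Lie algebra `(h, μ)`. -/
def center (μ : h [⋀^Fin 3]→ₗ[K] h) : Set h :=
  {u | ∀ v w : h, μ ![u, v, w] = 0}

/-- An action of the 3-Lie algebra `(g, π)` on the 3-Lie algebra `(h, μ)`. -/
structure IsAction (π : g [⋀^Fin 3]→ₗ[K] g) (μ : h [⋀^Fin 3]→ₗ[K] h)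
    (ρ : g [⋀^Fin 2]→ₗ[K] Module.End K h) : Prop extends IsRepresentation π ρ where
  mem_center : ∀ (x y : g) (u : h), ρ ![x, y] u ∈ center μ
  map_bracket : ∀ (x y : g) (u v w : h), ρ ![x, y] (μ ![u, v, w]) = 0

theorem update_pair_zero {M : Type*} (a b t : M) : Function.update ![a, b] 0 t = ![t, b] := by
  ext i
  fin_cases i <;> simp

theorem update_pair_one {M : Type*} (a b t : M) : Function.update ![a, b] 1 t = ![a, t] := by
  ext i
  fin_cases i <;> simp

theorem alt₂_add_left (f : g [⋀^Fin 2]→ₗ[K] V) (a b c : g) :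
    f ![a + b, c] = f ![a, c] + f ![b, c] := by
  have := f.map_update_add ![a, c] 0 a b
  simpa only [update_pair_zero, update_pair_one] using this

theorem alt₂_add_right (f : g [⋀^Fin 2]→ₗ[K] V) (a b c : g) :
    f ![a, b + c] = f ![a, b] + f ![a, c] := by
  have := f.map_update_add ![a, b] 1 b c
  simpa only [update_pair_zero, update_pair_one] using this

theorem alt₂_smul_left (f : g [⋀^Fin 2]→ₗ[K] V) (r : K) (a b : g) :
    f ![r • a, b] = r • f ![a, b] := by
  have := f.map_update_smul ![a, b] 0 r a
  simpa only [update_pair_zero, update_pair_one] using this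

theorem alt₂_smul_right (f : g [⋀^Fin 2]→ₗ[K] V) (r : K) (a b : g) :
    f ![a, r • b] = r • f ![a, b] := by
  have := f.map_update_smul ![a, b] 1 r b
  simpa only [update_pair_zero, update_pair_one] using this

theorem alt₂_self (f : g [⋀^Fin 2]→ₗ[K] V) (a : g) : f ![a, a] = 0 :=
  f.map_eq_zero_of_eq ![a, a] (i := 0) (j := 1) (by simp) (by decide)

theorem alt₂_swap (f : g [⋀^Fin 2]→ₗ[K] V) (a b : g) : f ![a, b] = -f ![b, a] := by
  have := f.map_swap ![b, a] (i := 0) (j := 1) (by decide)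
  rw [← this]
  congr 1
  ext t
  fin_cases t <;> simp

/-- The alternating map
`(x + u, y + v, z + w) ↦ ρ(x, y) w + ρ(y, z) u + ρ(z, x) v` on `g ⊕ h` with values in `h`. -/
def actionPart (ρ : g [⋀^Fin 2]→ₗ[K] Module.End K h) : (g × h) [⋀^Fin 3]→ₗ[K] h where
  toFun a := ρ ![(a 0).1, (a 1).1] (a 2).2 + ρ ![(a 1).1, (a 2).1] (a 0).2
    + ρ ![(a 2).1, (a 0).1] (a 1).2
  map_update_add' := by
    intro inst m i x y
    obtain rfl : inst = instDecidableEqFin 3 := Subsingleton.elim _ _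
    fin_cases i <;> simp [Function.update, alt₂_add_left, alt₂_add_right] <;> abel
  map_update_smul' := by
    intro inst m i c x
    obtain rfl : inst = instDecidableEqFin 3 := Subsingleton.elim _ _
    fin_cases i <;> simp [Function.update, alt₂_smul_left, alt₂_smul_right]
  map_eq_zero_of_eq' := by
    intro a i j hij hne
    have hs := alt₂_swap ρ
    have hz := alt₂_self ρ
    fin_cases i <;> fin_cases j <;> simp at hij hne ⊢ <;> rw [hij] <;> simp [hz] <;>
      first
        | rw [hs (a 2).1 (a 1).1]; simp
        | rw [hs (a 1).1 (a 0).1]; simp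
        | rw [hs (a 2).1 (a 0).1]; simp

/-- The alternating map `π + ρ + μ` on `g ⊕ h`:
`(x + u, y + v, z + w) ↦ π(x, y, z) + ρ(x, y) w + ρ(y, z) u + ρ(z, x) v + μ(u, v, w)`. -/
def semidirect (π : g [⋀^Fin 3]→ₗ[K] g) (ρ : g [⋀^Fin 2]→ₗ[K] Module.End K h)
    (μ : h [⋀^Fin 3]→ₗ[K] h) : (g × h) [⋀^Fin 3]→ₗ[K] (g × h) :=
  (LinearMap.inl K g h).compAlternatingMap (π.compLinearMap (LinearMap.fst K g h))
    + (LinearMap.inr K g h).compAlternatingMap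
        (actionPart ρ + μ.compLinearMap (LinearMap.snd K g h))

theorem semidirect_apply (π : g [⋀^Fin 3]→ₗ[K] g) (ρ : g [⋀^Fin 2]→ₗ[K] Module.End K h)
    (μ : h [⋀^Fin 3]→ₗ[K] h) (x y z : g) (u v w : h) :
    semidirect π ρ μ ![(x, u), (y, v), (z, w)] =
      (π ![x, y, z], ρ ![x, y] w + ρ ![y, z] u + ρ ![z, x] v + μ ![u, v, w]) := by
  have e1 : (fun i => (![(x, u), (y, v), (z, w)] i).1) = ![x, y, z] := by
    ext i; fin_cases i <;> rfl
  have e2 : (fun i => (![(x, u), (y, v), (z, w)] i).2) = ![u, v, w] := by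
    ext i; fin_cases i <;> rfl
  simp [semidirect, actionPart, e1, e2]

end Brackets


section Unshuffles

/-- `σ` is an `(a, n - a)`-unshuffle: `σ(1) < ⋯ < σ(a)` and `σ(a+1) < ⋯ < σ(n)`
(positions are counted from `0` in `Fin n`). -/
def IsUnshuffle {n : ℕ} (a : ℕ) (σ : Equiv.Perm (Fin n)) : Prop :=
  (∀ i j : Fin n, i < j → (j : ℕ) < a → σ i < σ j) ∧
    (∀ i j : Fin n, i < j → a ≤ (i : ℕ) → σ i < σ j)

open scoped Classical in
/-- The finite set `S(a, n - a)` of `(a, n - a)`-unshuffles of `n` letters. -/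
noncomputable def unshuffles (n a : ℕ) : Finset (Equiv.Perm (Fin n)) :=
  Finset.univ.filter (IsUnshuffle a)

/-- The permutation of `n + 1` letters that puts the largest letter at position `a` and is given by
`τ` on the other positions. -/
def insertTop {n : ℕ} (a : Fin (n + 1)) (τ : Equiv.Perm (Fin n)) : Equiv.Perm (Fin (n + 1)) :=
  (finSuccEquiv' a).trans ((Equiv.optionCongr τ).trans (finSuccEquiv' (Fin.last n)).symm)

theorem insertTop_self {n : ℕ} (a : Fin (n + 1)) (τ : Equiv.Perm (Fin n)) :
    insertTop a τ a = Fin.last n := by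
  simp [insertTop]

theorem insertTop_succAbove {n : ℕ} (a : Fin (n + 1)) (τ : Equiv.Perm (Fin n)) (i : Fin n) :
    insertTop a τ (a.succAbove i) = (τ i).castSucc := by
  simp [insertTop]

theorem sign_insertTop {n : ℕ} (a : Fin (n + 1)) (τ : Equiv.Perm (Fin n)) :
    Equiv.Perm.sign (insertTop a τ) = (-1) ^ (n - (a : ℕ)) * Equiv.Perm.sign τ := by
  have h1 : insertTop a τ * Fin.cycleIcc a (Fin.last n) = insertTop (Fin.last n) τ := by
    ext i
    refine Fin.lastCases ?_ (fun i => ?_) i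
    · rw [Equiv.Perm.mul_apply, Fin.cycleIcc_of_last (Fin.le_last a), insertTop_self,
        insertTop_self]
    · have h2 := congrFun (Fin.cycleIcc_comp_succAbove a (Fin.last n) (Fin.le_last a)) i
      simp only [Function.comp_apply, Fin.succAbove_last] at h2
      rw [Equiv.Perm.mul_apply, h2, insertTop_succAbove, ← Fin.succAbove_last_apply i,
        insertTop_succAbove]
  have h3 : Equiv.Perm.sign (insertTop (Fin.last n) τ) = Equiv.Perm.sign τ := by
    rw [← Equiv.optionCongr_sign τ]
    exact Equiv.Perm.sign_trans_trans_symm (Equiv.optionCongr τ) (finSuccEquiv' (Fin.last n))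
  have h4 := congrArg Equiv.Perm.sign h1
  rw [Equiv.Perm.sign_mul, Fin.sign_cycleIcc_of_le (Fin.le_last a), h3, Fin.val_last] at h4
  rw [← h4, mul_comm, mul_assoc, ← mul_pow]
  simp

theorem insertTop_surjective {n : ℕ} (a : Fin (n + 1)) (σ : Equiv.Perm (Fin (n + 1)))
    (h : σ a = Fin.last n) : ∃ τ, insertTop a τ = σ := by
  let e : Option (Fin n) ≃ Option (Fin n) :=
    (finSuccEquiv' a).symm.trans (σ.trans (finSuccEquiv' (Fin.last n)))
  have he : e none = none := by simp [e, h]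
  refine ⟨Equiv.removeNone e, ?_⟩
  have h2 : Equiv.optionCongr (Equiv.removeNone e) = e := by
    ext1 o
    cases o with
    | none => simp [he]
    | some i =>
      have : e (some i) ≠ none := fun hh => by
        have := e.injective (hh.trans he.symm)
        simp at this
      exact Equiv.removeNone_some e (Option.ne_none_iff_exists'.1 this)
  ext1 i
  simp [insertTop, h2, e]

theorem sum_unshuffles_top {M : Type*} [AddCommMonoid M] {N n a : ℕ} (h : N = n + 1) (ha : a ≤ n)
    (F : Equiv.Perm (Fin N) → M) (G : Equiv.Perm (Fin n) → M)
    (h0 : ∀ σ ∈ unshuffles N (a + 1), (σ ⟨a, by omega⟩ : ℕ) ≠ n → F σ = 0)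
    (h1 : ∀ (σ : Equiv.Perm (Fin N)) (τ : Equiv.Perm (Fin n)), (σ ⟨a, by omega⟩ : ℕ) = n →
      (∀ (i : ℕ) (hi : i < n), i < a → (σ ⟨i, by omega⟩ : ℕ) = τ ⟨i, hi⟩) →
      (∀ (i : ℕ) (hi : i < n), a ≤ i → (σ ⟨i + 1, by omega⟩ : ℕ) = τ ⟨i, hi⟩) →
      Equiv.Perm.sign σ = (-1) ^ (n - a) * Equiv.Perm.sign τ → F σ = G τ) :
    ∑ σ ∈ unshuffles N (a + 1), F σ = ∑ τ ∈ unshuffles n a, G τ := by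
  classical
  subst h
  set b : Fin (n + 1) := ⟨a, by omega⟩ with hb
  have lo : ∀ (τ : Equiv.Perm (Fin n)) (i : ℕ) (hi : i < n), i < a →
      (insertTop b τ ⟨i, by omega⟩ : ℕ) = τ ⟨i, hi⟩ := by
    intro τ i hi hia
    have := insertTop_succAbove b τ ⟨i, hi⟩
    rw [Fin.succAbove_of_castSucc_lt _ _ (by simpa [Fin.lt_def, hb] using hia)] at this
    exact congrArg Fin.val this
  have up : ∀ (τ : Equiv.Perm (Fin n)) (i : ℕ) (hi : i < n), a ≤ i →
      (insertTop b τ ⟨i + 1, by omega⟩ : ℕ) = τ ⟨i, hi⟩ := by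
    intro τ i hi hia
    have := insertTop_succAbove b τ ⟨i, hi⟩
    rw [Fin.succAbove_of_le_castSucc _ _ (by simpa [Fin.le_def, hb] using hia)] at this
    exact congrArg Fin.val this
  have tp : ∀ τ : Equiv.Perm (Fin n), (insertTop b τ b : ℕ) = n := fun τ => by
    rw [insertTop_self]; rfl
  have mem : ∀ τ : Equiv.Perm (Fin n),
      insertTop b τ ∈ unshuffles (n + 1) (a + 1) ↔ τ ∈ unshuffles n a := by
    intro τ
    simp only [unshuffles, Finset.mem_filter, Finset.mem_univ, true_and, IsUnshuffle]
    constructor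
    · rintro ⟨hl, hr⟩
      constructor
      · rintro ⟨i, hi⟩ ⟨j, hj⟩ hij hja
        have hij' : i < j := hij
        have hja' : j < a := hja
        have := hl ⟨i, by omega⟩ ⟨j, by omega⟩ hij (by simp; omega)
        rw [Fin.lt_def, lo τ i hi (by omega), lo τ j hj hja'] at this
        exact this
      · rintro ⟨i, hi⟩ ⟨j, hj⟩ hij hia
        have hij' : i < j := hij
        have hia' : a ≤ i := hia
        have := hr ⟨i + 1, by omega⟩ ⟨j + 1, by omega⟩ (by simpa [Fin.lt_def] using hij')
          (by simpa using hia')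
        rw [Fin.lt_def, up τ i hi hia', up τ j hj (by omega)] at this
        exact this
    · rintro ⟨hl, hr⟩
      constructor
      · rintro ⟨i, hi⟩ ⟨j, hj⟩ hij hja
        have hij' : i < j := hij
        have hja' : j < a + 1 := hja
        rw [Fin.lt_def, lo τ i (by omega) (by omega)]
        rcases Nat.lt_or_ge j a with hj2 | hj2
        · rw [lo τ j (by omega) hj2]
          exact hl ⟨i, by omega⟩ ⟨j, by omega⟩ hij hj2
        · obtain rfl : j = a := by omega
          have := tp τ
          rw [hb] at this
          rw [this]
          exact (τ _).isLt
      · rintro ⟨i, hi⟩ ⟨j, hj⟩ hij hia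
        have hij' : i < j := hij
        have hia' : a + 1 ≤ i := hia
        obtain ⟨i, rfl⟩ : ∃ i', i = i' + 1 := ⟨i - 1, by omega⟩
        obtain ⟨j, rfl⟩ : ∃ j', j = j' + 1 := ⟨j - 1, by omega⟩
        rw [Fin.lt_def, up τ i (by omega) (by omega), up τ j (by omega) (by omega)]
        exact hr ⟨i, by omega⟩ ⟨j, by omega⟩ (by simpa [Fin.lt_def] using hij')
          (by simp; omega)
  symm
  refine Finset.sum_bij_ne_zero (fun τ _ _ => insertTop b τ) ?_ ?_ ?_ ?_
  · intro τ hτ _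
    exact (mem τ).2 hτ
  · intro τ _ _ τ' _ _ hh
    ext i
    have h2 := insertTop_succAbove b τ i
    rw [hh, insertTop_succAbove] at h2
    simpa using (congrArg Fin.val h2).symm
  · intro σ hσ hne
    have ht : (σ b : ℕ) = n := by
      by_contra hc
      exact hne (h0 σ hσ hc)
    obtain ⟨τ, rfl⟩ := insertTop_surjective b σ (Fin.ext ht)
    refine ⟨τ, (mem τ).1 hσ, ?_, rfl⟩
    rwa [← h1 _ τ ht (lo τ) (up τ) (sign_insertTop b τ)]
  · intro τ _ _
    exact (h1 _ τ (tp τ) (lo τ) (up τ) (sign_insertTop b τ)).symm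

end Unshuffles

section Cochains

variable (K : Type*) [Field K]

/-- `Hom(∧²V ⊗ ⋯ ⊗ ∧²V ⊗ V, W)` with `n` factors `∧²V`, as multilinear maps
`(𝔛₁, …, 𝔛ₙ) ↦ (x ↦ f(𝔛₁, …, 𝔛ₙ, x))`. -/
abbrev PreCochain (n : ℕ) (V W : Type*) [AddCommGroup V] [Module K V] [AddCommGroup W]
    [Module K W] : Type _ :=
  MultilinearMap K (fun _ : Fin n => ⋀[K]^2 V) (V →ₗ[K] W)

/-- `Cⁿ(V, W) = Hom(∧²V ⊗ ⋯ ⊗ ∧²V ∧ V, W)` with `n` factors `∧²V`: the maps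
`f(𝔛₁, …, 𝔛ₙ, x)` that are (for `n ≥ 1`) alternating in the last three vectors `xₙ, yₙ, x`,
where `𝔛ₙ = xₙ ∧ yₙ`. As `f` is alternating in `xₙ, yₙ`, it is enough that it vanishes if
`x = yₙ`. -/
def cochainSubmodule (n : ℕ) (V W : Type*) [AddCommGroup V] [Module K V] [AddCommGroup W] [Module K W] :
    Submodule K (PreCochain K n V W) where
  carrier := {f | ∀ i : Fin n, (i : ℕ) + 1 = n → ∀ (X : Fin n → ⋀[K]^2 V) (x y : V),
    f (Function.update X i (exteriorPower.ιMulti K 2 ![x, y])) y = 0}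
  add_mem' := by
    intro f f' hf hf' i hi X x y
    simp [hf i hi X x y, hf' i hi X x y]
  zero_mem' := by
    intro i hi X x y
    simp
  smul_mem' := by
    intro c f hf i hi X x y
    simp [hf i hi X x y]

/-- The vector space `Cⁿ(V, W)`. -/
def Cochain (n : ℕ) (V W : Type*) [AddCommGroup V] [Module K V] [AddCommGroup W] [Module K W] :
    Type _ :=
  ↥(cochainSubmodule K n V W)

instance (n : ℕ) (V W : Type*) [AddCommGroup V] [Module K V] [AddCommGroup W] [Module K W] :
    AddCommGroup (Cochain K n V W) :=
  inferInstanceAs (AddCommGroup ↥(cochainSubmodule K n V W))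

instance (n : ℕ) (V W : Type*) [AddCommGroup V] [Module K V] [AddCommGroup W] [Module K W] :
    Module K (Cochain K n V W) :=
  inferInstanceAs (Module K ↥(cochainSubmodule K n V W))

/-- The graded vector space `C^*(V, W) = ⨁_{n ≥ 0} Cⁿ(V, W)`. -/
abbrev CochainSum (V W : Type*) [AddCommGroup V] [Module K V] [AddCommGroup W] [Module K W] :
    Type _ :=
  DirectSum ℕ (fun n => Cochain K n V W)

/-- The `ℤ`-grading of `C^*(V, W)`: degree `k` is `Cᵏ(V, W)` for `k ≥ 0` and `0` for `k < 0`. -/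
def grading (V W : Type*) [AddCommGroup V] [Module K V] [AddCommGroup W] [Module K W] (k : ℤ) :
    Submodule K (CochainSum K V W) where
  carrier := {f | ∀ n : ℕ, (n : ℤ) ≠ k → f n = 0}
  add_mem' := by
    intro f f' hf hf' n hn
    simp [hf n hn, hf' n hn]
  zero_mem' := by
    intro n _
    simp
  smul_mem' := by
    intro c f hf n hn
    simp [DirectSum.smul_apply, hf n hn]

end Cochains

section Circle

variable {K V : Type*} [Field K] [AddCommGroup V] [Module K V]

/-- The extension of an endomorphism `φ` of `V` to `∧²V` as a derivation:
`x ∧ y ↦ φ(x) ∧ y + x ∧ φ(y)`. -/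
noncomputable def wedgeDerivation : Module.End K V →ₗ[K] Module.End K (⋀[K]^2 V) :=
  (exteriorPower.alternatingMapLinearEquiv (R := K) (n := 2)).toLinearMap ∘ₗ
    { toFun := fun φ =>
        { toFun := fun v =>
            exteriorPower.ιMulti K 2 ![φ (v 0), v 1] + exteriorPower.ιMulti K 2 ![v 0, φ (v 1)]
          map_update_add' := by
            intro inst m i x y
            obtain rfl : inst = instDecidableEqFin 2 := Subsingleton.elim _ _
            fin_cases i <;>
              simp [-exteriorPower.ιMulti_apply_coe, Function.update, alt₂_add_left,
                alt₂_add_right] <;> abel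
          map_update_smul' := by
            intro inst m i c x
            obtain rfl : inst = instDecidableEqFin 2 := Subsingleton.elim _ _
            fin_cases i <;>
              simp [-exteriorPower.ιMulti_apply_coe, Function.update, alt₂_smul_left,
                alt₂_smul_right]
          map_eq_zero_of_eq' := by
            intro v i j hij hne
            have h01 : v 0 = v 1 := by
              fin_cases i <;> fin_cases j <;> simp_all
            rw [h01, alt₂_swap]
            exact neg_add_cancel _ }
      map_add' := by
        intro φ ψ
        ext v
        simp [-exteriorPower.ιMulti_apply_coe, alt₂_add_left, alt₂_add_right]
        abel
      map_smul' := by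
        intro c φ
        ext v
        simp [-exteriorPower.ιMulti_apply_coe, alt₂_smul_left, alt₂_smul_right] }

theorem wedgeDerivation_apply (φ : Module.End K V) (x y : V) :
    wedgeDerivation φ (exteriorPower.ιMulti K 2 ![x, y]) =
      exteriorPower.ιMulti K 2 ![φ x, y] + exteriorPower.ιMulti K 2 ![x, φ y] := by
  simp [wedgeDerivation, -exteriorPower.ιMulti_apply_coe]

/-- How the `p + q` arguments `𝔛` are distributed by `σ ∈ S(k, q)`, `k ≤ p` (all positions
counted from `0`): the `j`-th argument of `Q` is `𝔛_{σ(k+j)}`; the `i`-th position of `P` receives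
`𝔛_{σ(i)}` if `i < k` and `𝔛_{i+q}` if `i ≥ k`. -/
def slot {p q k : ℕ} (hk : k ≤ p) (σ : Equiv.Perm (Fin (k + q))) :
    Fin q ⊕ Fin p → Fin (p + q)
  | Sum.inl j => ⟨σ ⟨k + j, by omega⟩, by omega⟩
  | Sum.inr i => if h : (i : ℕ) < k then ⟨σ ⟨i, by omega⟩, by omega⟩ else ⟨i + q, by omega⟩

theorem slot_injective {p q k : ℕ} (hk : k ≤ p) (σ : Equiv.Perm (Fin (k + q))) :
    Function.Injective (slot hk σ) := by
  have key : ∀ (a b : ℕ) (ha : a < k + q) (hb : b < k + q),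
      (σ ⟨a, ha⟩ : ℕ) = σ ⟨b, hb⟩ → a = b := by
    intro a b ha hb hab
    have := σ.injective (Fin.ext hab)
    simpa using this
  rintro (i | i) (j | j) hij
  · simp only [slot] at hij
    have h1 := congrArg Fin.val hij
    have := key _ _ _ _ h1
    congr 1
    ext
    omega
  · exfalso
    simp only [slot] at hij
    split_ifs at hij with hj
    · have h1 := congrArg Fin.val hij
      have := key _ _ _ _ h1
      omega
    · have h1 := congrArg Fin.val hij
      simp only at h1
      have h2 := (σ ⟨k + i, by omega⟩).isLt
      omega
  · exfalso
    simp only [slot] at hij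
    split_ifs at hij with hi
    · have h1 := congrArg Fin.val hij
      have := key _ _ _ _ h1
      omega
    · have h1 := congrArg Fin.val hij
      simp only at h1
      have h2 := (σ ⟨k + j, by omega⟩).isLt
      omega
  · simp only [slot] at hij
    congr 1
    ext
    split_ifs at hij with hi hj hj
    · have h1 := congrArg Fin.val hij
      exact key _ _ _ _ h1
    · have h1 := congrArg Fin.val hij
      simp only at h1
      have h2 := (σ ⟨i, by omega⟩).isLt
      omega
    · have h1 := congrArg Fin.val hij
      simp only at h1
      have h2 := (σ ⟨j, by omega⟩).isLt
      omega
    · have h1 := congrArg Fin.val hij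
      simp only at h1
      omega

theorem slot_bijective {p q k : ℕ} (hk : k ≤ p) (σ : Equiv.Perm (Fin (k + q))) :
    Function.Bijective (slot hk σ) := by
  rw [Fintype.bijective_iff_injective_and_card]
  exact ⟨slot_injective hk σ, by simp [add_comm]⟩

/-- `slot` as a bijection. -/
noncomputable def slotEquiv {p q k : ℕ} (hk : k ≤ p) (σ : Equiv.Perm (Fin (k + q))) :
    Fin q ⊕ Fin p ≃ Fin (p + q) :=
  Equiv.ofBijective (slot hk σ) (slot_bijective hk σ)

/-- Insertion of `Q` into the `k`-th wedge factor of `P`: for `B` a family of `p` elements and `A`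
a family of `q` elements of `∧²V`, with `B_k = x ∧ y`, this is
`P(B₁, …, Q(A, x) ∧ y + x ∧ Q(A, y), …, B_p, ·)`. -/
noncomputable def insertWedge {p q : ℕ} (P : PreCochain K p V V) (Q : PreCochain K q V V)
    (k : Fin p) :
    MultilinearMap K (fun _ : Fin q ⊕ Fin p => ⋀[K]^2 V) (V →ₗ[K] V) where
  toFun Y := P (Function.update (fun i => Y (Sum.inr i)) k
    (wedgeDerivation (Q fun j => Y (Sum.inl j)) (Y (Sum.inr k))))
  map_update_add' := by
    intro inst Y s a b
    obtain rfl : inst = instDecidableEqSum := Subsingleton.elim _ _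
    rcases s with j | i
    · simp
    · by_cases hik : k = i
      · subst hik
        simp
      · simp [hik, Function.update_comm (Ne.symm hik)]
  map_update_smul' := by
    intro inst Y s c a
    obtain rfl : inst = instDecidableEqSum := Subsingleton.elim _ _
    rcases s with j | i
    · simp
    · by_cases hik : k = i
      · subst hik
        simp
      · simp [hik, Function.update_comm (Ne.symm hik)]

/-- Insertion of `Q` into the last argument of `P`: `P(B, Q(A, ·))`. -/
def insertLast {p q : ℕ} (P : PreCochain K p V V) (Q : PreCochain K q V V) :
    MultilinearMap K (fun _ : Fin q ⊕ Fin p => ⋀[K]^2 V) (V →ₗ[K] V) where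
  toFun Y := (P fun i => Y (Sum.inr i)) ∘ₗ (Q fun j => Y (Sum.inl j))
  map_update_add' := by
    intro inst Y s a b
    obtain rfl : inst = instDecidableEqSum := Subsingleton.elim _ _
    rcases s with j | i
    · simp [LinearMap.comp_add]
    · simp [LinearMap.add_comp]
  map_update_smul' := by
    intro inst Y s c a
    obtain rfl : inst = instDecidableEqSum := Subsingleton.elim _ _
    rcases s with j | i
    · simp [LinearMap.comp_smul]
    · simp [LinearMap.smul_comp]

/-- The circle product `P ∘ Q`. With `k` counted from `0`, it is
`∑_{k < p} (-1)^{kq} ∑_{σ ∈ S(k,q)} (-1)^σ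
  P(𝔛_{σ(0)}, …, 𝔛_{σ(k-1)}, Q(𝔛_{σ(k)}, …, 𝔛_{σ(k+q-1)}, ·) ⋆ 𝔛_{k+q}, 𝔛_{k+q+1}, …, x)
  + (-1)^{pq} ∑_{σ ∈ S(p,q)} (-1)^σ
  P(𝔛_{σ(0)}, …, 𝔛_{σ(p-1)}, Q(𝔛_{σ(p)}, …, 𝔛_{σ(p+q-1)}, x))`,
where `φ ⋆ (x ∧ y) = φ(x) ∧ y + x ∧ φ(y)`. -/
noncomputable def preCircle {p q : ℕ} (P : PreCochain K p V V) (Q : PreCochain K q V V) :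
    PreCochain K (p + q) V V :=
  (∑ k : Fin p, (-1 : ℤ) ^ ((k : ℕ) * q) • ∑ σ ∈ unshuffles ((k : ℕ) + q) k,
      Equiv.Perm.sign σ • (insertWedge P Q k).domDomCongr (slotEquiv k.isLt.le σ))
    + (-1 : ℤ) ^ (p * q) • ∑ σ ∈ unshuffles (p + q) p,
      Equiv.Perm.sign σ • (insertLast P Q).domDomCongr (slotEquiv le_rfl σ)

end Circle

section Closure

variable {K V : Type*} [Field K] [AddCommGroup V] [Module K V]

theorem preCircle_apply {p q : ℕ} (P : PreCochain K p V V) (Q : PreCochain K q V V)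
    (X : Fin (p + q) → ⋀[K]^2 V) (x : V) :
    preCircle P Q X x =
      (∑ k : Fin p, (-1 : ℤ) ^ ((k : ℕ) * q) • ∑ σ ∈ unshuffles ((k : ℕ) + q) k,
        Equiv.Perm.sign σ • P (Function.update
          (fun i => X (slotEquiv k.isLt.le σ (Sum.inr i))) k
          (wedgeDerivation (Q fun j => X (slotEquiv k.isLt.le σ (Sum.inl j)))
            (X (slotEquiv k.isLt.le σ (Sum.inr k))))) x)
      + (-1 : ℤ) ^ (p * q) • ∑ σ ∈ unshuffles (p + q) p, Equiv.Perm.sign σ •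
        (P fun i => X (slotEquiv le_rfl σ (Sum.inr i)))
          ((Q fun j => X (slotEquiv le_rfl σ (Sum.inl j))) x) := by
  simp only [preCircle, add_apply, sum_apply, smul_apply,
    LinearMap.add_apply, LinearMap.sum_apply, LinearMap.smul_apply]
  rfl

theorem slotEquiv_inl {p q k : ℕ} (hk : k ≤ p) (σ : Equiv.Perm (Fin (k + q))) (j : Fin q) :
    slotEquiv hk σ (Sum.inl j) = ⟨σ ⟨k + j, by omega⟩, by omega⟩ := rfl

theorem slotEquiv_inr_lt {p q k : ℕ} (hk : k ≤ p) (σ : Equiv.Perm (Fin (k + q))) (i : Fin p)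
    (hi : (i : ℕ) < k) : slotEquiv hk σ (Sum.inr i) = ⟨σ ⟨i, by omega⟩, by omega⟩ :=
  dif_pos hi

theorem slotEquiv_inr_ge {p q k : ℕ} (hk : k ≤ p) (σ : Equiv.Perm (Fin (k + q))) (i : Fin p)
    (hi : ¬ (i : ℕ) < k) : slotEquiv hk σ (Sum.inr i) = ⟨i + q, by omega⟩ :=
  dif_neg hi

theorem cochain_swap {n : ℕ} {f : PreCochain K n V V} (hf : f ∈ cochainSubmodule K n V V) (i : Fin n)
    (hi : (i : ℕ) + 1 = n) (X : Fin n → ⋀[K]^2 V) (x y z : V) :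
    f (Function.update X i (exteriorPower.ιMulti K 2 ![x, y])) z =
      -f (Function.update X i (exteriorPower.ιMulti K 2 ![x, z])) y := by
  have h := hf i hi X x (y + z)
  have h1 := hf i hi X x y
  have h2 := hf i hi X x z
  rw [alt₂_add_right, MultilinearMap.map_update_add, LinearMap.add_apply, map_add, map_add, h1,
    h2, zero_add, add_zero] at h
  exact eq_neg_of_add_eq_zero_left h

theorem preCircle_mem {p q : ℕ} {P : PreCochain K p V V} {Q : PreCochain K q V V}
    (hP : P ∈ cochainSubmodule K p V V) (hQ : Q ∈ cochainSubmodule K q V V) :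
    preCircle P Q ∈ cochainSubmodule K (p + q) V V := by
  intro N hN X x y
  set X' := Function.update X N (exteriorPower.ιMulti K 2 ![x, y]) with hX'
  have hX'N : X' N = exteriorPower.ιMulti K 2 ![x, y] := by simp [hX']
  -- a family whose value at the last index is `x ∧ y`
  have hP0 : ∀ (i : Fin p), (i : ℕ) + 1 = p → ∀ Y : Fin p → ⋀[K]^2 V,
      Y i = exteriorPower.ιMulti K 2 ![x, y] → P Y y = 0 := by
    intro i hi Y hY
    have := hP i hi Y x y
    rwa [← hY, Function.update_eq_self] at this
  have hQ0 : ∀ (i : Fin q), (i : ℕ) + 1 = q → ∀ Y : Fin q → ⋀[K]^2 V,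
      Y i = exteriorPower.ιMulti K 2 ![x, y] → Q Y y = 0 := by
    intro i hi Y hY
    have := hQ i hi Y x y
    rwa [← hY, Function.update_eq_self] at this
  -- a term of the last sum vanishes unless the last index sits at position `p - 1`
  have last0 : ∀ σ ∈ unshuffles (p + q) p,
      (∀ i : Fin (p + q), (i : ℕ) + 1 = p → σ i ≠ N) →
      (P fun i => X' (slotEquiv le_rfl σ (Sum.inr i)))
        ((Q fun j => X' (slotEquiv le_rfl σ (Sum.inl j))) y) = 0 := by
    intro σ hσ hne
    have hσ' : IsUnshuffle p σ := by simpa [unshuffles] using hσ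
    obtain ⟨r, hr⟩ := σ.surjective N
    have hmax : ∀ s, ¬ σ r < σ s := by
      intro s hs
      rw [hr, Fin.lt_def] at hs
      have := (σ s).isLt
      omega
    have hrq : p ≤ (r : ℕ) := by
      by_contra hc
      by_cases hr1 : (r : ℕ) + 1 = p
      · exact hne r hr1 hr
      · exact hmax ⟨p - 1, by omega⟩
          (hσ'.1 r ⟨p - 1, by omega⟩ (by rw [Fin.lt_def]; simp; omega) (by simp; omega))
    have hrl : (r : ℕ) + 1 = p + q := by
      by_contra hc
      exact hmax ⟨r + 1, by omega⟩
        (hσ'.2 r ⟨r + 1, by omega⟩ (by rw [Fin.lt_def]; simp) hrq)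
    rw [hQ0 ⟨r - p, by omega⟩ (by simp; omega), map_zero]
    rw [slotEquiv_inl]
    have : (⟨p + (r - p : ℕ), by omega⟩ : Fin (p + q)) = r := Fin.ext (by simp; omega)
    simp only [this, hr]
    exact hX'N
  rw [preCircle_apply]
  rcases p with _ | p
  · rw [Fin.sum_univ_zero, zero_add, Finset.sum_eq_zero, smul_zero]
    intro σ hσ
    rw [last0 σ hσ (fun i hi => by omega), smul_zero]
  · rw [Fin.sum_univ_castSucc, Finset.sum_eq_zero, zero_add]
    · have key := sum_unshuffles_top (M := V) (N := p + 1 + q) (n := p + q) (a := p) (by omega)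
        (by omega)
        (fun σ => Equiv.Perm.sign σ • (P fun i => X' (slotEquiv le_rfl σ (Sum.inr i)))
          ((Q fun j => X' (slotEquiv le_rfl σ (Sum.inl j))) y))
        (fun τ => (-1 : ℤ) ^ (q + 1) • Equiv.Perm.sign τ • P (Function.update
          (fun i => X' (slotEquiv (Fin.last p).isLt.le τ (Sum.inr i))) (Fin.last p)
          (wedgeDerivation (Q fun j => X' (slotEquiv (Fin.last p).isLt.le τ (Sum.inl j)))
            (X' (slotEquiv (Fin.last p).isLt.le τ (Sum.inr (Fin.last p)))))) y) ?_ ?_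
      · rw [key, ← Finset.smul_sum, smul_smul, ← pow_add]
        have hs : (-1 : ℤ) ^ ((p + 1) * q + (q + 1)) = -(-1 : ℤ) ^ (p * q) := by
          rw [show (p + 1) * q + (q + 1) = p * q + 1 + 2 * q by ring, pow_add, pow_mul, pow_succ]
          simp
        rw [hs, neg_smul]
        exact add_neg_cancel _
      · intro σ hσ hne
        rw [last0 σ hσ, smul_zero]
        intro i hi hiN
        apply hne
        have : (⟨p, by omega⟩ : Fin (p + 1 + q)) = i := Fin.ext (by simp; omega)
        rw [this, hiN]
        omega
      · intro σ τ htop hlo hup hsign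
        have eQ : (fun j => X' (slotEquiv (Fin.last p).isLt.le τ (Sum.inl j))) =
            fun j => X' (slotEquiv le_rfl σ (Sum.inl j)) := by
          funext j
          congr 1
          rw [slotEquiv_inl, slotEquiv_inl, Fin.mk.injEq]
          have := hup (p + j) (by omega) (by omega)
          simp only [Fin.val_last]
          rw [← this]
          congr 3
          omega
        have eN1 : X' (slotEquiv (Fin.last p).isLt.le τ (Sum.inr (Fin.last p))) =
            exteriorPower.ιMulti K 2 ![x, y] := by
          rw [← hX'N]
          congr 1
          rw [slotEquiv_inr_ge _ _ _ (by simp)]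
          ext
          simp
          omega
        have eN2 : X' (slotEquiv le_rfl σ (Sum.inr (Fin.last p))) =
            exteriorPower.ιMulti K 2 ![x, y] := by
          rw [← hX'N]
          congr 1
          rw [slotEquiv_inr_lt _ _ _ (by simp)]
          ext
          simp only [Fin.val_last]
          omega
        have eP : ∀ w, Function.update (fun i => X' (slotEquiv (Fin.last p).isLt.le τ (Sum.inr i)))
              (Fin.last p) w =
            Function.update (fun i => X' (slotEquiv le_rfl σ (Sum.inr i))) (Fin.last p) w := by
          intro w
          funext i
          by_cases hi : i = Fin.last p
          · subst hi
            simp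
          · have hi' : (i : ℕ) < p := by
              have := i.isLt
              have h2 : (i : ℕ) ≠ p := fun h => hi (Fin.ext h)
              omega
            rw [Function.update_of_ne hi, Function.update_of_ne hi]
            congr 1
            rw [slotEquiv_inr_lt _ _ _ (by simpa using hi'), slotEquiv_inr_lt _ _ _ (by omega),
              Fin.mk.injEq]
            exact (hlo i (by omega) hi').symm
        rw [eQ, eN1, eP, wedgeDerivation_apply, MultilinearMap.map_update_add,
          LinearMap.add_apply, hP _ (by simp), zero_add, cochain_swap hP _ (by simp), ← eN2,
          Function.update_eq_self, hsign, smul_neg, smul_neg, pow_succ]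
        have hpq : p + q - p = q := by omega
        rw [hpq, mul_smul, Units.smul_def ((-1 : ℤˣ) ^ q)]
        simp
    · intro k _
      rw [Finset.sum_eq_zero, smul_zero]
      intro σ _
      rw [hP0 (Fin.last p) (by simp), smul_zero]
      rw [Function.update_of_ne (by simp [Fin.ext_iff]; omega), ← hX'N]
      congr 1
      rw [slotEquiv_inr_ge _ _ _ (by simp)]
      ext
      simp
      omega

end Closure

section Bracket

variable {K : Type*} (V : Type*) [Field K] [AddCommGroup V] [Module K V]

/-- The circle product as a bilinear map `Cᵖ(V, V) × C^q(V, V) → C^{p+q}(V, V)`. -/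
noncomputable def circle (p q : ℕ) :
    Cochain K p V V →ₗ[K] Cochain K q V V →ₗ[K] Cochain K (p + q) V V :=
  LinearMap.mk₂ K (fun P Q => ⟨preCircle P.1 Q.1, preCircle_mem P.2 Q.2⟩)
    (by
      intro P P' Q
      refine Subtype.ext (MultilinearMap.ext fun X => LinearMap.ext fun x => ?_)
      change preCircle (P.1 + P'.1) Q.1 X x = preCircle P.1 Q.1 X x + preCircle P'.1 Q.1 X x
      simp only [add_apply, LinearMap.add_apply, preCircle_apply, smul_add,
        Finset.sum_add_distrib]
      abel)
    (by
      intro c P Q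
      refine Subtype.ext (MultilinearMap.ext fun X => LinearMap.ext fun x => ?_)
      change preCircle (c • P.1) Q.1 X x = c • preCircle P.1 Q.1 X x
      simp only [smul_apply, LinearMap.smul_apply, preCircle_apply, smul_add,
        Finset.smul_sum, smul_comm c])
    (by
      intro P Q Q'
      refine Subtype.ext (MultilinearMap.ext fun X => LinearMap.ext fun x => ?_)
      change preCircle P.1 (Q.1 + Q'.1) X x = preCircle P.1 Q.1 X x + preCircle P.1 Q'.1 X x
      simp only [add_apply, LinearMap.add_apply, preCircle_apply, smul_add,
        map_add, MultilinearMap.map_update_add, Finset.sum_add_distrib]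
      abel)
    (by
      intro c P Q
      refine Subtype.ext (MultilinearMap.ext fun X => LinearMap.ext fun x => ?_)
      change preCircle P.1 (c • Q.1) X x = c • preCircle P.1 Q.1 X x
      simp only [smul_apply, LinearMap.smul_apply, preCircle_apply, smul_add,
        map_smul, MultilinearMap.map_update_smul, Finset.smul_sum, smul_comm c])

/-- The graded commutator bracket on `C^*(V, V)`, the bilinear map with
`[P, Q] = P ∘ Q - (-1)^{pq} Q ∘ P` for `P ∈ Cᵖ(V, V)` and `Q ∈ C^q(V, V)`. -/
noncomputable def bracket :
    CochainSum K V V →ₗ[K] CochainSum K V V →ₗ[K] CochainSum K V V :=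
  DirectSum.toModule K ℕ _ fun p => LinearMap.flip <| DirectSum.toModule K ℕ _ fun q =>
    LinearMap.flip <|
      (circle V p q).compr₂ (DirectSum.lof K ℕ (fun n => Cochain K n V V) (p + q))
        - (-1 : ℤ) ^ (p * q) •
          ((circle V q p).compr₂ (DirectSum.lof K ℕ (fun n => Cochain K n V V) (q + p))).flip

theorem bracket_lof (p q : ℕ) (P : Cochain K p V V) (Q : Cochain K q V V) :
    bracket V (DirectSum.lof K ℕ (fun n => Cochain K n V V) p P)
        (DirectSum.lof K ℕ (fun n => Cochain K n V V) q Q) =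
      DirectSum.lof K ℕ (fun n => Cochain K n V V) (p + q) (circle V p q P Q)
        - (-1 : ℤ) ^ (p * q) •
          DirectSum.lof K ℕ (fun n => Cochain K n V V) (q + p) (circle V q p Q P) := by
  simp only [bracket, DirectSum.toModule_lof, LinearMap.flip_apply, LinearMap.sub_apply,
    LinearMap.compr₂_apply, LinearMap.smul_apply]

end Bracket

section Trilinear

variable {K V W : Type*} [Field K] [AddCommGroup V] [Module K V] [AddCommGroup W] [Module K W]

/-- The linear map `∧²V → Hom(V, W)`, `x ∧ y ↦ (z ↦ f(x, y, z))`, of an alternating trilinear map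
(written with `f(z, x, y) = f(x, y, z)`). -/
noncomputable def wedgeCurry (f : V [⋀^Fin 3]→ₗ[K] W) : ⋀[K]^2 V →ₗ[K] V →ₗ[K] W :=
  ((exteriorPower.alternatingMapLinearEquiv (R := K) (n := 2)).toLinearMap ∘ₗ
    AlternatingMap.curryLeft f).flip

theorem wedgeCurry_apply (f : V [⋀^Fin 3]→ₗ[K] W) (x y z : V) :
    wedgeCurry f (exteriorPower.ιMulti K 2 ![x, y]) z = f ![x, y, z] := by
  have h1 : wedgeCurry f (exteriorPower.ιMulti K 2 ![x, y]) z = f ![z, x, y] := by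
    simp [wedgeCurry, -exteriorPower.ιMulti_apply_coe]
  rw [h1]
  have h2 := f.map_perm ![x, y, z] (finRotate 3).symm
  have h3 : Equiv.Perm.sign (finRotate 3).symm = 1 := by decide
  rw [h3, one_smul] at h2
  rw [← h2]
  congr 1
  ext i
  fin_cases i <;> rfl

/-- An alternating trilinear map `∧³V → W` as an element of `C¹(V, W)`. -/
noncomputable def ofAlternating (f : V [⋀^Fin 3]→ₗ[K] W) : Cochain K 1 V W :=
  ⟨MultilinearMap.ofSubsingleton K (⋀[K]^2 V) (V →ₗ[K] W) (0 : Fin 1) (wedgeCurry f), by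
    intro i _ X x y
    obtain rfl : i = 0 := Subsingleton.elim _ _
    rw [MultilinearMap.ofSubsingleton_apply_apply, Function.update_self, wedgeCurry_apply]
    exact f.map_eq_zero_of_eq _ (i := 1) (j := 2) (by simp) (by decide)⟩

end Trilinear

section Functoriality

variable {K V W V' W' : Type*} [Field K] [AddCommGroup V] [Module K V] [AddCommGroup W]
  [Module K W] [AddCommGroup V'] [Module K V'] [AddCommGroup W'] [Module K W']

/-- The map `Cⁿ(V, W) → Cⁿ(V', W')` induced by `α : V' → V` and `β : W → W'`:
`f ↦ ((𝔛₁, …, 𝔛ₙ, x) ↦ β(f(∧²α(𝔛₁), …, ∧²α(𝔛ₙ), α(x))))`. -/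
noncomputable def Cochain.map (α : V' →ₗ[K] V) (β : W →ₗ[K] W') (n : ℕ) :
    Cochain K n V W →ₗ[K] Cochain K n V' W' where
  toFun f :=
    ⟨((LinearMap.lcomp K W' α) ∘ₗ (LinearMap.llcomp K V W W' β)).compMultilinearMap
      (f.1.compLinearMap fun _ => exteriorPower.map 2 α), by
      intro i hi X x y
      have e : (fun j => exteriorPower.map 2 α
            (Function.update X i (exteriorPower.ιMulti K 2 ![x, y]) j)) =
          Function.update (fun j => exteriorPower.map 2 α (X j)) i
            (exteriorPower.ιMulti K 2 ![α x, α y]) := by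
        funext j
        by_cases hj : j = i
        · subst hj
          rw [Function.update_self, Function.update_self, exteriorPower.map_apply_ιMulti]
          congr 1
          ext t
          fin_cases t <;> rfl
        · rw [Function.update_of_ne hj, Function.update_of_ne hj]
      change β (f.1 (fun j => exteriorPower.map 2 α
            (Function.update X i (exteriorPower.ιMulti K 2 ![x, y]) j)) (α y)) = 0
      rw [e, f.2 i hi, map_zero]⟩
  map_add' f f' := by
    refine Subtype.ext (MultilinearMap.ext fun X => LinearMap.ext fun x => ?_)
    exact map_add β _ _
  map_smul' c f := by
    refine Subtype.ext (MultilinearMap.ext fun X => LinearMap.ext fun x => ?_)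
    exact map_smul β _ _

theorem Cochain.map_apply (α : V' →ₗ[K] V) (β : W →ₗ[K] W') (n : ℕ) (f : Cochain K n V W)
    (X : Fin n → ⋀[K]^2 V') (x : V') :
    (Cochain.map α β n f).1 X x = β (f.1 (fun i => exteriorPower.map 2 α (X i)) (α x)) := rfl

variable (K g h : Type*) [Field K] [AddCommGroup g] [Module K g] [AddCommGroup h] [Module K h]

/-- The inclusion `C^*(g, h) → C^*(g ⊕ h, g ⊕ h)`: an element of `Cⁿ(g, h)` is extended by `0` to
arguments in `h` and regarded as having values in `g ⊕ h`. -/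
noncomputable def embed : CochainSum K g h →ₗ[K] CochainSum K (g × h) (g × h) :=
  DirectSum.lmap (Cochain.map (LinearMap.fst K g h) (LinearMap.inr K g h))

/-- The map `C^*(g ⊕ h, g ⊕ h) → C^*(g, h)` that restricts the arguments to `g` and takes the
`h`-component of the value. -/
noncomputable def restrict : CochainSum K (g × h) (g × h) →ₗ[K] CochainSum K g h :=
  DirectSum.lmap (Cochain.map (LinearMap.inl K g h) (LinearMap.snd K g h))

theorem restrict_embed (P : CochainSum K g h) : restrict K g h (embed K g h P) = P := by
  refine DFinsupp.ext fun n => ?_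
  refine Subtype.ext (MultilinearMap.ext fun X => LinearMap.ext fun x => ?_)
  have e : ∀ w : ⋀[K]^2 g,
      exteriorPower.map 2 (LinearMap.fst K g h)
        (exteriorPower.map 2 (LinearMap.inl K g h) w) = w := by
    intro w
    rw [← LinearMap.comp_apply, ← exteriorPower.map_comp, LinearMap.fst_comp_inl,
      exteriorPower.map_id, LinearMap.id_apply]
  change (P n).1 (fun i => exteriorPower.map 2 (LinearMap.fst K g h)
    (exteriorPower.map 2 (LinearMap.inl K g h) (X i))) x = (P n).1 X x
  simp only [e]

/-- The projection of `C^*(g ⊕ h, g ⊕ h)` onto the subspace `C^*(g, h)`. -/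
noncomputable def projection : CochainSum K (g × h) (g × h) →ₗ[K] CochainSum K (g × h) (g × h) :=
  embed K g h ∘ₗ restrict K g h

end Functoriality

section Graded

variable {K A : Type*} [Field K] [AddCommGroup A] [Module K A]

/-- `(A, br)` with `A = ⨁_{k ∈ ℤ} 𝒜 k` is a graded Lie algebra. -/
structure IsGradedLieAlgebra (𝒜 : ℤ → Submodule K A) (br : A →ₗ[K] A →ₗ[K] A) : Prop where
  internal : DirectSum.IsInternal 𝒜
  degree : ∀ (p q : ℤ) (a b : A), a ∈ 𝒜 p → b ∈ 𝒜 q → br a b ∈ 𝒜 (p + q)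
  skew : ∀ (p q : ℤ) (a b : A), a ∈ 𝒜 p → b ∈ 𝒜 q → br a b = -((p * q).negOnePow • br b a)
  jacobi : ∀ (p q r : ℤ) (a b c : A), a ∈ 𝒜 p → b ∈ 𝒜 q → c ∈ 𝒜 r →
    br a (br b c) = br (br a b) c + (p * q).negOnePow • br b (br a c)

/-- `S` is a graded Lie subalgebra: it is spanned by its homogeneous elements and closed under the
bracket. -/
structure IsGradedLieSubalgebra (𝒜 : ℤ → Submodule K A) (br : A →ₗ[K] A →ₗ[K] A)
    (S : Submodule K A) : Prop where
  graded : S = ⨆ k : ℤ, S ⊓ 𝒜 k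
  closed : ∀ a ∈ S, ∀ b ∈ S, br a b ∈ S

/-- `(A, F, proj, Δ)` is a V-data: `A` is a graded Lie algebra, `F` an abelian graded Lie
subalgebra, `proj` a projection with image `F` whose kernel is a graded Lie subalgebra, and `Δ` an
element of degree `1` of the kernel with `[Δ, Δ] = 0`. -/
structure IsVData (𝒜 : ℤ → Submodule K A) (br : A →ₗ[K] A →ₗ[K] A) (F : Submodule K A)
    (proj : A →ₗ[K] A) (Δ : A) : Prop where
  lie : IsGradedLieAlgebra 𝒜 br
  subalgebra : IsGradedLieSubalgebra 𝒜 br F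
  abelian : ∀ a ∈ F, ∀ b ∈ F, br a b = 0
  idempotent : proj ∘ₗ proj = proj
  range_eq : LinearMap.range proj = F
  ker_subalgebra : IsGradedLieSubalgebra 𝒜 br (LinearMap.ker proj)
  mem_ker : Δ ∈ LinearMap.ker proj
  mem_degree_one : Δ ∈ 𝒜 1
  square_zero : br Δ Δ = 0

/-- The iterated bracket `[⋯[[Δ, a₁], a₂], ⋯, a_k]` as a multilinear map. -/
noncomputable def iteratedBracket (br : A →ₗ[K] A →ₗ[K] A) (Δ : A) :
    (k : ℕ) → MultilinearMap K (fun _ : Fin k => A) A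
  | 0 => MultilinearMap.constOfIsEmpty K _ Δ
  | k + 1 => (br.compMultilinearMap (iteratedBracket br Δ k)).uncurryRight

theorem iteratedBracket_succ (br : A →ₗ[K] A →ₗ[K] A) (Δ : A) (k : ℕ) (a : Fin (k + 1) → A) :
    iteratedBracket br Δ (k + 1) a =
      br (iteratedBracket br Δ k (fun i => a i.castSucc)) (a (Fin.last k)) := rfl

/-- The Koszul sign `ε(σ) = ε(σ; x₁, …, xₙ)` for homogeneous elements of degrees `d₁, …, dₙ`,
defined by `x_{σ(1)} ⊙ ⋯ ⊙ x_{σ(n)} = ε(σ) x₁ ⊙ ⋯ ⊙ xₙ`: every inversion `i < j`,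
`σ(j) < σ(i)` contributes `(-1)^{d_{σ(i)} d_{σ(j)}}`. -/
def koszulSign {n : ℕ} (d : Fin n → ℤ) (σ : Equiv.Perm (Fin n)) : ℤˣ :=
  ∏ i : Fin n, ∏ j : Fin n, if i < j ∧ σ j < σ i then (d (σ i) * d (σ j)).negOnePow else 1

/-- `(A, {l_k}_{k ≥ 1})` with `A = ⨁_{k ∈ ℤ} 𝒜 k` is an `L_∞`-algebra, with all `l_k` graded
symmetric of degree `1`. (The map `l 0` plays no role.) In `jacobi`, the inner bracket has `i + 1`
arguments and the outer one has `n - i`. -/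
structure IsLInftyAlgebra (𝒜 : ℤ → Submodule K A)
    (l : (k : ℕ) → MultilinearMap K (fun _ : Fin k => A) A) : Prop where
  internal : DirectSum.IsInternal 𝒜
  degree : ∀ n : ℕ, 1 ≤ n → ∀ (d : Fin n → ℤ) (x : Fin n → A), (∀ i, x i ∈ 𝒜 (d i)) →
    l n x ∈ 𝒜 ((∑ i, d i) + 1)
  symm : ∀ n : ℕ, 1 ≤ n → ∀ (d : Fin n → ℤ) (x : Fin n → A), (∀ i, x i ∈ 𝒜 (d i)) →
    ∀ σ : Equiv.Perm (Fin n), l n (fun i => x (σ i)) = koszulSign d σ • l n x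
  jacobi : ∀ n : ℕ, 1 ≤ n → ∀ (d : Fin n → ℤ) (x : Fin n → A), (∀ i, x i ∈ 𝒜 (d i)) →
    ∑ i : Fin n, ∑ σ ∈ unshuffles n (i + 1), koszulSign d σ •
      l (n - i) (fun r : Fin (n - i) =>
        if (r : ℕ) = 0 then l (i + 1) (fun s : Fin (i + 1) => x (σ ⟨s, by omega⟩))
        else x (σ ⟨i + r, by omega⟩)) = 0

end Graded

section CrossedHomomorphisms

variable {K g h : Type*} [Field K] [AddCommGroup g] [Module K g] [AddCommGroup h] [Module K h]

/-- `Δ = π + ρ + μ` as an element of degree `1` of `C^*(g ⊕ h, g ⊕ h)`. -/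
noncomputable def delta (π : g [⋀^Fin 3]→ₗ[K] g) (ρ : g [⋀^Fin 2]→ₗ[K] Module.End K h)
    (μ : h [⋀^Fin 3]→ₗ[K] h) : CochainSum K (g × h) (g × h) :=
  DirectSum.lof K ℕ (fun n => Cochain K n (g × h) (g × h)) 1 (ofAlternating (semidirect π ρ μ))

/-- The higher derived brackets `l_k(a₁, …, a_k) = 𝒫[⋯[[Δ, a₁], a₂], ⋯, a_k]` on `C^*(g, h)`, the
element `𝒫(⋯)` of the subspace `C^*(g, h)` being read off through `restrict`. -/
noncomputable def derivedBracket (π : g [⋀^Fin 3]→ₗ[K] g)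
    (ρ : g [⋀^Fin 2]→ₗ[K] Module.End K h) (μ : h [⋀^Fin 3]→ₗ[K] h) (k : ℕ) :
    MultilinearMap K (fun _ : Fin k => CochainSum K g h) (CochainSum K g h) :=
  (restrict K g h).compMultilinearMap
    ((iteratedBracket (bracket (g × h)) (delta π ρ μ) k).compLinearMap fun _ => embed K g h)

end CrossedHomomorphisms

end ThreeLie

/-!
Work first with cochains that need not be alternating. Such a cochain is determined by its value in
degree `0` together with its contractions with the elements of `∧²V`, and a contraction of `P ∘ Q`
is a combination of `P ∘ Q_X`, `P_X ∘ Q` and, for `Q` of degree `0`, the contraction of `P` with the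
image of `X` under `Q`. By induction on the degree the associator of `∘` is graded symmetric in its
last two arguments, so the graded commutator is a graded Lie bracket.

`Δ` is the structure of the semidirect product 3-Lie algebra, and `[Δ, Δ] = 0` is its fundamental
identity. Bracketing with the projection of `g ⊕ h` onto `h` is a derivation, whose eigenvalue, the
weight, counts outputs in `h` minus inputs from `h`. Cochains in `F` have weight `1`, `π + ρ` has
weight `0`, `μ` has weight `-2`, no nonzero cochain has weight above `1`, and `𝒫` is the projection
onto weight `1`. Hence among the derived brackets only `l₁`, from `π + ρ`, and `l₃`, from `μ`,
survive.

The `L_∞` relations are Voronov's: expand `[⋯[[Δ, Δ], a₁], ⋯, aₙ] = 0` by the Leibniz rule and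
apply `𝒫`. As `F` is abelian and `ker 𝒫` a subalgebra, `𝒫[x, y] = 𝒫[𝒫x, y] + 𝒫[x, 𝒫y]`, and the two
resulting sums agree, so each of them vanishes.
-/

namespace ThreeLie

/-! ### Sums over unshuffles -/

section InsertZero

variable {n : ℕ}

/-- The permutation of `n + 1` letters that puts the smallest letter `0` at position `a` and is
given by `τ` on the other positions. It turns sums over unshuffles into recursions on `n`. -/
def insertZero (a : Fin (n + 1)) (τ : Equiv.Perm (Fin n)) : Equiv.Perm (Fin (n + 1)) :=
  (finSuccEquiv' a).trans ((Equiv.optionCongr τ).trans (finSuccEquiv' 0).symm)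

theorem insertZero_self (a : Fin (n + 1)) (τ : Equiv.Perm (Fin n)) : insertZero a τ a = 0 := by
  simp [insertZero]

theorem insertZero_succAbove (a : Fin (n + 1)) (τ : Equiv.Perm (Fin n)) (i : Fin n) :
    insertZero a τ (a.succAbove i) = (τ i).succ := by
  simp [insertZero]

theorem insertZero_of_lt (a : Fin (n + 1)) (τ : Equiv.Perm (Fin n)) (i : Fin n)
    (h : (i : ℕ) < a) : insertZero a τ i.castSucc = (τ i).succ := by
  rw [← insertZero_succAbove a, Fin.succAbove_of_castSucc_lt _ _ h]

theorem insertZero_of_le (a : Fin (n + 1)) (τ : Equiv.Perm (Fin n)) (i : Fin n)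
    (h : (a : ℕ) ≤ i) : insertZero a τ i.succ = (τ i).succ := by
  rw [← insertZero_succAbove a, Fin.succAbove_of_le_castSucc _ _ h]

theorem sign_insertZero (a : Fin (n + 1)) (τ : Equiv.Perm (Fin n)) :
    Equiv.Perm.sign (insertZero a τ) = (-1) ^ (a : ℕ) * Equiv.Perm.sign τ := by
  have move_to_front : insertZero a τ = insertZero 0 τ * a.cycleRange := by
    ext i
    rcases eq_or_ne i a with rfl | hi
    · rw [Equiv.Perm.mul_apply, Fin.cycleRange_self, insertZero_self, insertZero_self]
    · obtain ⟨j, rfl⟩ := Fin.exists_succAbove_eq hi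
      rw [Equiv.Perm.mul_apply, Fin.cycleRange_succAbove, insertZero_succAbove,
        ← Fin.succAbove_zero_apply j, insertZero_succAbove]
  have sign_zero : Equiv.Perm.sign (insertZero 0 τ) = Equiv.Perm.sign τ := by
    rw [← Equiv.optionCongr_sign τ]
    exact Equiv.Perm.sign_trans_trans_symm (Equiv.optionCongr τ) (finSuccEquiv' 0)
  rw [move_to_front, Equiv.Perm.sign_mul, sign_zero, Fin.sign_cycleRange, mul_comm]

theorem insertZero_injective (a : Fin (n + 1)) :
    Function.Injective (insertZero a : Equiv.Perm (Fin n) → Equiv.Perm (Fin (n + 1))) := by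
  intro τ τ' h
  ext i : 1
  rw [← Fin.succ_inj, ← insertZero_succAbove a, ← insertZero_succAbove a, h]

theorem exists_insertZero_eq {a : Fin (n + 1)} {σ : Equiv.Perm (Fin (n + 1))} (h : σ a = 0) :
    ∃ τ, insertZero a τ = σ := by
  let e : Equiv.Perm (Option (Fin n)) :=
    (finSuccEquiv' a).symm.trans (σ.trans (finSuccEquiv' 0))
  have he : e none = none := by simp [e, h]
  refine ⟨Equiv.removeNone e, ?_⟩
  have congr_removeNone : Equiv.optionCongr (Equiv.removeNone e) = e := by
    rw [map_equiv_removeNone, he, Equiv.swap_self]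
    exact one_mul e
  ext1 i
  simp [insertZero, congr_removeNone, e]

end InsertZero

section SumUnshuffles

variable {n k : ℕ}

theorem mem_unshuffles {σ : Equiv.Perm (Fin n)} : σ ∈ unshuffles n k ↔ IsUnshuffle k σ := by
  simp [unshuffles]

theorem insertZero_zero_mem_unshuffles (τ : Equiv.Perm (Fin n)) :
    insertZero 0 τ ∈ unshuffles (n + 1) (k + 1) ↔ τ ∈ unshuffles n k := by
  have insertZero_zero_succ : ∀ i, insertZero 0 τ (Fin.succ i) = (τ i).succ := fun i =>
    insertZero_of_le 0 τ i (Nat.zero_le i)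
  simp [mem_unshuffles, IsUnshuffle, Fin.forall_fin_succ, insertZero_self, insertZero_zero_succ]

theorem insertZero_mem_unshuffles (a : Fin (n + 1)) (τ : Equiv.Perm (Fin n)) :
    insertZero a τ ∈ unshuffles (n + 1) a ↔ τ ∈ unshuffles n a := by
  have val_lt : ∀ i, (a.succAbove i : ℕ) < a ↔ (i : ℕ) < a := fun i =>
    Fin.succAbove_lt_iff_castSucc_lt a i
  have le_val : ∀ i, (a : ℕ) ≤ a.succAbove i ↔ (a : ℕ) ≤ i := fun i => by
    simpa only [not_lt] using (val_lt i).not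
  simp only [mem_unshuffles, IsUnshuffle, Fin.forall_iff_succAbove a, insertZero_self,
    insertZero_succAbove, Fin.succAbove_lt_succAbove_iff, Fin.succ_lt_succ_iff, Fin.succ_pos,
    val_lt, le_val, lt_irrefl, le_refl, forall_const, imp_true_iff, true_and,
    false_imp_iff]
  exact and_congr_right fun _ => ⟨fun h i => (h i).2, fun h i =>
    ⟨fun hlt hle => absurd ((val_lt i).1 hlt) hle.not_gt, h i⟩⟩

theorem apply_zero_eq_zero_or_apply_eq_zero {σ : Equiv.Perm (Fin (n + 1))}
    (hσ : σ ∈ unshuffles (n + 1) k) : (0 < k ∧ σ 0 = 0) ∨ ∃ h : k < n + 1, σ ⟨k, h⟩ = 0 := by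
  rw [mem_unshuffles] at hσ
  obtain ⟨r, hr⟩ := σ.surjective 0
  have not_lt : ∀ s, ¬ σ s < σ r := by simp [hr]
  rcases lt_or_ge (r : ℕ) k with hrk | hrk
  · obtain rfl : r = 0 := by
      by_contra hne
      exact not_lt 0 (hσ.1 0 r (Fin.pos_of_ne_zero hne) hrk)
    exact Or.inl ⟨hrk, hr⟩
  · have hk : k < n + 1 := hrk.trans_lt r.isLt
    obtain rfl : r = ⟨k, hk⟩ := by
      by_contra hne
      exact not_lt ⟨k, hk⟩ (hσ.2 ⟨k, hk⟩ r (lt_of_le_of_ne hrk (Ne.symm hne)) le_rfl)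
    exact Or.inr ⟨hk, hr⟩

variable {M : Type*} [AddCommMonoid M] (F : Equiv.Perm (Fin (n + 1)) → M)

theorem sum_filter_apply_eq_zero {S : Finset (Equiv.Perm (Fin (n + 1)))}
    {T : Finset (Equiv.Perm (Fin n))} (a : Fin (n + 1)) (h : ∀ τ, insertZero a τ ∈ S ↔ τ ∈ T) :
    ∑ σ ∈ S with σ a = 0, F σ = ∑ τ ∈ T, F (insertZero a τ) := by
  symm
  refine Finset.sum_bij (fun τ _ => insertZero a τ) (fun τ hτ => ?_)
    (fun _ _ _ _ hττ' => insertZero_injective a hττ') (fun σ hσ => ?_) fun _ _ => rfl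
  · exact Finset.mem_filter.2 ⟨(h τ).2 hτ, insertZero_self a τ⟩
  · rw [Finset.mem_filter] at hσ
    obtain ⟨τ, rfl⟩ := exists_insertZero_eq hσ.2
    exact ⟨τ, (h τ).1 hσ.1, rfl⟩

theorem sum_unshuffles_zero_right :
    ∑ σ ∈ unshuffles (n + 1) 0, F σ = ∑ τ ∈ unshuffles n 0, F (insertZero 0 τ) := by
  have h := sum_filter_apply_eq_zero F 0 (insertZero_mem_unshuffles (n := n) 0)
  rw [Finset.filter_true_of_mem] at h
  · exact h
  · intro σ hσ
    rcases apply_zero_eq_zero_or_apply_eq_zero hσ with ⟨h, _⟩ | ⟨_, h⟩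
    exacts [absurd h (lt_irrefl 0), h]

theorem sum_unshuffles_self :
    ∑ σ ∈ unshuffles (n + 1) (n + 1), F σ = ∑ τ ∈ unshuffles n n, F (insertZero 0 τ) := by
  rw [← sum_filter_apply_eq_zero F 0 insertZero_zero_mem_unshuffles, Finset.filter_true_of_mem]
  intro σ hσ
  rcases apply_zero_eq_zero_or_apply_eq_zero hσ with ⟨_, h⟩ | ⟨h, _⟩
  exacts [h, absurd h (lt_irrefl _)]

theorem sum_unshuffles_succ (hk : k + 1 < n + 1) :
    ∑ σ ∈ unshuffles (n + 1) (k + 1), F σ = ∑ τ ∈ unshuffles n k, F (insertZero 0 τ) +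
      ∑ τ ∈ unshuffles n (k + 1), F (insertZero ⟨k + 1, hk⟩ τ) := by
  rw [← Finset.sum_filter_add_sum_filter_not _ (fun σ : Equiv.Perm (Fin (n + 1)) => σ 0 = 0),
    sum_filter_apply_eq_zero F 0 insertZero_zero_mem_unshuffles,
    ← sum_filter_apply_eq_zero F ⟨k + 1, hk⟩ (insertZero_mem_unshuffles ⟨k + 1, hk⟩)]
  congr 2
  refine Finset.filter_congr fun σ hσ => ⟨fun hne => ?_, fun h h0 => ?_⟩
  · exact (apply_zero_eq_zero_or_apply_eq_zero hσ).elim (fun h => absurd h.2 hne) fun h => h.2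
  · exact Fin.ne_of_lt (Fin.succ_pos ⟨k, Nat.lt_of_succ_lt_succ hk⟩) (σ.injective (h0.trans h.symm))

end SumUnshuffles

/-! ### The circle product of two cochains, one argument at a time -/

section UnshuffleSum

variable {X M : Type*} [AddCommGroup M]

/-- The sequence `s` with its first `n` terms permuted by `σ`. -/
def permuteSeq {n : ℕ} (σ : Equiv.Perm (Fin n)) (s : ℕ → X) (i : ℕ) : X :=
  if h : i < n then s (σ ⟨i, h⟩) else s i

/-- The sequence `t` with `x` inserted at position `a`. -/
def insertSeq (a : ℕ) (x : X) (t : ℕ → X) (i : ℕ) : X :=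
  if i < a then t i else if i = a then x else t (i - 1)

theorem insertSeq_self (a : ℕ) (x : X) (t : ℕ → X) : insertSeq a x t a = x := by
  simp [insertSeq]

theorem insertSeq_of_lt {a i : ℕ} (h : i < a) (x : X) (t : ℕ → X) : insertSeq a x t i = t i := by
  simp [insertSeq, h]

theorem insertSeq_succ {a i : ℕ} (h : a ≤ i) (x : X) (t : ℕ → X) :
    insertSeq a x t (i + 1) = t i := by
  simp [insertSeq, show ¬ i + 1 < a by omega, show i + 1 ≠ a by omega]

theorem permuteSeq_insertZero {n : ℕ} (a : Fin (n + 1)) (τ : Equiv.Perm (Fin n)) (s : ℕ → X) :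
    permuteSeq (insertZero a τ) s = insertSeq a (s 0) (permuteSeq τ fun i => s (i + 1)) := by
  funext i
  rcases lt_trichotomy i (a : ℕ) with h | rfl | h
  · have hi : i < n := by omega
    rw [insertSeq_of_lt h, permuteSeq, permuteSeq, dif_pos (by omega), dif_pos hi]
    exact congrArg (fun j : Fin (n + 1) => s j) (insertZero_of_lt a τ ⟨i, hi⟩ h)
  · rw [insertSeq_self, permuteSeq, dif_pos a.isLt, Fin.eta, insertZero_self, Fin.val_zero]
  · obtain ⟨i, rfl⟩ := Nat.exists_eq_add_of_lt (Nat.zero_lt_of_lt h)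
    rw [zero_add] at h ⊢
    rw [insertSeq_succ (Nat.lt_succ_iff.1 h), permuteSeq, permuteSeq]
    by_cases hi : i < n
    · rw [dif_pos (Nat.succ_lt_succ hi), dif_pos hi]
      exact congrArg (fun j : Fin (n + 1) => s j)
        (insertZero_of_le a τ ⟨i, hi⟩ (Nat.lt_succ_iff.1 h))
    · rw [dif_neg fun hi' => hi (Nat.lt_of_succ_lt_succ hi'), dif_neg hi]

/-- The signed sum `∑_{σ ∈ S(k, q)} (-1)^σ Φ(s_{σ(0)}, …, s_{σ(k+q-1)}, s_{k+q}, …)`. -/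
noncomputable def unshuffleSum (k q : ℕ) (Φ : (ℕ → X) → M) (s : ℕ → X) : M :=
  ∑ σ ∈ unshuffles (k + q) k, Equiv.Perm.sign σ • Φ (permuteSeq σ s)

theorem unshuffleSum_zero_zero (Φ : (ℕ → X) → M) (s : ℕ → X) : unshuffleSum 0 0 Φ s = Φ s := by
  have unshuffles_eq : unshuffles 0 0 = {1} := by
    ext σ
    simp [mem_unshuffles, IsUnshuffle, Subsingleton.elim σ 1]
  have permuteSeq_one : permuteSeq (1 : Equiv.Perm (Fin 0)) s = s := by
    funext i
    exact dif_neg (Nat.not_lt_zero i)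
  rw [unshuffleSum, show 0 + 0 = 0 from rfl, unshuffles_eq, Finset.sum_singleton,
    Equiv.Perm.sign_one, one_smul, permuteSeq_one]

theorem unshuffleSum_zero_succ (q : ℕ) (Φ : (ℕ → X) → M) (s : ℕ → X) :
    unshuffleSum 0 (q + 1) Φ s =
      unshuffleSum 0 q (fun t => Φ (insertSeq 0 (s 0) t)) (fun i => s (i + 1)) := by
  simp only [unshuffleSum]
  rw [show 0 + (q + 1) = 0 + q + 1 from rfl, sum_unshuffles_zero_right]
  simp only [sign_insertZero, permuteSeq_insertZero, Fin.val_zero, pow_zero, one_mul]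

theorem unshuffleSum_succ_zero (k : ℕ) (Φ : (ℕ → X) → M) (s : ℕ → X) :
    unshuffleSum (k + 1) 0 Φ s =
      unshuffleSum k 0 (fun t => Φ (insertSeq 0 (s 0) t)) (fun i => s (i + 1)) := by
  simp only [unshuffleSum, sum_unshuffles_self, sign_insertZero, permuteSeq_insertZero,
    Fin.val_zero, pow_zero, one_mul]
  rfl

theorem unshuffleSum_succ_succ (k q : ℕ) (Φ : (ℕ → X) → M) (s : ℕ → X) :
    unshuffleSum (k + 1) (q + 1) Φ s =
      unshuffleSum k (q + 1) (fun t => Φ (insertSeq 0 (s 0) t)) (fun i => s (i + 1)) +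
        (-1 : ℤ) ^ (k + 1) •
          unshuffleSum (k + 1) q (fun t => Φ (insertSeq (k + 1) (s 0) t)) fun i => s (i + 1) := by
  simp only [unshuffleSum]
  rw [show k + 1 + (q + 1) = k + 1 + q + 1 from rfl, sum_unshuffles_succ _ (by omega),
    show k + (q + 1) = k + 1 + q by omega]
  simp only [sign_insertZero, permuteSeq_insertZero, Fin.val_zero, pow_zero, one_mul,
    Finset.smul_sum, mul_smul, Units.smul_def, Units.val_pow_eq_pow_val, Units.val_neg,
    Units.val_one]

end UnshuffleSum

section Recursion

variable {K V : Type*} [Field K] [AddCommGroup V] [Module K V]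

/-- The value of a cochain on the first terms of a sequence. -/
def onSeq {n : ℕ} (P : PreCochain K n V V) (s : ℕ → ⋀[K]^2 V) : V →ₗ[K] V :=
  P fun i => s i

/-- The summand of the circle product in which `Q` is inserted into the `k`-th wedge factor, for
arguments that are already permuted. -/
noncomputable def wedgeTerm {p q : ℕ} (P : PreCochain K p V V) (Q : PreCochain K q V V) (k : Fin p)
    (t : ℕ → ⋀[K]^2 V) : V →ₗ[K] V :=
  P (Function.update (fun i : Fin p => t (if (i : ℕ) < k then i else i + q)) k
    (wedgeDerivation (Q fun j : Fin q => t (k + j)) (t (k + q))))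

/-- The summand of the circle product in which `Q` is inserted into the last argument, for
arguments that are already permuted. -/
def lastTerm {p q : ℕ} (P : PreCochain K p V V) (Q : PreCochain K q V V)
    (t : ℕ → ⋀[K]^2 V) : V →ₗ[K] V :=
  (P fun i : Fin p => t i) ∘ₗ (Q fun j : Fin q => t (p + j))

theorem onSeq_preCircle {p q : ℕ} (P : PreCochain K p V V) (Q : PreCochain K q V V)
    (s : ℕ → ⋀[K]^2 V) :
    onSeq (preCircle P Q) s =
      ∑ k : Fin p, (-1 : ℤ) ^ ((k : ℕ) * q) • unshuffleSum k q (wedgeTerm P Q k) s +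
        (-1 : ℤ) ^ (p * q) • unshuffleSum p q (lastTerm P Q) s := by
  have apply_inl : ∀ {k : ℕ} (hk : k ≤ p) (σ : Equiv.Perm (Fin (k + q))) (j : Fin q),
      s (slotEquiv hk σ (Sum.inl j)) = permuteSeq σ s (k + j) := fun hk σ j => by
    rw [slotEquiv_inl, permuteSeq, dif_pos]
  have apply_inr : ∀ {k : ℕ} (hk : k ≤ p) (σ : Equiv.Perm (Fin (k + q))) (i : Fin p),
      s (slotEquiv hk σ (Sum.inr i)) = permuteSeq σ s (if (i : ℕ) < k then i else i + q) := by
    intro k hk σ i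
    split_ifs with h
    · rw [slotEquiv_inr_lt _ _ _ h, permuteSeq, dif_pos]
    · rw [slotEquiv_inr_ge _ _ _ h, permuteSeq, dif_neg (by omega)]
  ext x
  simp only [onSeq, preCircle_apply, unshuffleSum, wedgeTerm, lastTerm, LinearMap.add_apply,
    LinearMap.sum_apply, LinearMap.smul_apply, apply_inl, apply_inr, lt_irrefl,
    if_false, LinearMap.comp_apply, Fin.is_lt, if_true]

theorem insertSeq_zero_fin (p : ℕ) (X : ⋀[K]^2 V) (t : ℕ → ⋀[K]^2 V) :
    (fun i : Fin (p + 1) => insertSeq 0 X t i) = Fin.cons X fun i : Fin p => t i := by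
  funext i
  refine Fin.cases ?_ (fun i => ?_) i
  · exact insertSeq_self 0 X t
  · exact insertSeq_succ (Nat.zero_le _) X t

theorem wedgeTerm_succ_insertSeq_zero {p q : ℕ} (P : PreCochain K (p + 1) V V)
    (Q : PreCochain K q V V) (k : Fin p) (X : ⋀[K]^2 V) (t : ℕ → ⋀[K]^2 V) :
    wedgeTerm P Q k.succ (insertSeq 0 X t) = wedgeTerm (P.curryLeft X) Q k t := by
  have shift : ∀ j : ℕ, insertSeq 0 X t (k.succ + j) = t (k + j) := fun j => by
    rw [Fin.val_succ, add_right_comm, insertSeq_succ (Nat.zero_le _)]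
  simp only [wedgeTerm, MultilinearMap.curryLeft_apply, Fin.cons_update, shift]
  congr 2
  funext i
  refine Fin.cases ?_ (fun i => ?_) i
  · simp [insertSeq_self]
  · simp only [Fin.cons_succ, Fin.val_succ, add_lt_add_iff_right, add_right_comm _ 1 q,
      ← apply_ite (· + 1), insertSeq_succ (Nat.zero_le _)]

theorem wedgeTerm_insertSeq {p q : ℕ} (P : PreCochain K p V V) (Q : PreCochain K (q + 1) V V)
    (k : Fin p) (X : ⋀[K]^2 V) (t : ℕ → ⋀[K]^2 V) :
    wedgeTerm P Q k (insertSeq k X t) = wedgeTerm P (Q.curryLeft X) k t := by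
  have args_Q : (fun j : Fin (q + 1) => insertSeq k X t (k + j)) =
      Fin.cons X fun j : Fin q => t (k + j) := by
    funext j
    refine Fin.cases ?_ (fun j => ?_) j
    · exact insertSeq_self k X t
    · exact insertSeq_succ (Nat.le_add_right _ _) X t
  have args_P : (fun i : Fin p => insertSeq k X t (if (i : ℕ) < k then i else i + (q + 1))) =
      fun i : Fin p => t (if (i : ℕ) < k then i else i + q) := by
    funext i
    split_ifs with h
    · exact insertSeq_of_lt h X t
    · exact insertSeq_succ (show (k : ℕ) ≤ i + q by omega) X t
  rw [wedgeTerm, args_Q, args_P, ← add_assoc, insertSeq_succ (Nat.le_add_right _ _)]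
  rfl

theorem lastTerm_insertSeq_zero {p q : ℕ} (P : PreCochain K (p + 1) V V) (Q : PreCochain K q V V)
    (X : ⋀[K]^2 V) (t : ℕ → ⋀[K]^2 V) :
    lastTerm P Q (insertSeq 0 X t) = lastTerm (P.curryLeft X) Q t := by
  have shift : ∀ j : ℕ, insertSeq 0 X t (p + 1 + j) = t (p + j) := fun j => by
    rw [add_right_comm, insertSeq_succ (Nat.zero_le _)]
  simp only [lastTerm, shift, insertSeq_zero_fin, MultilinearMap.curryLeft_apply]

theorem lastTerm_insertSeq {p q : ℕ} (P : PreCochain K p V V) (Q : PreCochain K (q + 1) V V)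
    (X : ⋀[K]^2 V) (t : ℕ → ⋀[K]^2 V) :
    lastTerm P Q (insertSeq p X t) = lastTerm P (Q.curryLeft X) t := by
  have args_Q : (fun j : Fin (q + 1) => insertSeq p X t (p + j)) =
      Fin.cons X fun j : Fin q => t (p + j) := by
    funext j
    refine Fin.cases ?_ (fun j => ?_) j
    · exact insertSeq_self p X t
    · exact insertSeq_succ (Nat.le_add_right _ _) X t
  simp only [lastTerm, args_Q, insertSeq_of_lt (Fin.is_lt _), MultilinearMap.curryLeft_apply]

theorem onSeq_preCircle_zero_zero (P Q : PreCochain K 0 V V) (s : ℕ → ⋀[K]^2 V) :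
    onSeq (preCircle P Q) s = onSeq P s ∘ₗ onSeq Q s := by
  rw [onSeq_preCircle, Fin.sum_univ_zero, unshuffleSum_zero_zero, mul_zero, pow_zero, one_smul,
    zero_add, lastTerm, onSeq, onSeq]
  congr 1
  exact congrArg Q (Subsingleton.elim _ _)

theorem onSeq_preCircle_zero_succ {q : ℕ} (P : PreCochain K 0 V V)
    (Q : PreCochain K (q + 1) V V) (s : ℕ → ⋀[K]^2 V) :
    onSeq (preCircle P Q) s = onSeq (preCircle P (Q.curryLeft (s 0))) fun i => s (i + 1) := by
  rw [onSeq_preCircle, onSeq_preCircle, Fin.sum_univ_zero, Fin.sum_univ_zero, zero_mul, zero_mul,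
    unshuffleSum_zero_succ]
  simp only [lastTerm_insertSeq]

theorem onSeq_preCircle_succ_zero {p : ℕ} (P : PreCochain K (p + 1) V V)
    (Q : PreCochain K 0 V V) (s : ℕ → ⋀[K]^2 V) :
    onSeq (preCircle P Q) s = onSeq (preCircle (P.curryLeft (s 0)) Q) (fun i => s (i + 1)) +
      onSeq (P.curryLeft (wedgeDerivation (onSeq Q s) (s 0))) (fun i => s (i + 1)) := by
  have first_wedgeTerm : wedgeTerm P Q 0 s =
      onSeq (P.curryLeft (wedgeDerivation (onSeq Q s) (s 0))) (fun i => s (i + 1)) := by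
    simp only [wedgeTerm, onSeq, Fin.val_zero, not_lt_zero, if_false, add_zero,
      MultilinearMap.curryLeft_apply]
    congr 1
    funext i
    refine Fin.cases ?_ (fun i => ?_) i <;> simp
  rw [onSeq_preCircle, onSeq_preCircle, Fin.sum_univ_succ, add_comm _ (onSeq (P.curryLeft _) _),
    ← first_wedgeTerm, add_assoc]
  simp only [Fin.val_zero, Fin.val_succ, mul_zero, pow_zero, one_smul, unshuffleSum_zero_zero,
    unshuffleSum_succ_zero, wedgeTerm_succ_insertSeq_zero, lastTerm_insertSeq_zero]

theorem onSeq_preCircle_succ_succ {p q : ℕ} (P : PreCochain K (p + 1) V V)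
    (Q : PreCochain K (q + 1) V V) (s : ℕ → ⋀[K]^2 V) :
    onSeq (preCircle P Q) s = onSeq (preCircle P (Q.curryLeft (s 0))) (fun i => s (i + 1)) +
      (-1 : ℤ) ^ (q + 1) • onSeq (preCircle (P.curryLeft (s 0)) Q) (fun i => s (i + 1)) := by
  have sign_left : ∀ k : ℕ,
      (-1 : ℤ) ^ ((k + 1) * (q + 1)) = (-1) ^ (q + 1) * (-1) ^ (k * (q + 1)) := fun k => by ring
  have sign_right : ∀ k : ℕ,
      (-1 : ℤ) ^ ((k + 1) * (q + 1)) * (-1) ^ (k + 1) = (-1) ^ ((k + 1) * q) := fun k => by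
    rw [mul_add_one, pow_add, mul_assoc, ← mul_pow, neg_one_mul, neg_neg, one_pow, mul_one]
  have wedgeTerm_succ : ∀ (k : Fin p) t, wedgeTerm P Q k.succ (insertSeq (k + 1) (s 0) t) =
      wedgeTerm P (Q.curryLeft (s 0)) k.succ t := fun k => wedgeTerm_insertSeq P Q k.succ (s 0)
  have wedgeTerm_zero : ∀ t, wedgeTerm P Q 0 (insertSeq 0 (s 0) t) =
      wedgeTerm P (Q.curryLeft (s 0)) 0 t := wedgeTerm_insertSeq P Q 0 (s 0)
  rw [onSeq_preCircle, onSeq_preCircle, onSeq_preCircle, Fin.sum_univ_succ, Fin.sum_univ_succ]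
  simp only [Fin.val_zero, Fin.val_succ, unshuffleSum_succ_succ, unshuffleSum_zero_succ,
    wedgeTerm_succ_insertSeq_zero, wedgeTerm_succ, wedgeTerm_zero, lastTerm_insertSeq_zero,
    lastTerm_insertSeq, smul_add, Finset.sum_add_distrib, smul_smul, sign_right, Finset.smul_sum]
  simp only [sign_left, zero_mul, pow_zero]
  abel

end Recursion

/-! ### The graded pre-Lie identity -/

section PreLie

variable (K V : Type*) [Field K] [AddCommGroup V] [Module K V]

/-- The direct sum of the spaces `Hom(∧²V ⊗ ⋯ ⊗ ∧²V ⊗ V, V)`. -/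
abbrev PreSum : Type _ := DirectSum ℕ (fun n => PreCochain K n V V)

variable {K V}

noncomputable instance : AddCommGroup (PreSum K V) := inferInstance

noncomputable instance : Module K (PreSum K V) := inferInstance

/-- The cochain `P` of degree `n`, as an element of the direct sum. -/
abbrev single (n : ℕ) (P : PreCochain K n V V) : PreSum K V :=
  DirectSum.lof K ℕ (fun n => PreCochain K n V V) n P

/-- A cochain regarded as a cochain of an equal degree. -/
def castDegree {a b : ℕ} (h : a = b) (P : PreCochain K a V V) : PreCochain K b V V :=
  P.domDomCongr (finCongr h)

theorem onSeq_castDegree {a b : ℕ} (h : a = b) (P : PreCochain K a V V) (s : ℕ → ⋀[K]^2 V) :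
    onSeq (castDegree h P) s = onSeq P s := rfl

theorem single_castDegree {a b : ℕ} (h : a = b) (P : PreCochain K a V V) :
    single b (castDegree h P) = single a P := by
  subst h
  rfl

theorem onSeq_add {a : ℕ} (P Q : PreCochain K a V V) (s : ℕ → ⋀[K]^2 V) :
    onSeq (P + Q) s = onSeq P s + onSeq Q s := rfl

theorem onSeq_zsmul {a : ℕ} (c : ℤ) (P : PreCochain K a V V) (s : ℕ → ⋀[K]^2 V) :
    onSeq (c • P) s = c • onSeq P s := rfl

theorem onSeq_ext {a : ℕ} {P Q : PreCochain K a V V} (h : ∀ s, onSeq P s = onSeq Q s) : P = Q := by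
  ext1 X
  have := h (fun i => if hi : i < a then X ⟨i, hi⟩ else 0)
  simpa [onSeq] using this

theorem onSeq_curryLeft {a : ℕ} (P : PreCochain K (a + 1) V V) (X : ⋀[K]^2 V)
    (s : ℕ → ⋀[K]^2 V) :
    onSeq (P.curryLeft X) s = onSeq P (fun i => Nat.casesOn i X s) := by
  simp only [onSeq, MultilinearMap.curryLeft_apply]
  congr 1
  funext i
  refine Fin.cases ?_ (fun i => ?_) i <;> rfl

/-- Insertion of `X` as the first argument. -/
noncomputable def contract (X : ⋀[K]^2 V) : PreSum K V →ₗ[K] PreSum K V :=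
  DirectSum.toModule K ℕ _ fun n => match n with
    | 0 => 0
    | n + 1 => DirectSum.lof K ℕ (fun n => PreCochain K n V V) n ∘ₗ
        { toFun := fun P => P.curryLeft X
          map_add' := fun _ _ => rfl
          map_smul' := fun _ _ => rfl }

theorem contract_single_zero (X : ⋀[K]^2 V) (P : PreCochain K 0 V V) :
    contract X (single 0 P) = 0 := by
  simp [contract]

theorem contract_single_succ (X : ⋀[K]^2 V) {n : ℕ} (P : PreCochain K (n + 1) V V) :
    contract X (single (n + 1) P) = single n (P.curryLeft X) := by
  rw [contract, single, DirectSum.toModule_lof]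
  rfl

theorem contract_apply (X : ⋀[K]^2 V) (f : PreSum K V) (n : ℕ) :
    contract X f n = (f (n + 1)).curryLeft X := by
  induction f using DirectSum.induction_on with
  | zero => rw [map_zero]; rfl
  | add f g hf hg => rw [map_add, DirectSum.add_apply, hf, hg]; rfl
  | of m P =>
    change contract X (single m P) n = (single m P (n + 1)).curryLeft X
    rcases m with _ | m
    · rw [contract_single_zero]
      rw [single, DirectSum.lof_eq_of, DirectSum.of_eq_of_ne _ _ _ (by omega)]
      rfl
    · rw [contract_single_succ]
      rcases eq_or_ne n m with rfl | h
      · rw [single, single, DirectSum.lof_apply, DirectSum.lof_apply]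
      · rw [single, single, DirectSum.lof_eq_of, DirectSum.lof_eq_of,
          DirectSum.of_eq_of_ne _ _ _ h, DirectSum.of_eq_of_ne _ _ _ (by omega)]
        rfl

theorem contract_add (X Y : ⋀[K]^2 V) (f : PreSum K V) :
    contract (X + Y) f = contract X f + contract Y f := by
  refine DFinsupp.ext fun n => ?_
  rw [DirectSum.add_apply, contract_apply, contract_apply, contract_apply, map_add]

theorem contract_zero (f : PreSum K V) : contract 0 f = 0 := by
  refine DFinsupp.ext fun n => ?_
  rw [contract_apply, map_zero]
  rfl

/-- The value of the component of degree `0`. -/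
def value : PreSum K V →ₗ[K] Module.End K V where
  toFun f := f 0 fun _ => 0
  map_add' _ _ := rfl
  map_smul' _ _ := rfl

theorem value_single_zero (P : PreCochain K 0 V V) (s : ℕ → ⋀[K]^2 V) :
    value (single 0 P) = onSeq P s := by
  change single 0 P 0 _ = _
  rw [single, DirectSum.lof_apply]
  exact congrArg P (Subsingleton.elim _ _)

theorem value_single_succ {n : ℕ} (P : PreCochain K (n + 1) V V) :
    value (single (n + 1) P) = 0 := by
  change single (n + 1) P 0 (fun _ => 0) = 0
  rw [single, DirectSum.lof_eq_of, DirectSum.of_eq_of_ne _ _ _ (by omega)]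
  rfl

theorem apply_zero_eq_of_value_eq {f g : PreSum K V} (h : value f = value g) : f 0 = g 0 := by
  ext1 X
  rw [Subsingleton.elim X fun _ => 0]
  exact h

theorem apply_succ_eq_of_contract_eq {f g : PreSum K V} {n : ℕ}
    (h : ∀ X, contract X f n = contract X g n) : f (n + 1) = g (n + 1) := by
  ext1 X
  have head := h (X 0)
  rw [contract_apply, contract_apply] at head
  rw [← Fin.cons_self_tail X, ← MultilinearMap.curryLeft_apply, head,
    MultilinearMap.curryLeft_apply]

theorem preSum_ext {f g : PreSum K V} (h0 : value f = value g)
    (h : ∀ X, contract X f = contract X g) : f = g := by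
  refine DFinsupp.ext fun n => ?_
  rcases n with _ | n
  · exact apply_zero_eq_of_value_eq h0
  · exact apply_succ_eq_of_contract_eq fun X => by rw [h X]

/-- The sign `(-1)ⁿ` in degree `n`. -/
noncomputable def signOp : PreSum K V →ₗ[K] PreSum K V :=
  DirectSum.lmap fun n => (-1 : ℤ) ^ n • LinearMap.id

theorem signOp_single {n : ℕ} (P : PreCochain K n V V) :
    signOp (single n P) = (-1 : ℤ) ^ n • single n P := by
  rw [signOp, single, DirectSum.lmap_lof, LinearMap.smul_apply, LinearMap.id_apply, map_zsmul]

/-- The circle product as a bilinear map. -/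
noncomputable def preCircleHom (p q : ℕ) :
    PreCochain K p V V →ₗ[K] PreCochain K q V V →ₗ[K] PreCochain K (p + q) V V :=
  LinearMap.mk₂ K preCircle
    (by
      intro P P' Q
      refine (MultilinearMap.ext fun X => LinearMap.ext fun x => ?_)
      simp only [add_apply, LinearMap.add_apply, preCircle_apply, smul_add,
        Finset.sum_add_distrib]
      abel)
    (by
      intro c P Q
      refine (MultilinearMap.ext fun X => LinearMap.ext fun x => ?_)
      simp only [smul_apply, LinearMap.smul_apply, preCircle_apply, smul_add,
        Finset.smul_sum, smul_comm c])
    (by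
      intro P Q Q'
      refine (MultilinearMap.ext fun X => LinearMap.ext fun x => ?_)
      simp only [add_apply, LinearMap.add_apply, preCircle_apply, smul_add,
        map_add, MultilinearMap.map_update_add, Finset.sum_add_distrib]
      abel)
    (by
      intro c P Q
      refine (MultilinearMap.ext fun X => LinearMap.ext fun x => ?_)
      simp only [smul_apply, LinearMap.smul_apply, preCircle_apply, smul_add,
        map_smul, MultilinearMap.map_update_smul, Finset.smul_sum, smul_comm c])

/-- The circle product on the direct sum. -/
noncomputable def circ : PreSum K V →ₗ[K] PreSum K V →ₗ[K] PreSum K V :=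
  DirectSum.toModule K ℕ _ fun p => LinearMap.flip <| DirectSum.toModule K ℕ _ fun q =>
    LinearMap.flip <|
      (preCircleHom p q).compr₂ (DirectSum.lof K ℕ (fun n => PreCochain K n V V) (p + q))

theorem circ_single {p q : ℕ} (P : PreCochain K p V V) (Q : PreCochain K q V V) :
    circ (single p P) (single q Q) = single (p + q) (preCircle P Q) := by
  simp only [circ, single, DirectSum.toModule_lof, LinearMap.flip_apply, LinearMap.compr₂_apply]
  rfl

theorem zsmul_apply (c : ℤ) (f : PreSum K V) (n : ℕ) : (c • f) n = c • f n :=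
  DFinsupp.zsmul_apply c f n

theorem preSum_induction {C : PreSum K V → Prop} (f : PreSum K V) (zero : C 0)
    (add : ∀ f g, C f → C g → C (f + g)) (single : ∀ n P, C (single n P)) : C f :=
  DirectSum.induction_on f zero single add

theorem circ_zsmul_left (c : ℤ) (P Q : PreSum K V) : circ (c • P) Q = c • circ P Q :=
  map_zsmul (circ.flip Q) c P

theorem value_circ (P Q : PreSum K V) : value (circ P Q) = value P * value Q := by
  induction P using preSum_induction with
  | zero => simp
  | add f g hf hg => simp only [map_add, LinearMap.add_apply, hf, hg, add_mul]
  | single p P =>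
    induction Q using preSum_induction with
    | zero => simp
    | add f g hf hg => simp only [map_add, hf, hg, mul_add]
    | single q Q =>
      rw [circ_single]
      rcases q with _ | q
      · rcases p with _ | p
        · rw [value_single_zero P fun _ => 0, value_single_zero Q fun _ => 0]
          exact (value_single_zero (preCircle P Q) fun _ => 0).trans
            (onSeq_preCircle_zero_zero P Q _)
        · rw [value_single_succ P, zero_mul]
          exact value_single_succ (preCircle P Q :)
      · rw [value_single_succ Q, mul_zero]
        exact value_single_succ (preCircle P Q :)

theorem contract_circ_single_zero_succ (X : ⋀[K]^2 V) {q : ℕ} (P : PreCochain K 0 V V)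
    (Q : PreCochain K (q + 1) V V) :
    contract X (circ (single 0 P) (single (q + 1) Q)) =
      circ (single 0 P) (single q (Q.curryLeft X)) := by
  rw [circ_single, circ_single]
  refine (contract_single_succ X (preCircle P Q :)).trans
    (congrArg (single (0 + q)) (onSeq_ext fun s => ?_))
  rw [onSeq_curryLeft]
  exact onSeq_preCircle_zero_succ P Q _

theorem contract_circ_single_succ_zero (X : ⋀[K]^2 V) {p : ℕ} (P : PreCochain K (p + 1) V V)
    (Q : PreCochain K 0 V V) :
    contract X (circ (single (p + 1) P) (single 0 Q)) =
      circ (single p (P.curryLeft X)) (single 0 Q) +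
        single p (P.curryLeft (wedgeDerivation (value (single 0 Q)) X)) := by
  rw [circ_single, circ_single]
  refine (contract_single_succ X (preCircle P Q :)).trans ?_
  change single p _ = single p _ + single p _
  rw [← map_add]
  refine congrArg (single p) (onSeq_ext fun s => ?_)
  rw [onSeq_curryLeft, onSeq_add, value_single_zero Q fun i => Nat.casesOn i X s]
  exact onSeq_preCircle_succ_zero P Q _

theorem contract_circ_single_succ_succ (X : ⋀[K]^2 V) {p q : ℕ} (P : PreCochain K (p + 1) V V)
    (Q : PreCochain K (q + 1) V V) :
    contract X (circ (single (p + 1) P) (single (q + 1) Q)) =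
      circ (single (p + 1) P) (single q (Q.curryLeft X)) +
        (-1 : ℤ) ^ (q + 1) • circ (single p (P.curryLeft X)) (single (q + 1) Q) := by
  rw [circ_single, circ_single, circ_single,
    ← single_castDegree (show p + (q + 1) = p + 1 + q by omega)]
  refine (contract_single_succ X (preCircle P Q :)).trans ?_
  rw [← map_zsmul, ← map_add]
  refine congrArg (single (p + 1 + q)) (onSeq_ext fun s => ?_)
  rw [onSeq_curryLeft, onSeq_add, onSeq_zsmul, onSeq_castDegree]
  exact onSeq_preCircle_succ_succ P Q _

theorem contract_circ (X : ⋀[K]^2 V) (P Q : PreSum K V) :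
    contract X (circ P Q) = circ P (contract X Q) + circ (contract X P) (signOp Q) +
      contract (wedgeDerivation (value Q) X) P := by
  induction P using preSum_induction with
  | zero => simp
  | add f g hf hg =>
    simp only [map_add, LinearMap.add_apply, hf, hg]
    abel
  | single p P =>
    induction Q using preSum_induction with
    | zero => simp [contract_zero]
    | add f g hf hg =>
      simp only [map_add, LinearMap.add_apply, hf, hg, contract_add]
      abel
    | single q Q =>
      rw [signOp_single]
      rcases q with _ | q <;> rcases p with _ | p
      · simp only [circ_single, contract_single_zero, map_zero, LinearMap.zero_apply, add_zero]
        exact contract_single_zero X (preCircle P Q)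
      · rw [contract_circ_single_succ_zero]
        simp only [contract_single_zero, contract_single_succ, map_zero, zero_add, pow_zero,
          one_smul]
      · rw [contract_circ_single_zero_succ]
        simp only [contract_single_zero, contract_single_succ, map_zero, LinearMap.zero_apply,
          add_zero]
      · rw [contract_circ_single_succ_succ]
        simp only [contract_single_succ, value_single_succ, map_zero, LinearMap.zero_apply,
          add_zero, map_zsmul]

theorem signOp_circ (P Q : PreSum K V) : signOp (circ P Q) = circ (signOp P) (signOp Q) := by
  induction P using preSum_induction with
  | zero => simp
  | add f g hf hg => simp only [map_add, LinearMap.add_apply, hf, hg]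
  | single p P =>
    induction Q using preSum_induction with
    | zero => simp
    | add f g hf hg => simp only [map_add, hf, hg]
    | single q Q =>
      rw [circ_single, signOp_single, signOp_single, signOp_single, map_zsmul,
        circ_zsmul_left, circ_single, smul_smul, pow_add, mul_comm]

theorem wedge_induction {C : ⋀[K]^2 V → Prop} (w : ⋀[K]^2 V) (zero : C 0)
    (add : ∀ a b, C a → C b → C (a + b)) (smul : ∀ (c : K) a, C a → C (c • a))
    (wedge : ∀ x y, C (exteriorPower.ιMulti K 2 ![x, y])) : C w := by
  have hw : w ∈ Submodule.span K (Set.range (exteriorPower.ιMulti K 2 (M := V))) := by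
    rw [exteriorPower.ιMulti_span]
    trivial
  induction hw using Submodule.span_induction with
  | mem x hx =>
    obtain ⟨v, rfl⟩ := hx
    have hv : v = ![v 0, v 1] := by ext i; fin_cases i <;> rfl
    rw [hv]
    exact wedge _ _
  | zero => exact zero
  | add x y _ _ hx hy => exact add x y hx hy
  | smul a x _ hx => exact smul a x hx

theorem wedgeDerivation_wedgeDerivation (φ ψ : Module.End K V) (X : ⋀[K]^2 V) :
    wedgeDerivation φ (wedgeDerivation ψ X) + wedgeDerivation (ψ * φ) X =
      wedgeDerivation ψ (wedgeDerivation φ X) + wedgeDerivation (φ * ψ) X := by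
  induction X using wedge_induction with
  | zero => simp
  | add a b ha hb =>
    simp only [map_add]
    calc _ = (wedgeDerivation φ (wedgeDerivation ψ a) + wedgeDerivation (ψ * φ) a) +
          (wedgeDerivation φ (wedgeDerivation ψ b) + wedgeDerivation (ψ * φ) b) := by abel
      _ = _ := by rw [ha, hb]; abel
  | smul c a ha => simp only [map_smul, ← smul_add, ha]
  | wedge x y =>
    simp only [wedgeDerivation_apply, map_add, Module.End.mul_apply]
    abel

/-- The associator of the circle product, which measures the failure of associativity. -/
noncomputable def assoc (P Q R : PreSum K V) : PreSum K V :=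
  circ (circ P Q) R - circ P (circ Q R)

/-- The part of `contract X (assoc P Q R)` in which `X` is met by the values of `Q` and `R`. -/
noncomputable def assocDefect (X : ⋀[K]^2 V) (P Q R : PreSum K V) : PreSum K V :=
  circ (contract (wedgeDerivation (value Q) X) P) (signOp R) +
    circ (contract (wedgeDerivation (value R) X) P) (signOp Q) +
    (contract (wedgeDerivation (value Q) (wedgeDerivation (value R) X)) P -
      contract (wedgeDerivation (value Q * value R) X) P)

theorem contract_assoc (X : ⋀[K]^2 V) (P Q R : PreSum K V) :
    contract X (assoc P Q R) = assoc P Q (contract X R) + assoc P (contract X Q) (signOp R) +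
      assoc (contract X P) (signOp Q) (signOp R) + assocDefect X P Q R := by
  simp only [assoc, assocDefect, map_sub, contract_circ, value_circ, signOp_circ, map_add,
    LinearMap.add_apply]
  abel

theorem assocDefect_comm (X : ⋀[K]^2 V) (P Q R : PreSum K V) :
    assocDefect X P Q R = assocDefect X P R Q := by
  rw [assocDefect, assocDefect, add_comm (circ _ (signOp R)), add_right_inj,
    sub_eq_sub_iff_add_eq_add, ← contract_add, ← contract_add, wedgeDerivation_wedgeDerivation]

theorem neg_one_pow_zsmul_assocDefect (X : ⋀[K]^2 V) (P : PreSum K V) {q r : ℕ}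
    (Q : PreCochain K q V V) (R : PreCochain K r V V) :
    (-1 : ℤ) ^ (q * r) • assocDefect X P (single q Q) (single r R) =
      assocDefect X P (single q Q) (single r R) := by
  rcases q with _ | q
  · rw [zero_mul, pow_zero, one_smul]
  rcases r with _ | r
  · rw [mul_zero, pow_zero, one_smul]
  simp only [assocDefect, value_single_succ, map_zero, LinearMap.zero_apply, contract_zero,
    mul_zero, add_zero, sub_zero, smul_zero]

theorem assoc_zsmul_mid (c : ℤ) (P Q R : PreSum K V) : assoc P (c • Q) R = c • assoc P Q R := by
  rw [assoc, map_zsmul, circ_zsmul_left, circ_zsmul_left, map_zsmul, ← smul_sub, assoc]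

theorem assoc_zsmul_right (c : ℤ) (P Q R : PreSum K V) : assoc P Q (c • R) = c • assoc P Q R := by
  rw [assoc, map_zsmul, map_zsmul, map_zsmul, ← smul_sub, assoc]

theorem value_assoc (P Q R : PreSum K V) : value (assoc P Q R) = 0 := by
  simp only [assoc, map_sub, value_circ, mul_assoc, sub_self]

theorem signed_sum_comm {M : Type*} [AddCommGroup M] (q r : ℕ) (A B C D : M) :
    (-1 : ℤ) ^ (q * r + q) • A + (-1 : ℤ) ^ r • (-1 : ℤ) ^ (q * r + r) • B +
        (-1 : ℤ) ^ r • (-1 : ℤ) ^ q • (-1 : ℤ) ^ (q * r) • C + (-1 : ℤ) ^ (q * r) • D =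
      (-1 : ℤ) ^ (q * r) • (B + (-1 : ℤ) ^ q • A + (-1 : ℤ) ^ q • (-1 : ℤ) ^ r • C + D) := by
  rcases neg_one_pow_eq_or ℤ (q * r) with h | h <;> rcases neg_one_pow_eq_or ℤ q with h1 | h1 <;>
    rcases neg_one_pow_eq_or ℤ r with h2 | h2 <;> simp only [pow_add, h, h1, h2] <;> module

/-- The graded right pre-Lie identity. Contraction is a derivation of the associator up to a defect
that is symmetric in `Q` and `R`, which carries the induction on the degree. -/
theorem assoc_symm {q r : ℕ} (P : PreSum K V) (Q : PreCochain K q V V) (R : PreCochain K r V V) :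
    assoc P (single q Q) (single r R) =
      (-1 : ℤ) ^ (q * r) • assoc P (single r R) (single q Q) := by
  refine DFinsupp.ext fun n => ?_
  induction n generalizing P q r with
  | zero => exact apply_zero_eq_of_value_eq (by rw [map_zsmul, value_assoc, value_assoc, smul_zero])
  | succ n ih =>
    refine apply_succ_eq_of_contract_eq fun X => ?_
    have contract_right : assoc P (single q Q) (contract X (single r R)) n =
        (-1 : ℤ) ^ (q * r + q) • assoc P (contract X (single r R)) (single q Q) n := by
      rcases r with _ | r
      · simp [contract_single_zero, assoc]
      · rw [contract_single_succ, ih, zsmul_apply, mul_add_one, add_assoc, pow_add, pow_add,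
          ← mul_pow, neg_one_mul, neg_neg, one_pow, mul_one]
    have contract_mid : assoc P (contract X (single q Q)) (single r R) n =
        (-1 : ℤ) ^ (q * r + r) • assoc P (single r R) (contract X (single q Q)) n := by
      rcases q with _ | q
      · simp [contract_single_zero, assoc]
      · rw [contract_single_succ, ih, zsmul_apply, add_one_mul, add_assoc, pow_add, pow_add,
          ← mul_pow, neg_one_mul, neg_neg, one_pow, mul_one]
    have contract_left := ih (contract X P) Q R
    rw [map_zsmul, contract_assoc, contract_assoc, ← neg_one_pow_zsmul_assocDefect,
      assocDefect_comm X P (single q Q)]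
    simp only [signOp_single, assoc_zsmul_mid, assoc_zsmul_right, DirectSum.add_apply, zsmul_apply,
      contract_left, contract_mid, contract_right]
    exact signed_sum_comm _ _ _ _ _ _

end PreLie

/-! ### The graded Lie algebra of cochains -/

section Grading

variable {K V W : Type*} [Field K] [AddCommGroup V] [Module K V] [AddCommGroup W] [Module K W]

theorem lof_mem_grading (n : ℕ) (P : Cochain K n V W) :
    DirectSum.lof K ℕ (fun n => Cochain K n V W) n P ∈ grading K V W n := by
  intro m hm
  rw [DirectSum.lof_eq_of, DirectSum.of_eq_of_ne _ _ _ (by simpa using hm)]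

theorem eq_lof_of_mem_grading {n : ℕ} {x : CochainSum K V W} (h : x ∈ grading K V W n) :
    x = DirectSum.lof K ℕ (fun n => Cochain K n V W) n (x n) := by
  refine DFinsupp.ext fun m => ?_
  rcases eq_or_ne m n with rfl | hm
  · exact (DirectSum.lof_apply (M := fun n => Cochain K n V W) K m (x m)).symm
  · rw [h m (by simpa using hm), lof_mem_grading n (x n) m (by simpa using hm)]

theorem eq_zero_or_exists_natCast_of_mem_grading {k : ℤ} {x : CochainSum K V W}
    (h : x ∈ grading K V W k) : x = 0 ∨ ∃ n : ℕ, k = n := by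
  rcases lt_or_ge k 0 with hk | hk
  · exact Or.inl (DFinsupp.ext fun m => h m (by omega))
  · exact Or.inr ⟨k.toNat, (Int.toNat_of_nonneg hk).symm⟩

theorem eq_iSup_inf_grading (S : Submodule K (CochainSum K V W))
    (h : ∀ x ∈ S, ∀ n, DirectSum.lof K ℕ (fun n => Cochain K n V W) n (x n) ∈ S) :
    S = ⨆ k : ℤ, S ⊓ grading K V W k := by
  classical
  refine le_antisymm (fun x hx => ?_) (iSup_le fun k => inf_le_left)
  rw [← DirectSum.sum_support_of x]
  refine Submodule.sum_mem _ fun n _ => ?_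
  exact Submodule.mem_iSup_of_mem (n : ℤ) ⟨h x hx n, lof_mem_grading n _⟩

variable (K V W)

theorem grading_internal : DirectSum.IsInternal (grading K V W) := by
  rw [DirectSum.isInternal_submodule_iff_iSupIndep_and_iSup_eq_top]
  constructor
  · refine fun k => Submodule.disjoint_def.2 fun x hx hx' => ?_
    refine DFinsupp.ext fun n => ?_
    by_cases hn : (n : ℤ) = k
    · have sup_le_ker : ⨆ j, ⨆ (_ : j ≠ k), grading K V W j ≤
          LinearMap.ker (DirectSum.component K ℕ (fun n => Cochain K n V W) n) := by
        refine iSup_le fun j => iSup_le fun hj y hy => ?_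
        rw [LinearMap.mem_ker]
        exact hy n (by rw [hn]; exact hj.symm)
      exact sup_le_ker hx'
    · exact hx n hn
  · simpa using (eq_iSup_inf_grading (⊤ : Submodule K (CochainSum K V W)) fun _ _ _ => trivial).symm

variable {K V W}

theorem cochainSum_induction {C : CochainSum K V W → Prop} (f : CochainSum K V W) (zero : C 0)
    (add : ∀ f g, C f → C g → C (f + g))
    (lof : ∀ n P, C (DirectSum.lof K ℕ (fun n => Cochain K n V W) n P)) : C f :=
  DirectSum.induction_on f zero lof add

end Grading

section Signs

theorem negOnePow_natCast_smul {M : Type*} [AddCommGroup M] (n : ℕ) (x : M) :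
    (n : ℤ).negOnePow • x = (-1 : ℤ) ^ n • x := by
  rw [Int.negOnePow_def, zpow_natCast, Units.smul_def]
  simp

theorem jacobi_of_assoc_symm {M : Type*} [AddCommGroup M] (m : M →+ M →+ M) (p q r : ℕ)
    (a b c : M)
    (hbc : m (m a b) c - m a (m b c) = (-1 : ℤ) ^ (q * r) • (m (m a c) b - m a (m c b)))
    (hac : m (m b a) c - m b (m a c) = (-1 : ℤ) ^ (p * r) • (m (m b c) a - m b (m c a)))
    (hab : m (m c a) b - m c (m a b) = (-1 : ℤ) ^ (p * q) • (m (m c b) a - m c (m b a))) :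
    m a (m b c - (-1 : ℤ) ^ (q * r) • m c b) -
        (-1 : ℤ) ^ (p * (q + r)) • m (m b c - (-1 : ℤ) ^ (q * r) • m c b) a =
      m (m a b - (-1 : ℤ) ^ (p * q) • m b a) c -
        (-1 : ℤ) ^ ((p + q) * r) • m c (m a b - (-1 : ℤ) ^ (p * q) • m b a) +
      (-1 : ℤ) ^ (p * q) • (m b (m a c - (-1 : ℤ) ^ (p * r) • m c a) -
        (-1 : ℤ) ^ (q * (p + r)) • m (m a c - (-1 : ℤ) ^ (p * r) • m c a) b) := by
  rw [mul_add p, add_mul p, mul_add q, mul_comm q p]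
  simp only [map_sub, map_zsmul, AddMonoidHom.sub_apply, AddMonoidHom.coe_smul, Pi.smul_apply,
    pow_add]
  rw [sub_eq_iff_eq_add] at hbc hac hab
  rw [hbc, hac, hab]
  rcases neg_one_pow_eq_or ℤ (p * q) with hpq | hpq <;>
    rcases neg_one_pow_eq_or ℤ (p * r) with hpr | hpr <;>
    rcases neg_one_pow_eq_or ℤ (q * r) with hqr | hqr <;>
    simp only [hpq, hpr, hqr] <;> module

end Signs

section GradedLie

variable {K V : Type*} [Field K] [AddCommGroup V] [Module K V]

/-- The map forgetting that the components of a cochain satisfy the alternation condition. -/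
noncomputable def forget : CochainSum K V V →ₗ[K] PreSum K V :=
  DirectSum.lmap fun n => (cochainSubmodule K n V V).subtype

theorem forget_injective : Function.Injective (forget : CochainSum K V V →ₗ[K] PreSum K V) :=
  (DirectSum.lmap_injective _).2 fun _ => Subtype.val_injective

theorem forget_lof (n : ℕ) (P : Cochain K n V V) :
    forget (DirectSum.lof K ℕ (fun n => Cochain K n V V) n P) = single n P.1 :=
  DirectSum.lmap_lof _ _ _

theorem forget_lof_circle (p q : ℕ) (P : Cochain K p V V) (Q : Cochain K q V V) :
    forget (DirectSum.lof K ℕ (fun n => Cochain K n V V) (p + q) (circle V p q P Q)) =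
      circ (single p P.1) (single q Q.1) := by
  rw [forget_lof, circ_single]
  rfl

theorem bracket_mem_grading {p q : ℕ} {a b : CochainSum K V V} (ha : a ∈ grading K V V p)
    (hb : b ∈ grading K V V q) : bracket V a b ∈ grading K V V (p + q : ℕ) := by
  rw [eq_lof_of_mem_grading ha, eq_lof_of_mem_grading hb, bracket_lof]
  refine Submodule.sub_mem _ (lof_mem_grading _ _) ?_
  rw [add_comm p q]
  exact zsmul_mem (lof_mem_grading (q + p) (circle V q p (b q) (a p))) _

theorem forget_bracket {p q : ℕ} {a b : CochainSum K V V} (ha : a ∈ grading K V V p)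
    (hb : b ∈ grading K V V q) :
    forget (bracket V a b) =
      circ (forget a) (forget b) - (-1 : ℤ) ^ (p * q) • circ (forget b) (forget a) := by
  rw [eq_lof_of_mem_grading ha, eq_lof_of_mem_grading hb, bracket_lof, map_sub, map_zsmul,
    forget_lof_circle, forget_lof_circle, forget_lof, forget_lof]

theorem assoc_symm_of_mem_grading {p q r : ℕ} {a b c : CochainSum K V V}
    (ha : a ∈ grading K V V p) (hb : b ∈ grading K V V q) (hc : c ∈ grading K V V r) :
    assoc (forget a) (forget b) (forget c) =
      (-1 : ℤ) ^ (q * r) • assoc (forget a) (forget c) (forget b) := by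
  rw [eq_lof_of_mem_grading ha, eq_lof_of_mem_grading hb, eq_lof_of_mem_grading hc, forget_lof,
    forget_lof, forget_lof]
  exact assoc_symm _ _ _

theorem bracket_skew {p q : ℕ} {a b : CochainSum K V V} (ha : a ∈ grading K V V p)
    (hb : b ∈ grading K V V q) : bracket V a b = -((-1 : ℤ) ^ (p * q) • bracket V b a) := by
  rw [eq_lof_of_mem_grading ha, eq_lof_of_mem_grading hb, bracket_lof, bracket_lof, mul_comm q p]
  rcases neg_one_pow_eq_or ℤ (p * q) with h | h <;> rw [h] <;> simp [add_comm]

theorem bracket_jacobi {p q r : ℕ} {a b c : CochainSum K V V} (ha : a ∈ grading K V V p)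
    (hb : b ∈ grading K V V q) (hc : c ∈ grading K V V r) :
    bracket V a (bracket V b c) =
      bracket V (bracket V a b) c + (-1 : ℤ) ^ (p * q) • bracket V b (bracket V a c) := by
  apply forget_injective
  rw [map_add, map_zsmul, forget_bracket ha (bracket_mem_grading hb hc),
    forget_bracket (bracket_mem_grading ha hb) hc, forget_bracket hb (bracket_mem_grading ha hc),
    forget_bracket ha hb, forget_bracket ha hc, forget_bracket hb hc]
  let m : PreSum K V →+ PreSum K V →+ PreSum K V :=
    { toFun := fun f => (circ f).toAddMonoidHom
      map_zero' := by ext; simp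
      map_add' := fun f g => by ext; simp }
  exact jacobi_of_assoc_symm m p q r _ _ _ (assoc_symm_of_mem_grading ha hb hc)
    (assoc_symm_of_mem_grading hb ha hc) (assoc_symm_of_mem_grading hc ha hb)

variable (K V)

theorem isGradedLieAlgebra_bracket :
    IsGradedLieAlgebra (grading K V V) (bracket (K := K) V) where
  internal := grading_internal K V V
  degree p q a b ha hb := by
    rcases eq_zero_or_exists_natCast_of_mem_grading ha with rfl | ⟨p, rfl⟩
    · simp
    rcases eq_zero_or_exists_natCast_of_mem_grading hb with rfl | ⟨q, rfl⟩
    · simp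
    exact_mod_cast bracket_mem_grading ha hb
  skew p q a b ha hb := by
    rcases eq_zero_or_exists_natCast_of_mem_grading ha with rfl | ⟨p, rfl⟩
    · simp
    rcases eq_zero_or_exists_natCast_of_mem_grading hb with rfl | ⟨q, rfl⟩
    · simp
    rw [← Nat.cast_mul, negOnePow_natCast_smul]
    exact bracket_skew ha hb
  jacobi p q r a b c ha hb hc := by
    rcases eq_zero_or_exists_natCast_of_mem_grading ha with rfl | ⟨p, rfl⟩
    · simp
    rcases eq_zero_or_exists_natCast_of_mem_grading hb with rfl | ⟨q, rfl⟩
    · simp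
    rcases eq_zero_or_exists_natCast_of_mem_grading hc with rfl | ⟨r, rfl⟩
    · simp
    rw [← Nat.cast_mul, negOnePow_natCast_smul]
    exact bracket_jacobi ha hb hc

end GradedLie

/-! ### Semidirect products of 3-Lie algebras -/

section DegreeZero

variable {K V : Type*} [Field K] [AddCommGroup V] [Module K V]

/-- The endomorphism `φ` as a cochain of degree `0`. -/
noncomputable def ofEnd (φ : Module.End K V) : PreSum K V :=
  single 0 (MultilinearMap.constOfIsEmpty K _ φ)

theorem value_ofEnd (φ : Module.End K V) : value (ofEnd φ) = φ :=
  value_single_zero _ fun _ => 0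

theorem contract_ofEnd (X : ⋀[K]^2 V) (φ : Module.End K V) : contract X (ofEnd φ) = 0 :=
  contract_single_zero X _

theorem signOp_ofEnd (φ : Module.End K V) : signOp (ofEnd φ) = ofEnd φ := by
  rw [ofEnd, signOp_single, pow_zero, one_smul]

theorem eq_ofEnd {f : PreSum K V} {φ : Module.End K V} (hvalue : value f = φ)
    (hcontract : ∀ X, contract X f = 0) : f = ofEnd φ :=
  preSum_ext (by rw [hvalue, value_ofEnd]) fun X => by rw [hcontract, contract_ofEnd]

theorem circ_ofEnd_ofEnd (φ ψ : Module.End K V) : circ (ofEnd φ) (ofEnd ψ) = ofEnd (φ * ψ) :=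
  eq_ofEnd (by rw [value_circ, value_ofEnd, value_ofEnd]) fun X => by
    simp only [contract_circ, contract_ofEnd, map_zero, LinearMap.zero_apply, add_zero]

theorem ofEnd_add (φ ψ : Module.End K V) : ofEnd (φ + ψ) = ofEnd φ + ofEnd ψ :=
  (eq_ofEnd (by rw [map_add, value_ofEnd, value_ofEnd]) fun X => by
    simp only [map_add, contract_ofEnd, add_zero]).symm

theorem ofEnd_sub (φ ψ : Module.End K V) : ofEnd (φ - ψ) = ofEnd φ - ofEnd ψ :=
  (eq_ofEnd (by rw [map_sub, value_ofEnd, value_ofEnd]) fun X => by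
    simp only [map_sub, contract_ofEnd, sub_zero]).symm

theorem ofEnd_smul (c : K) (φ : Module.End K V) : ofEnd (c • φ) = c • ofEnd φ :=
  (eq_ofEnd (by rw [map_smul, value_ofEnd]) fun X => by
    rw [map_smul, contract_ofEnd, smul_zero]).symm

theorem ofEnd_zero : ofEnd (0 : Module.End K V) = 0 :=
  (eq_ofEnd (map_zero _) fun _ => map_zero _).symm

end DegreeZero

section Ternary

variable {K V : Type*} [Field K] [AddCommGroup V] [Module K V]

/-- The cochain of degree `1` given by an alternating trilinear map. -/
noncomputable def ternary (f : V [⋀^Fin 3]→ₗ[K] V) : CochainSum K V V :=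
  DirectSum.lof K ℕ (fun n => Cochain K n V V) 1 (ofAlternating f)

theorem ternary_mem_grading (f : V [⋀^Fin 3]→ₗ[K] V) : ternary f ∈ grading K V V 1 :=
  lof_mem_grading 1 _

theorem value_forget_ternary (f : V [⋀^Fin 3]→ₗ[K] V) : value (forget (ternary f)) = 0 := by
  rw [ternary, forget_lof, value_single_succ]

theorem contract_forget_ternary (X : ⋀[K]^2 V) (f : V [⋀^Fin 3]→ₗ[K] V) :
    contract X (forget (ternary f)) = ofEnd (wedgeCurry f X) := by
  rw [ternary, forget_lof, contract_single_succ]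
  rfl

theorem signOp_forget_ternary (f : V [⋀^Fin 3]→ₗ[K] V) :
    signOp (forget (ternary f)) = -forget (ternary f) := by
  rw [ternary, forget_lof, signOp_single, pow_one, neg_one_zsmul]

theorem IsThreeLieBracket.wedgeCurry_mul_wedgeCurry {f : V [⋀^Fin 3]→ₗ[K] V}
    (hf : IsThreeLieBracket f) (X Y : ⋀[K]^2 V) :
    wedgeCurry f X * wedgeCurry f Y =
      wedgeCurry f (wedgeDerivation (wedgeCurry f X) Y) + wedgeCurry f Y * wedgeCurry f X := by
  induction X using wedge_induction with
  | zero => simp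
  | add a b ha hb =>
    simp only [map_add, add_mul, mul_add, LinearMap.add_apply, ha, hb]
    abel
  | smul c a ha =>
    simp only [map_smul, smul_mul_assoc, mul_smul_comm, LinearMap.smul_apply, ha, smul_add]
  | wedge x y =>
    induction Y using wedge_induction with
    | zero => simp
    | add a b ha hb =>
      simp only [map_add, add_mul, mul_add, ha, hb]
      abel
    | smul c a ha => simp only [map_smul, smul_mul_assoc, mul_smul_comm, ha, smul_add]
    | wedge z w =>
      ext t
      simp only [LinearMap.add_apply, Module.End.mul_apply, wedgeDerivation_apply, map_add,
        wedgeCurry_apply]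
      exact hf x y z w t

theorem circ_forget_ternary_self {f : V [⋀^Fin 3]→ₗ[K] V} (hf : IsThreeLieBracket f) :
    circ (forget (ternary f)) (forget (ternary f)) = 0 := by
  refine preSum_ext (by rw [value_circ, value_forget_ternary, mul_zero, map_zero]) fun X => ?_
  have contract_once : contract X (circ (forget (ternary f)) (forget (ternary f))) =
      circ (forget (ternary f)) (ofEnd (wedgeCurry f X)) -
        circ (ofEnd (wedgeCurry f X)) (forget (ternary f)) := by
    rw [contract_circ, contract_forget_ternary, signOp_forget_ternary, value_forget_ternary,
      map_zero, LinearMap.zero_apply, contract_zero, add_zero, map_neg, ← sub_eq_add_neg]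
  rw [map_zero, contract_once]
  refine preSum_ext ?_ fun Y => ?_
  · rw [map_sub, value_circ, value_circ, value_forget_ternary, zero_mul, mul_zero, sub_zero,
      map_zero]
  · simp only [map_sub, contract_circ, contract_ofEnd, contract_forget_ternary, signOp_ofEnd,
      value_ofEnd, map_zero, zero_add, LinearMap.zero_apply, add_zero, circ_ofEnd_ofEnd,
      ← ofEnd_add, ← ofEnd_sub]
    rw [hf.wedgeCurry_mul_wedgeCurry X Y, add_comm, sub_self, ofEnd_zero]

theorem bracket_ternary_self {f : V [⋀^Fin 3]→ₗ[K] V} (hf : IsThreeLieBracket f) :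
    bracket V (ternary f) (ternary f) = 0 := by
  have degree_one := ternary_mem_grading f
  rw [← Nat.cast_one] at degree_one
  apply forget_injective
  rw [forget_bracket degree_one degree_one, circ_forget_ternary_self hf, smul_zero, sub_zero,
    map_zero]

end Ternary

section SemidirectProduct

variable {K V W : Type*} [Field K] [AddCommGroup V] [Module K V] [AddCommGroup W] [Module K W]

theorem alt₃_rotate (f : V [⋀^Fin 3]→ₗ[K] W) (x y z : V) : f ![x, y, z] = f ![z, x, y] := by
  rw [← one_smul ℤˣ (f ![x, y, z]),
    ← show Equiv.Perm.sign (finRotate 3).symm = 1 by decide, ← f.map_perm]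
  congr 1
  ext i
  fin_cases i <;> rfl

theorem alt₃_add_left (f : V [⋀^Fin 3]→ₗ[K] W) (a b y z : V) :
    f ![a + b, y, z] = f ![a, y, z] + f ![b, y, z] :=
  f.map_vecCons_add ![y, z] a b

theorem alt₃_add_right (f : V [⋀^Fin 3]→ₗ[K] W) (x y a b : V) :
    f ![x, y, a + b] = f ![x, y, a] + f ![x, y, b] := by
  rw [alt₃_rotate f x y, alt₃_add_left, ← alt₃_rotate f x y a, ← alt₃_rotate f x y b]

theorem alt₃_add_mid (f : V [⋀^Fin 3]→ₗ[K] W) (x a b z : V) :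
    f ![x, a + b, z] = f ![x, a, z] + f ![x, b, z] := by
  rw [alt₃_rotate f x, alt₃_add_right, ← alt₃_rotate f x a, ← alt₃_rotate f x b]

variable {g h : Type*} [AddCommGroup g] [Module K g] [AddCommGroup h] [Module K h]
  {π : g [⋀^Fin 3]→ₗ[K] g} {μ : h [⋀^Fin 3]→ₗ[K] h} {ρ : g [⋀^Fin 2]→ₗ[K] Module.End K h}

theorem IsAction.bracket_action_left (hρ : IsAction π μ ρ) (x y : g) (u v w : h) :
    μ ![ρ ![x, y] u, v, w] = 0 :=
  hρ.mem_center x y u v w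

theorem IsAction.bracket_action_right (hρ : IsAction π μ ρ) (x y : g) (u v w : h) :
    μ ![v, w, ρ ![x, y] u] = 0 := by
  rw [alt₃_rotate, hρ.bracket_action_left]

theorem IsAction.bracket_action_mid (hρ : IsAction π μ ρ) (x y : g) (u v w : h) :
    μ ![v, ρ ![x, y] u, w] = 0 := by
  rw [alt₃_rotate, hρ.bracket_action_right]

theorem IsAction.action_action (hρ : IsAction π μ ρ) (x₁ x₂ x₃ x₄ : g) (u : h) :
    ρ ![x₁, x₂] (ρ ![x₃, x₄] u) = ρ ![π ![x₁, x₂, x₃], x₄] u +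
      ρ ![x₃, π ![x₁, x₂, x₄]] u + ρ ![x₃, x₄] (ρ ![x₁, x₂] u) :=
  LinearMap.congr_fun (hρ.rep₁ x₁ x₂ x₃ x₄) u

theorem IsAction.action_bracket (hρ : IsAction π μ ρ) (x₁ x₂ x₃ x₄ : g) (u : h) :
    ρ ![x₁, π ![x₂, x₃, x₄]] u = ρ ![x₃, x₄] (ρ ![x₁, x₂] u) -
      ρ ![x₂, x₄] (ρ ![x₁, x₃] u) + ρ ![x₂, x₃] (ρ ![x₁, x₄] u) :=
  LinearMap.congr_fun (hρ.rep₂ x₁ x₂ x₃ x₄) u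

theorem isThreeLieBracket_semidirect (hπ : IsThreeLieBracket π) (hμ : IsThreeLieBracket μ)
    (hρ : IsAction π μ ρ) : IsThreeLieBracket (semidirect π ρ μ) := by
  rintro ⟨a₁, u₁⟩ ⟨a₂, u₂⟩ ⟨a₃, u₃⟩ ⟨a₄, u₄⟩ ⟨a₅, u₅⟩
  simp only [semidirect_apply, Prod.mk_add_mk]
  refine Prod.ext (hπ _ _ _ _ _) ?_
  have swap : ∀ x y u, ρ ![x, y] u = -ρ ![y, x] u := fun x y u => by
    rw [alt₂_swap ρ x y, LinearMap.neg_apply]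
  simp only [map_add, alt₃_add_left, alt₃_add_mid, alt₃_add_right, hρ.bracket_action_left,
    hρ.bracket_action_mid, hρ.bracket_action_right, hρ.map_bracket, add_zero, zero_add]
  rw [hρ.action_action a₁ a₂ a₃ a₄ u₅, hρ.action_action a₁ a₂ a₄ a₅ u₃,
    hρ.action_action a₁ a₂ a₅ a₃ u₄, hρ.action_bracket a₂ a₃ a₄ a₅ u₁,
    swap (π ![a₃, a₄, a₅]) a₁, hρ.action_bracket a₁ a₃ a₄ a₅ u₂, hμ u₁ u₂ u₃ u₄ u₅,
    swap a₅ a₃ (ρ ![a₂, a₄] u₁), swap a₃ a₁, swap a₄ a₁, swap a₅ a₁, swap a₅ a₃ (ρ ![a₁, a₂] u₄),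
    swap a₅ a₃ (-ρ ![a₁, a₄] u₂)]
  simp only [map_neg]
  abel

end SemidirectProduct

/-! ### The projection onto `C^*(g, h)` -/

section MapPre

variable {K V : Type*} [Field K] [AddCommGroup V] [Module K V]

/-- The map `f ↦ ((𝔛₁, …, 𝔛ₙ, x) ↦ β(f(∧²α(𝔛₁), …, ∧²α(𝔛ₙ), α(x))))`. -/
noncomputable def mapPre (α β : Module.End K V) : PreSum K V →ₗ[K] PreSum K V :=
  DirectSum.lmap fun _ =>
    { toFun := fun P => ((LinearMap.lcomp K V α) ∘ₗ (LinearMap.llcomp K V V V β)).compMultilinearMap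
        (P.compLinearMap fun _ => exteriorPower.map 2 α)
      map_add' := fun _ _ => MultilinearMap.ext fun _ => LinearMap.ext fun _ => map_add β _ _
      map_smul' := fun _ _ => MultilinearMap.ext fun _ => LinearMap.ext fun _ => map_smul β _ _ }

variable {α β : Module.End K V}

theorem value_mapPre (f : PreSum K V) : value (mapPre α β f) = β * value f * α := by
  refine LinearMap.ext fun x => congrArg (fun X => β (f 0 X (α x))) (Subsingleton.elim _ _)

theorem contract_mapPre (X : ⋀[K]^2 V) (f : PreSum K V) :
    contract X (mapPre α β f) = mapPre α β (contract (exteriorPower.map 2 α X) f) := by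
  refine DFinsupp.ext fun n => MultilinearMap.ext fun Y => LinearMap.ext fun x => ?_
  rw [contract_apply]
  change β (f (n + 1) (fun i => exteriorPower.map 2 α ((Fin.cons X Y : Fin (n + 1) → _) i)) (α x)) =
    β (contract (exteriorPower.map 2 α X) f n (fun i => exteriorPower.map 2 α (Y i)) (α x))
  rw [contract_apply, MultilinearMap.curryLeft_apply]
  congr 3
  funext i
  cases i using Fin.cases <;> rfl

theorem signOp_mapPre (f : PreSum K V) : signOp (mapPre α β f) = mapPre α β (signOp f) :=
  DFinsupp.ext fun n => MultilinearMap.ext fun _ => LinearMap.ext fun _ =>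
    (map_zsmul β ((-1 : ℤ) ^ n) _).symm

theorem mapPre_ofEnd (φ : Module.End K V) : mapPre α β (ofEnd φ) = ofEnd (β * φ * α) :=
  eq_ofEnd (by rw [value_mapPre, value_ofEnd]) fun X => by
    rw [contract_mapPre, contract_ofEnd, map_zero]

theorem map_wedge (x y : V) : exteriorPower.map 2 α (exteriorPower.ιMulti K 2 ![x, y]) =
    exteriorPower.ιMulti K 2 ![α x, α y] := by
  rw [exteriorPower.map_apply_ιMulti]
  congr 1
  ext i
  fin_cases i <;> rfl

theorem map_wedgeDerivation (φ ψ : Module.End K V) (hφ : α * φ = ψ * α) (w : ⋀[K]^2 V) :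
    exteriorPower.map 2 α (wedgeDerivation φ w) =
      wedgeDerivation ψ (exteriorPower.map 2 α w) := by
  have hφ' : ∀ x, α (φ x) = ψ (α x) := LinearMap.congr_fun hφ
  induction w using wedge_induction with
  | zero => simp only [map_zero]
  | add a b ha hb => simp only [map_add, ha, hb]
  | smul c a ha => simp only [map_smul, ha]
  | wedge x y => simp only [wedgeDerivation_apply, map_add, map_wedge, hφ']

theorem circ_mapPre_mapPre (hαβ : α * β = 0) (P Q : PreSum K V) :
    circ (mapPre α β P) (mapPre α β Q) = 0 := by
  refine DFinsupp.ext fun n => ?_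
  induction n generalizing P Q with
  | zero =>
    refine apply_zero_eq_of_value_eq ?_
    calc value (circ (mapPre α β P) (mapPre α β Q))
        = β * value P * (α * β) * (value Q * α) := by
          rw [value_circ, value_mapPre, value_mapPre]; simp only [mul_assoc]
      _ = value 0 := by rw [hαβ, mul_zero, zero_mul, map_zero]
  | succ n ih =>
    refine apply_succ_eq_of_contract_eq fun X => ?_
    have absorbed : contract (wedgeDerivation (value (mapPre α β Q)) X) (mapPre α β P) = 0 := by
      have vanish : α * value (mapPre α β Q) = 0 * α := by
        rw [value_mapPre, ← mul_assoc, ← mul_assoc, hαβ, zero_mul, zero_mul]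
      rw [contract_mapPre, map_wedgeDerivation _ _ vanish, map_zero, LinearMap.zero_apply,
        contract_zero, map_zero]
    rw [contract_circ, absorbed, contract_mapPre, contract_mapPre, signOp_mapPre, map_zero,
      add_zero, DirectSum.add_apply, ih, ih]
    exact add_zero _

theorem mapPre_circ_eq_zero (hadd : α + β = 1) {P Q : PreSum K V}
    (hP : mapPre α β P = 0) (hQ : mapPre α β Q = 0) : mapPre α β (circ P Q) = 0 := by
  have stable {R : PreSum K V} (hR : mapPre α β R = 0) : α * value R * α = value R * α := by
    rw [← add_zero (α * _ * _), ← map_zero value, ← hR, value_mapPre, ← add_mul, ← add_mul, hadd,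
      one_mul]
  refine DFinsupp.ext fun n => ?_
  induction n generalizing P Q with
  | zero =>
    refine apply_zero_eq_of_value_eq ?_
    calc value (mapPre α β (circ P Q)) = β * value P * (value Q * α) := by
          rw [value_mapPre, value_circ]; simp only [mul_assoc]
      _ = value (mapPre α β P) * (value Q * α) := by
          rw [value_mapPre, mul_assoc _ α, ← mul_assoc α, stable hQ]
      _ = value 0 := by rw [hP, map_zero, zero_mul]
  | succ n ih =>
    refine apply_succ_eq_of_contract_eq fun X => ?_
    have contract_eq_zero {R : PreSum K V} (hR : mapPre α β R = 0) (X : ⋀[K]^2 V) :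
        mapPre α β (contract (exteriorPower.map 2 α X) R) = 0 := by
      rw [← contract_mapPre, hR, map_zero]
    have inner : wedgeDerivation (value Q) (exteriorPower.map 2 α X) =
        exteriorPower.map 2 α (wedgeDerivation (value Q * α) X) :=
      (map_wedgeDerivation _ _ (by rw [← mul_assoc, stable hQ]) X).symm
    rw [contract_mapPre, contract_circ, inner, map_add, map_add,
      contract_eq_zero hP, add_zero, DirectSum.add_apply, ih hP (contract_eq_zero hQ X),
      ih (contract_eq_zero hP X) (by rw [← signOp_mapPre, hQ, map_zero]), map_zero]
    exact add_zero _

end MapPre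

section Projection

variable {K g h : Type*} [Field K] [AddCommGroup g] [Module K g] [AddCommGroup h] [Module K h]

theorem embed_lof (n : ℕ) (P : Cochain K n g h) :
    embed K g h (DirectSum.lof K ℕ (fun n => Cochain K n g h) n P) =
      DirectSum.lof K ℕ (fun n => Cochain K n (g × h) (g × h)) n
        (Cochain.map (LinearMap.fst K g h) (LinearMap.inr K g h) n P) :=
  DirectSum.lmap_lof _ _ _

theorem embed_mem_grading {k : ℤ} {P : CochainSum K g h} (hP : P ∈ grading K g h k) :
    embed K g h P ∈ grading K (g × h) (g × h) k := by
  intro n hn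
  change Cochain.map (LinearMap.fst K g h) (LinearMap.inr K g h) n (P n) = 0
  rw [hP n hn, map_zero]

theorem restrict_mem_grading {k : ℤ} {x : CochainSum K (g × h) (g × h)}
    (hx : x ∈ grading K (g × h) (g × h) k) : restrict K g h x ∈ grading K g h k := by
  intro n hn
  change Cochain.map (LinearMap.inl K g h) (LinearMap.snd K g h) n (x n) = 0
  rw [hx n hn, map_zero]

theorem embed_restrict (x : CochainSum K (g × h) (g × h)) :
    embed K g h (restrict K g h x) = projection K g h x := rfl

theorem projection_embed (P : CochainSum K g h) :
    projection K g h (embed K g h P) = embed K g h P := by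
  rw [← embed_restrict, restrict_embed]

theorem range_projection : LinearMap.range (projection K g h) = LinearMap.range (embed K g h) :=
  LinearMap.range_comp_of_range_eq_top _ <|
    LinearMap.range_eq_top.2 (Function.RightInverse.surjective (restrict_embed K g h))

variable (K g h) in
/-- The projection of `g ⊕ h` onto `g`, as an endomorphism of `g ⊕ h`. -/
def toFst : Module.End K (g × h) := LinearMap.inl K g h ∘ₗ LinearMap.fst K g h

variable (K g h) in
/-- The projection of `g ⊕ h` onto `h`, as an endomorphism of `g ⊕ h`. -/
def toSnd : Module.End K (g × h) := LinearMap.inr K g h ∘ₗ LinearMap.snd K g h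

theorem toFst_mul_toSnd : toFst K g h * toSnd K g h = 0 := rfl

theorem toFst_add_toSnd : toFst K g h + toSnd K g h = 1 :=
  LinearMap.ext fun x => Prod.ext (add_zero x.1) (zero_add x.2)

theorem forget_projection (x : CochainSum K (g × h) (g × h)) :
    forget (projection K g h x) = mapPre (toFst K g h) (toSnd K g h) (forget x) := by
  refine DFinsupp.ext fun n => MultilinearMap.ext fun X => LinearMap.ext fun v => ?_
  have map_toFst : ∀ w, exteriorPower.map 2 (toFst K g h) w =
      exteriorPower.map 2 (LinearMap.inl K g h) (exteriorPower.map 2 (LinearMap.fst K g h) w) :=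
    LinearMap.congr_fun (exteriorPower.map_comp (LinearMap.fst K g h) (LinearMap.inl K g h))
  change toSnd K g h ((x n).1 (fun i => exteriorPower.map 2 (LinearMap.inl K g h)
      (exteriorPower.map 2 (LinearMap.fst K g h) (X i))) (toFst K g h v)) =
    toSnd K g h ((x n).1 (fun i => exteriorPower.map 2 (toFst K g h) (X i)) (toFst K g h v))
  simp only [map_toFst]

theorem bracket_embed_embed (P Q : CochainSum K g h) :
    bracket (g × h) (embed K g h P) (embed K g h Q) = 0 := by
  have circ_eq_zero (P Q : CochainSum K g h) :
      circ (forget (embed K g h P)) (forget (embed K g h Q)) = 0 := by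
    rw [← projection_embed P, ← projection_embed Q, forget_projection, forget_projection,
      circ_mapPre_mapPre toFst_mul_toSnd]
  induction P using cochainSum_induction with
  | zero => simp
  | add f f' hf hf' => rw [map_add, map_add, LinearMap.add_apply, hf, hf', add_zero]
  | lof p P =>
    induction Q using cochainSum_induction with
    | zero => simp
    | add f f' hf hf' => rw [map_add, map_add, hf, hf', add_zero]
    | lof q Q =>
      apply forget_injective
      rw [forget_bracket (embed_mem_grading (lof_mem_grading p P))
        (embed_mem_grading (lof_mem_grading q Q)), circ_eq_zero, circ_eq_zero, smul_zero,
        sub_zero, map_zero]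

theorem isGradedLieSubalgebra_range_embed :
    IsGradedLieSubalgebra (grading K (g × h) (g × h)) (bracket (g × h))
      (LinearMap.range (embed K g h)) where
  graded := by
    refine eq_iSup_inf_grading _ ?_
    rintro _ ⟨P, rfl⟩ n
    exact ⟨DirectSum.lof K ℕ (fun n => Cochain K n g h) n (P n), embed_lof n (P n)⟩
  closed := by
    rintro _ ⟨P, rfl⟩ _ ⟨Q, rfl⟩
    rw [bracket_embed_embed]
    exact zero_mem _

theorem projection_lof_eq_zero {x : CochainSum K (g × h) (g × h)} (hx : projection K g h x = 0)
    (n : ℕ) : projection K g h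
      (DirectSum.lof K ℕ (fun n => Cochain K n (g × h) (g × h)) n (x n)) = 0 := by
  have component_eq_zero : Cochain.map (LinearMap.fst K g h) (LinearMap.inr K g h) n
      (Cochain.map (LinearMap.inl K g h) (LinearMap.snd K g h) n (x n)) = 0 :=
    congrArg (fun f : CochainSum K (g × h) (g × h) => f n) hx
  rw [← embed_restrict, restrict, DirectSum.lmap_lof, embed_lof, component_eq_zero, map_zero]

theorem projection_bracket_eq_zero {p q : ℕ} {a b : CochainSum K (g × h) (g × h)}
    (ha : a ∈ grading K (g × h) (g × h) p) (hb : b ∈ grading K (g × h) (g × h) q)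
    (ha₀ : projection K g h a = 0) (hb₀ : projection K g h b = 0) :
    projection K g h (bracket (g × h) a b) = 0 := by
  have forget_eq_zero {x : CochainSum K (g × h) (g × h)} (hx : projection K g h x = 0) :
      mapPre (toFst K g h) (toSnd K g h) (forget x) = 0 := by
    rw [← forget_projection, hx, map_zero]
  apply forget_injective
  rw [forget_projection, forget_bracket ha hb, map_sub, map_zsmul,
    mapPre_circ_eq_zero toFst_add_toSnd (forget_eq_zero ha₀) (forget_eq_zero hb₀),
    mapPre_circ_eq_zero toFst_add_toSnd (forget_eq_zero hb₀) (forget_eq_zero ha₀), smul_zero,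
    sub_zero, map_zero]

theorem isGradedLieSubalgebra_ker_projection :
    IsGradedLieSubalgebra (grading K (g × h) (g × h)) (bracket (g × h))
      (LinearMap.ker (projection K g h)) where
  graded := eq_iSup_inf_grading _ fun _ hx n => projection_lof_eq_zero hx n
  closed a ha b hb := by
    classical
    rw [LinearMap.mem_ker, ← DirectSum.sum_support_of a, ← DirectSum.sum_support_of b]
    simp only [map_sum, LinearMap.sum_apply]
    exact Finset.sum_eq_zero fun p _ => Finset.sum_eq_zero fun q _ =>
      projection_bracket_eq_zero (lof_mem_grading q (a q)) (lof_mem_grading p (b p))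
        (projection_lof_eq_zero ha q) (projection_lof_eq_zero hb p)

end Projection

/-! ### Weights -/

section Weight

variable {K V : Type*} [Field K] [AddCommGroup V] [Module K V]

/-- An endomorphism as an element of degree `0` of `C^*(V, V)`. -/
noncomputable def endCochain (φ : Module.End K V) : CochainSum K V V :=
  DirectSum.lof K ℕ (fun n => Cochain K n V V) 0
    ⟨MultilinearMap.constOfIsEmpty K _ φ, fun i => i.elim0⟩

theorem endCochain_mem_grading (φ : Module.End K V) : endCochain φ ∈ grading K V V (0 : ℕ) :=
  lof_mem_grading 0 _

/-- The commutator with an endomorphism `φ` for the circle product. -/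
noncomputable def adEnd (φ : Module.End K V) : PreSum K V →ₗ[K] PreSum K V :=
  circ (ofEnd φ) - circ.flip (ofEnd φ)

theorem adEnd_apply (φ : Module.End K V) (f : PreSum K V) :
    adEnd φ f = circ (ofEnd φ) f - circ f (ofEnd φ) := rfl

theorem forget_bracket_endCochain (φ : Module.End K V) (a : CochainSum K V V) :
    forget (bracket V (endCochain φ) a) = adEnd φ (forget a) := by
  induction a using cochainSum_induction with
  | zero => simp only [map_zero]
  | add a b ha hb => simp only [map_add, ha, hb]
  | lof n P =>
    rw [forget_bracket (endCochain_mem_grading φ) (lof_mem_grading n P), zero_mul, pow_zero,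
      one_smul, endCochain, forget_lof]
    rfl

theorem value_adEnd (φ : Module.End K V) (f : PreSum K V) :
    value (adEnd φ f) = φ * value f - value f * φ := by
  rw [adEnd_apply, map_sub, value_circ, value_circ, value_ofEnd]

theorem contract_adEnd (φ : Module.End K V) (X : ⋀[K]^2 V) (f : PreSum K V) :
    contract X (adEnd φ f) =
      adEnd φ (contract X f) - contract (wedgeDerivation φ X) f := by
  simp only [adEnd_apply, map_sub, contract_circ, contract_ofEnd, signOp_ofEnd, value_ofEnd,
    map_zero, LinearMap.zero_apply, add_zero, zero_add, sub_sub]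

/-- `a` has weight `c` for the grading of `C^*(V, V)` by the eigenvalues of `[φ, ·]`. For `φ` the
projection of `g ⊕ h` onto `h`, it counts the outputs in `h` minus the inputs from `h`. -/
def HasWeight (φ : Module.End K V) (c : K) (a : CochainSum K V V) : Prop :=
  bracket V (endCochain φ) a = c • a

variable {φ : Module.End K V} {b c : K}

theorem hasWeight_iff_adEnd_forget {a : CochainSum K V V} :
    HasWeight φ c a ↔ adEnd φ (forget a) = c • forget a := by
  rw [HasWeight, ← forget_injective.eq_iff, forget_bracket_endCochain, map_smul]

theorem bracket_endCochain_bracket (φ : Module.End K V) (x y : CochainSum K V V) :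
    bracket V (endCochain φ) (bracket V x y) =
      bracket V (bracket V (endCochain φ) x) y + bracket V x (bracket V (endCochain φ) y) := by
  induction x using cochainSum_induction with
  | zero => simp only [map_zero, LinearMap.zero_apply, add_zero]
  | add x x' hx hx' =>
    simp only [map_add, LinearMap.add_apply, hx, hx']
    abel
  | lof p P =>
    induction y using cochainSum_induction with
    | zero => simp only [map_zero, add_zero]
    | add y y' hy hy' =>
      simp only [map_add, hy, hy']
      abel
    | lof q Q =>
      rw [bracket_jacobi (endCochain_mem_grading φ) (lof_mem_grading p P) (lof_mem_grading q Q),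
        zero_mul, pow_zero, one_smul]

theorem hasWeight_bracket {x y : CochainSum K V V} (hx : HasWeight φ b x)
    (hy : HasWeight φ c y) : HasWeight φ (b + c) (bracket V x y) := by
  rw [HasWeight, bracket_endCochain_bracket, hx, hy, map_smul, map_smul, LinearMap.smul_apply,
    add_smul]

theorem hasWeight_ternary {f : V [⋀^Fin 3]→ₗ[K] V}
    (hf : ∀ x y z, φ (f ![x, y, z]) =
      f ![φ x, y, z] + f ![x, φ y, z] + f ![x, y, φ z] + c • f ![x, y, z]) :
    HasWeight φ c (ternary f) := by
  have curried (X : ⋀[K]^2 V) : φ * wedgeCurry f X =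
      c • wedgeCurry f X + wedgeCurry f (wedgeDerivation φ X) + wedgeCurry f X * φ := by
    induction X using wedge_induction with
    | zero => simp only [map_zero, mul_zero, zero_mul, smul_zero, add_zero]
    | add a b ha hb =>
      simp only [map_add, mul_add, add_mul, ha, hb, smul_add]
      abel
    | smul r a ha => simp only [map_smul, mul_smul_comm, smul_mul_assoc, ha, smul_add, smul_comm c]
    | wedge x y =>
      refine LinearMap.ext fun z => ?_
      simp only [Module.End.mul_apply, LinearMap.add_apply, LinearMap.smul_apply, map_add,
        wedgeDerivation_apply, wedgeCurry_apply, hf]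
      abel
  rw [hasWeight_iff_adEnd_forget]
  refine preSum_ext ?_ fun X => ?_
  · rw [value_adEnd, map_smul, value_forget_ternary, mul_zero, zero_mul, smul_zero, sub_zero]
  · rw [contract_adEnd, map_smul, contract_forget_ternary, contract_forget_ternary, adEnd_apply,
      circ_ofEnd_ofEnd, circ_ofEnd_ofEnd, curried, ← ofEnd_sub, ← ofEnd_sub, add_sub_cancel_right,
      add_sub_cancel_right, ofEnd_smul]

end Weight

section WeightVanishing

variable {K V : Type*} [Field K] [AddCommGroup V] [Module K V]

theorem contract_smul (r : K) (X : ⋀[K]^2 V) (f : PreSum K V) :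
    contract (r • X) f = r • contract X f := by
  refine DFinsupp.ext fun n => ?_
  rw [DirectSum.smul_apply, contract_apply, contract_apply, map_smul]

theorem adEnd_contract {φ : Module.End K V} {b c : K} {X : ⋀[K]^2 V} {f : PreSum K V}
    (hf : adEnd φ f = b • f) (hX : wedgeDerivation φ X = c • X) :
    adEnd φ (contract X f) = (b + c) • contract X f := by
  have := contract_adEnd φ X f
  rw [hf, hX, map_smul, contract_smul, eq_sub_iff_add_eq] at this
  rw [← this, add_smul]

variable {α ε : Module.End K V}

theorem mul_eq_zero_of_add_eq_one (hadd : α + ε = 1) (hε : IsIdempotentElem ε) : ε * α = 0 := by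
  rw [eq_sub_of_add_eq hadd, hε.mul_one_sub_self]

theorem wedgeDerivation_map_eq_zero (hε : ε * α = 0) (X : ⋀[K]^2 V) :
    wedgeDerivation ε (exteriorPower.map 2 α X) = 0 := by
  rw [← map_wedgeDerivation 0 ε (by rw [mul_zero, hε]), map_zero, LinearMap.zero_apply, map_zero]

theorem adEnd_contract_map (hε : ε * α = 0) {b : K} {f : PreSum K V} (hf : adEnd ε f = b • f)
    (X : ⋀[K]^2 V) : adEnd ε (contract (exteriorPower.map 2 α X) f) =
      b • contract (exteriorPower.map 2 α X) f := by
  have := adEnd_contract hf (c := 0) (by rw [wedgeDerivation_map_eq_zero hε X, zero_smul])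
  rwa [add_zero] at this

theorem wedgeDerivation_one (X : ⋀[K]^2 V) : wedgeDerivation 1 X = (2 : K) • X := by
  induction X using wedge_induction with
  | zero => simp only [map_zero, smul_zero]
  | add a b ha hb => simp only [map_add, ha, hb, smul_add]
  | smul r a ha => rw [map_smul, ha, smul_comm]
  | wedge x y => rw [wedgeDerivation_apply, Module.End.one_apply, Module.End.one_apply, two_smul]

theorem wedgeDerivation_map_self (hε : IsIdempotentElem ε) (X : ⋀[K]^2 V) :
    wedgeDerivation ε (exteriorPower.map 2 ε X) = (2 : K) • exteriorPower.map 2 ε X := by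
  rw [← map_wedgeDerivation 1 ε (by rw [mul_one, hε.eq]), wedgeDerivation_one, map_smul]

theorem wedgeDerivation_eq (hadd : α + ε = 1) (X : ⋀[K]^2 V) :
    wedgeDerivation ε X = X - exteriorPower.map 2 α X + exteriorPower.map 2 ε X := by
  induction X using wedge_induction with
  | zero => simp only [map_zero, sub_zero, add_zero]
  | add a b ha hb =>
    simp only [map_add, ha, hb]
    abel
  | smul r a ha => rw [map_smul, ha, map_smul, map_smul, smul_add, smul_sub]
  | wedge x y =>
    have split (z : V) : α z + ε z = z := LinearMap.congr_fun hadd z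
    have expand : exteriorPower.ιMulti K 2 ![x, y] =
        exteriorPower.ιMulti K 2 ![α x, α y] + exteriorPower.ιMulti K 2 ![α x, ε y] +
          exteriorPower.ιMulti K 2 ![ε x, y] := by
      rw [← alt₂_add_right, split, ← alt₂_add_left, split]
    have expand_left : exteriorPower.ιMulti K 2 ![x, ε y] =
        exteriorPower.ιMulti K 2 ![α x, ε y] + exteriorPower.ιMulti K 2 ![ε x, ε y] := by
      rw [← alt₂_add_left, split]
    rw [wedgeDerivation_apply, map_wedge, map_wedge, expand_left, expand]
    abel

/-- The summands are the parts of `X` with no, one and two factors in the image of `ε`. -/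
theorem exists_weight_decomposition (hadd : α + ε = 1) (hε : IsIdempotentElem ε) (X : ⋀[K]^2 V) :
    ∃ Y Z, X = exteriorPower.map 2 α X + Y + Z ∧ wedgeDerivation ε Y = (1 : K) • Y ∧
      wedgeDerivation ε Z = (2 : K) • Z := by
  have hεα : ε * α = 0 := mul_eq_zero_of_add_eq_one hadd hε
  refine ⟨X - exteriorPower.map 2 α X - exteriorPower.map 2 ε X, exteriorPower.map 2 ε X,
    by abel, ?_, wedgeDerivation_map_self hε X⟩
  rw [map_sub, map_sub, wedgeDerivation_map_eq_zero hεα, wedgeDerivation_map_self hε,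
    wedgeDerivation_eq hadd, two_smul, one_smul]
  abel

theorem mul_mul_eq_zero_of_commutator_eq (hε : IsIdempotentElem ε) {v : Module.End K V} {c : K}
    (hc : c ≠ 0) (hv : ε * v - v * ε = c • v) : ε * v * ε = 0 := by
  refine (smul_eq_zero_iff_right hc).1 ?_
  rw [← smul_mul_assoc, ← mul_smul_comm, ← hv, mul_sub, sub_mul, ← mul_assoc, hε.eq, mul_assoc,
    mul_assoc, mul_assoc, hε.eq, sub_self]

theorem mul_eq_zero_of_commutator_eq (hε : IsIdempotentElem ε) {v : Module.End K V} {c : K}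
    (hc : c ≠ 0) (hc' : c + 1 ≠ 0) (hv : ε * v - v * ε = c • v) : v * ε = 0 := by
  refine (smul_eq_zero_iff_right hc').1 ?_
  rw [add_smul, one_smul, ← smul_mul_assoc, ← hv, sub_mul,
    mul_mul_eq_zero_of_commutator_eq hε hc hv, mul_assoc, hε.eq, zero_sub, neg_add_cancel]

theorem eq_zero_of_commutator_eq (hε : IsIdempotentElem ε) {v : Module.End K V} {c : K}
    (hc : c ≠ 0) (hc₁ : c - 1 ≠ 0) (hc₂ : c + 1 ≠ 0) (hv : ε * v - v * ε = c • v) : v = 0 := by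
  rw [mul_eq_zero_of_commutator_eq hε hc hc₂ hv, sub_zero] at hv
  have left_eq_zero : ε * v = 0 := by
    refine (smul_eq_zero_iff_right hc₁).1 ?_
    rw [sub_smul, one_smul, ← mul_smul_comm, ← hv, ← mul_assoc, hε.eq, sub_self]
  exact (smul_eq_zero_iff_right hc).1 (hv.symm.trans left_eq_zero)

variable {f : PreSum K V}

theorem eq_zero_of_adEnd_eq [CharZero K] (hadd : α + ε = 1) (hε : IsIdempotentElem ε) {k : ℕ}
    (hf : adEnd ε f = ((k + 2 : ℕ) : K) • f) : f = 0 := by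
  have hεα : ε * α = 0 := mul_eq_zero_of_add_eq_one hadd hε
  refine DFinsupp.ext fun n => ?_
  induction n generalizing k f with
  | zero =>
    refine apply_zero_eq_of_value_eq (eq_zero_of_commutator_eq hε (c := ((k + 2 : ℕ) : K))
      ?_ ?_ ?_ (by rw [← value_adEnd, hf, map_smul]))
    · exact_mod_cast (k + 1).succ_ne_zero
    · rw [Nat.cast_add, Nat.cast_two, ← one_add_one_eq_two, ← add_assoc, add_sub_cancel_right]
      exact_mod_cast k.succ_ne_zero
    · exact_mod_cast (k + 2).succ_ne_zero
  | succ n ih =>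
    refine apply_succ_eq_of_contract_eq fun X => ?_
    obtain ⟨Y, Z, hX, hY, hZ⟩ := exists_weight_decomposition hadd hε X
    have contract_map := ih (adEnd_contract_map hεα hf X)
    have contract_Y := ih (k := k + 1) <| by
      rw [adEnd_contract hf hY, add_right_comm k, Nat.cast_succ (k + 2)]
    have contract_Z := ih (k := k + 2) <| by
      rw [adEnd_contract hf hZ, Nat.cast_add (k + 2), Nat.cast_two]
    rw [hX, contract_add, contract_add, DirectSum.add_apply, DirectSum.add_apply, contract_map,
      contract_Y, contract_Z, map_zero]
    exact (add_zero _).trans (add_zero _)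

theorem mapPre_eq_self_of_adEnd_eq [CharZero K] (hadd : α + ε = 1) (hε : IsIdempotentElem ε)
    (hf : adEnd ε f = (1 : K) • f) : mapPre α ε f = f := by
  have hεα : ε * α = 0 := mul_eq_zero_of_add_eq_one hadd hε
  refine DFinsupp.ext fun n => ?_
  induction n generalizing f with
  | zero =>
    have commutator_eq : ε * value f - value f * ε = (1 : K) • value f := by
      rw [← value_adEnd, hf, map_smul]
    have right_eq_zero : value f * ε = 0 := mul_eq_zero_of_commutator_eq hε one_ne_zero
      (by rw [one_add_one_eq_two]; exact two_ne_zero) commutator_eq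
    refine apply_zero_eq_of_value_eq ?_
    rw [value_mapPre, eq_sub_of_add_eq hadd, mul_sub, mul_one, mul_assoc, right_eq_zero, mul_zero,
      ← right_eq_zero, commutator_eq, one_smul]
  | succ n ih =>
    refine apply_succ_eq_of_contract_eq fun X => ?_
    obtain ⟨Y, Z, hX, hY, hZ⟩ := exists_weight_decomposition hadd hε X
    have contract_Y : contract Y f = 0 := eq_zero_of_adEnd_eq hadd hε (k := 0) <| by
      rw [adEnd_contract hf hY, zero_add, Nat.cast_two, one_add_one_eq_two]
    have contract_Z : contract Z f = 0 := eq_zero_of_adEnd_eq hadd hε (k := 1) <| by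
      rw [adEnd_contract hf hZ, Nat.cast_add, Nat.cast_one, Nat.cast_two]
    have contract_X : contract X f = contract (exteriorPower.map 2 α X) f := by
      conv_lhs => rw [hX, contract_add, contract_add, contract_Y, contract_Z, add_zero, add_zero]
    rw [contract_mapPre, contract_X, ih (adEnd_contract_map hεα hf X)]

theorem mapPre_eq_zero_of_adEnd_eq {γ : Module.End K V} {b c : K} (hεα : ε * α = 0)
    (hγ : γ * ε = c • γ) (hbc : b ≠ c) (hf : adEnd ε f = b • f) : mapPre α γ f = 0 := by
  refine DFinsupp.ext fun n => ?_
  induction n generalizing f with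
  | zero =>
    refine apply_zero_eq_of_value_eq ((smul_eq_zero_iff_right (sub_ne_zero.2 hbc)).1 ?_)
    have commutator_eq : ε * value f - value f * ε = b • value f := by
      rw [← value_adEnd, hf, map_smul]
    rw [value_mapPre, sub_smul, ← smul_mul_assoc, ← mul_smul_comm, ← commutator_eq, mul_sub,
      sub_mul, ← mul_assoc, hγ, mul_assoc γ, mul_assoc _ ε, hεα, mul_zero, mul_zero, sub_zero,
      smul_mul_assoc, smul_mul_assoc, sub_self]
  | succ n ih =>
    refine apply_succ_eq_of_contract_eq fun X => ?_
    rw [contract_mapPre, ih (adEnd_contract_map hεα hf X), map_zero]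

theorem adEnd_mapPre (hε : IsIdempotentElem ε) (hαε : α * ε = 0) (f : PreSum K V) :
    adEnd ε (mapPre α ε f) = (1 : K) • mapPre α ε f := by
  rw [one_smul]
  refine DFinsupp.ext fun n => ?_
  induction n generalizing f with
  | zero =>
    refine apply_zero_eq_of_value_eq ?_
    rw [value_adEnd, value_mapPre, ← mul_assoc, ← mul_assoc, hε.eq, mul_assoc _ α ε, hαε, mul_zero,
      sub_zero]
  | succ n ih =>
    refine apply_succ_eq_of_contract_eq fun X => ?_
    have contract_derivation : contract (wedgeDerivation ε X) (mapPre α ε f) = 0 := by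
      rw [contract_mapPre, map_wedgeDerivation ε 0 (by rw [hαε, zero_mul]), map_zero,
        LinearMap.zero_apply, contract_zero, map_zero]
    rw [contract_adEnd, contract_derivation, sub_zero, contract_mapPre, ih]

end WeightVanishing

section SemidirectWeight

variable {K g h : Type*} [Field K] [AddCommGroup g] [Module K g] [AddCommGroup h] [Module K h]

theorem isIdempotentElem_toSnd : IsIdempotentElem (toSnd K g h) := rfl

theorem toSnd_mul_toFst : toSnd K g h * toFst K g h = 0 := rfl

theorem hasWeight_embed (P : CochainSum K g h) :
    HasWeight (toSnd K g h) (1 : K) (embed K g h P) := by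
  rw [hasWeight_iff_adEnd_forget, ← projection_embed, forget_projection]
  exact adEnd_mapPre isIdempotentElem_toSnd toFst_mul_toSnd _

theorem HasWeight.projection_eq_self [CharZero K] {a : CochainSum K (g × h) (g × h)}
    (ha : HasWeight (toSnd K g h) (1 : K) a) : projection K g h a = a := by
  apply forget_injective
  rw [forget_projection]
  exact mapPre_eq_self_of_adEnd_eq toFst_add_toSnd isIdempotentElem_toSnd
    (hasWeight_iff_adEnd_forget.1 ha)

theorem HasWeight.projection_eq_zero {c : K} (hc : c ≠ 1) {a : CochainSum K (g × h) (g × h)}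
    (ha : HasWeight (toSnd K g h) c a) : projection K g h a = 0 := by
  apply forget_injective
  rw [forget_projection, map_zero]
  exact mapPre_eq_zero_of_adEnd_eq toSnd_mul_toFst
    (isIdempotentElem_toSnd.eq.trans (one_smul K _).symm) hc (hasWeight_iff_adEnd_forget.1 ha)

theorem HasWeight.fst_apply_inl {c : K} (hc : c ≠ 0) {a : CochainSum K (g × h) (g × h)}
    (ha : HasWeight (toSnd K g h) c a) (n : ℕ) (X : Fin n → ⋀[K]^2 g) (x : g) :
    ((a n).1 (fun i => exteriorPower.map 2 (LinearMap.inl K g h) (X i)) (x, 0)).1 = 0 := by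
  have map_eq_zero : mapPre (toFst K g h) (toFst K g h) (forget a) = 0 :=
    mapPre_eq_zero_of_adEnd_eq toSnd_mul_toFst
      (toFst_mul_toSnd.trans (zero_smul K _).symm) hc (hasWeight_iff_adEnd_forget.1 ha)
  have map_toFst (w : ⋀[K]^2 g) : exteriorPower.map 2 (toFst K g h)
      (exteriorPower.map 2 (LinearMap.inl K g h) w) =
        exteriorPower.map 2 (LinearMap.inl K g h) w := by
    rw [← LinearMap.comp_apply, ← exteriorPower.map_comp]
    rfl
  have evaluated : (toFst K g h ((a n).1 (fun i => exteriorPower.map 2 (toFst K g h)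
      (exteriorPower.map 2 (LinearMap.inl K g h) (X i))) (x, 0))).1 = 0 :=
    congrArg (fun f : PreSum K (g × h) =>
      (f n (fun i => exteriorPower.map 2 (LinearMap.inl K g h) (X i)) (x, 0)).1) map_eq_zero
  simp only [map_toFst] at evaluated
  exact evaluated

theorem toSnd_apply (x : g) (u : h) : toSnd K g h (x, u) = (0, u) := rfl

variable (π : g [⋀^Fin 3]→ₗ[K] g) (ρ : g [⋀^Fin 2]→ₗ[K] Module.End K h) (μ : h [⋀^Fin 3]→ₗ[K] h)

theorem wedgeCurry_add {V W : Type*} [AddCommGroup V] [Module K V] [AddCommGroup W] [Module K W]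
    (f f' : V [⋀^Fin 3]→ₗ[K] W) : wedgeCurry (f + f') = wedgeCurry f + wedgeCurry f' := by
  rw [wedgeCurry, AlternatingMap.curryLeft_add, LinearMap.comp_add]
  rfl

theorem delta_eq_ternary : delta π ρ μ = ternary (semidirect π ρ μ) := rfl

theorem delta_eq_add :
    delta π ρ μ = ternary (semidirect π ρ 0) + ternary (semidirect 0 0 μ) := by
  have split : semidirect π ρ μ = semidirect π ρ 0 + semidirect 0 0 μ := by
    ext v
    · simp [semidirect]
    · simp [semidirect, actionPart]
  rw [ternary, ternary, ← map_add, delta, split]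
  refine congrArg _ (Subtype.ext ?_)
  ext1 X
  exact LinearMap.congr_fun (wedgeCurry_add _ _) _

theorem hasWeight_ternary_action :
    HasWeight (toSnd K g h) (0 : K) (ternary (semidirect π ρ 0)) := by
  have π_zero (x y : g) : π ![0, x, y] = 0 ∧ π ![x, 0, y] = 0 ∧ π ![x, y, 0] = 0 :=
    ⟨π.map_coord_zero 0 rfl, π.map_coord_zero 1 rfl, π.map_coord_zero 2 rfl⟩
  have ρ_zero (x : g) : ρ ![0, x] = 0 ∧ ρ ![x, 0] = 0 :=
    ⟨ρ.map_coord_zero 0 rfl, ρ.map_coord_zero 1 rfl⟩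
  refine hasWeight_ternary fun ⟨x, u⟩ ⟨y, v⟩ ⟨z, w⟩ => ?_
  simp only [semidirect_apply, AlternatingMap.zero_apply, LinearMap.zero_apply, toSnd_apply, π_zero,
    ρ_zero, add_zero, zero_add, Prod.mk_add_mk, zero_smul]
  rw [Prod.mk.injEq]
  refine ⟨rfl, ?_⟩
  abel

theorem hasWeight_ternary_bracket :
    HasWeight (toSnd K g h) (-2 : K) (ternary (semidirect (0 : g [⋀^Fin 3]→ₗ[K] g) 0 μ)) := by
  refine hasWeight_ternary fun ⟨x, u⟩ ⟨y, v⟩ ⟨z, w⟩ => ?_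
  simp [semidirect_apply, toSnd_apply, two_smul]

theorem HasWeight.iteratedBracket_embed {c : K} {a : CochainSum K (g × h) (g × h)}
    (ha : HasWeight (toSnd K g h) c a) (k : ℕ) (P : Fin k → CochainSum K g h) :
    HasWeight (toSnd K g h) (c + k)
      (iteratedBracket (bracket (g × h)) a k fun i => embed K g h (P i)) := by
  induction k with
  | zero => simpa [iteratedBracket] using ha
  | succ k ih =>
    rw [iteratedBracket_succ, Nat.cast_succ, ← add_assoc]
    exact hasWeight_bracket (ih _) (hasWeight_embed _)

theorem iteratedBracket_add {A : Type*} [AddCommGroup A] [Module K A] (br : A →ₗ[K] A →ₗ[K] A)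
    (a b : A) (k : ℕ) (x : Fin k → A) :
    iteratedBracket br (a + b) k x = iteratedBracket br a k x + iteratedBracket br b k x := by
  induction k with
  | zero => rfl
  | succ k ih =>
    rw [iteratedBracket_succ, iteratedBracket_succ, iteratedBracket_succ, ih, map_add,
      LinearMap.add_apply]

theorem iteratedBracket_three {A : Type*} [AddCommGroup A] [Module K A] (br : A →ₗ[K] A →ₗ[K] A)
    (a : A) (x : Fin 3 → A) :
    iteratedBracket br a 3 x = br (br (br a (x 0)) (x 1)) (x 2) := rfl

/-- The part of weight `k` of an iterated bracket with `Δ` comes from `π + ρ`, that of weight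
`k - 2` from `μ`. -/
theorem exists_iteratedBracket_delta_eq_add (k : ℕ) (P : Fin k → CochainSum K g h) :
    ∃ a b, iteratedBracket (bracket (g × h)) (delta π ρ μ) k (fun i => embed K g h (P i)) = a + b ∧
      HasWeight (toSnd K g h) (k : K) a ∧ HasWeight (toSnd K g h) (k - 2 : K) b := by
  refine ⟨_, _, by rw [delta_eq_add, iteratedBracket_add], ?_, ?_⟩
  · simpa using (hasWeight_ternary_action π ρ).iteratedBracket_embed k P
  · simpa [sub_eq_neg_add] using (hasWeight_ternary_bracket μ).iteratedBracket_embed k P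

theorem embed_derivedBracket (k : ℕ) (P : Fin k → CochainSum K g h) :
    embed K g h (derivedBracket π ρ μ k P) = projection K g h
      (iteratedBracket (bracket (g × h)) (delta π ρ μ) k fun i => embed K g h (P i)) := rfl

theorem derivedBracket_eq_zero [CharZero K] {k : ℕ} (hk₁ : k ≠ 1) (hk₃ : k ≠ 3) :
    derivedBracket π ρ μ k = 0 := by
  refine MultilinearMap.ext fun P => ?_
  obtain ⟨a, b, hab, ha, hb⟩ := exists_iteratedBracket_delta_eq_add π ρ μ k P
  have weight_b : (k - 2 : K) ≠ 1 := by
    rw [Ne, sub_eq_iff_eq_add, add_comm, two_add_one_eq_three]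
    exact_mod_cast hk₃
  rw [← restrict_embed K g h (derivedBracket π ρ μ k P), embed_derivedBracket, hab, map_add,
    ha.projection_eq_zero (by exact_mod_cast hk₁), hb.projection_eq_zero weight_b, add_zero,
    map_zero]
  rfl

theorem embed_derivedBracket_three [CharZero K] (P Q R : CochainSum K g h) :
    embed K g h (derivedBracket π ρ μ 3 ![P, Q, R]) =
      bracket (g × h) (bracket (g × h) (bracket (g × h) (delta π ρ μ) (embed K g h P))
        (embed K g h Q)) (embed K g h R) := by
  obtain ⟨a, b, hab, ha, hb⟩ := exists_iteratedBracket_delta_eq_add π ρ μ 3 ![P, Q, R]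
  have a_eq_zero : a = 0 := forget_injective <| (eq_zero_of_adEnd_eq (k := 1) toFst_add_toSnd
    isIdempotentElem_toSnd (hasWeight_iff_adEnd_forget.1 ha)).trans (map_zero _).symm
  have weight_b : ((3 : ℕ) : K) - 2 = 1 := by norm_num
  rw [weight_b] at hb
  rw [embed_derivedBracket, hab, a_eq_zero, zero_add, hb.projection_eq_self, ← zero_add b,
    ← a_eq_zero, ← hab, iteratedBracket_three]
  rfl

theorem bracket_delta_embed_apply_inl [CharZero K] (P : CochainSum K g h) (n : ℕ)
    (X : Fin n → ⋀[K]^2 g) (x : g) :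
    (bracket (g × h) (delta π ρ μ) (embed K g h P) n).1
        (fun i => exteriorPower.map 2 (LinearMap.inl K g h) (X i)) (x, 0) =
      (0, (derivedBracket π ρ μ 1 ![P] n).1 X x) := by
  refine Prod.ext ?_ rfl
  obtain ⟨a, b, hab, ha, hb⟩ := exists_iteratedBracket_delta_eq_add π ρ μ 1 ![P]
  have weight_b : ((1 : ℕ) : K) - 2 ≠ 0 := by norm_num
  have bracket_eq : bracket (g × h) (delta π ρ μ) (embed K g h P) = a + b := hab
  rw [bracket_eq]
  have fst_a := ha.fst_apply_inl (Nat.cast_ne_zero.2 one_ne_zero) n X x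
  exact (congrArg₂ (· + ·) fst_a (hb.fst_apply_inl weight_b n X x)).trans (add_zero 0)

theorem projection_delta : projection K g h (delta π ρ μ) = 0 := by
  have curried (X : ⋀[K]^2 (g × h)) : toSnd K g h * wedgeCurry (semidirect π ρ μ)
      (exteriorPower.map 2 (toFst K g h) X) * toFst K g h = 0 := by
    induction X using wedge_induction with
    | zero => simp only [map_zero, mul_zero, zero_mul]
    | add a b ha hb => simp only [map_add, mul_add, add_mul, ha, hb, add_zero]
    | smul r a ha => simp only [map_smul, mul_smul_comm, smul_mul_assoc, ha, smul_zero]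
    | wedge x y =>
      refine LinearMap.ext fun z => ?_
      rw [map_wedge, Module.End.mul_apply, Module.End.mul_apply, wedgeCurry_apply]
      have μ_zero : μ ![0, 0, 0] = 0 := μ.map_coord_zero 0 rfl
      simp [toFst, semidirect_apply, toSnd_apply, μ_zero]
  apply forget_injective
  rw [forget_projection, map_zero]
  refine preSum_ext ?_ fun X => ?_
  · rw [value_mapPre, delta_eq_ternary, value_forget_ternary, mul_zero, zero_mul, map_zero]
  · rw [contract_mapPre, delta_eq_ternary, contract_forget_ternary, mapPre_ofEnd, curried,
      ofEnd_zero, map_zero]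

theorem isVData_delta {π : g [⋀^Fin 3]→ₗ[K] g} {μ : h [⋀^Fin 3]→ₗ[K] h}
    {ρ : g [⋀^Fin 2]→ₗ[K] Module.End K h} (hπ : IsThreeLieBracket π) (hμ : IsThreeLieBracket μ)
    (hρ : IsAction π μ ρ) :
    IsVData (grading K (g × h) (g × h)) (bracket (g × h)) (LinearMap.range (embed K g h))
      (projection K g h) (delta π ρ μ) where
  lie := isGradedLieAlgebra_bracket K (g × h)
  subalgebra := isGradedLieSubalgebra_range_embed
  abelian := by
    rintro _ ⟨P, rfl⟩ _ ⟨Q, rfl⟩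
    exact bracket_embed_embed P Q
  idempotent := LinearMap.ext fun _ => projection_embed _
  range_eq := range_projection
  ker_subalgebra := isGradedLieSubalgebra_ker_projection
  mem_ker := projection_delta π ρ μ
  mem_degree_one := ternary_mem_grading _
  square_zero := bracket_ternary_self (isThreeLieBracket_semidirect hπ hμ hρ)

end SemidirectWeight

/-! ### From V-data to `L_∞`-algebras -/

section SplitSum

variable {A M N : Type*} [AddCommGroup M] [AddCommGroup N]

/-- The total degree of a list of elements paired with their degrees. -/
def totalDegree (L : List (ℤ × A)) : ℤ := (L.map Prod.fst).sum

theorem totalDegree_cons (a : ℤ × A) (L : List (ℤ × A)) :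
    totalDegree (a :: L) = a.1 + totalDegree L := List.sum_cons

/-- The sum of `Φ f s` over all ways to split a list into complementary sublists `f` and `s`, each
term with the Koszul sign of moving `f` in front of `s`: the list form of a sum over unshuffles. -/
def splitSum : List (ℤ × A) → (List (ℤ × A) → List (ℤ × A) → M) → M
  | [], Φ => Φ [] []
  | a :: L, Φ => splitSum L fun f s => Φ (a :: f) s + (a.1 * totalDegree f).negOnePow • Φ f (a :: s)

theorem splitSum_congr {L : List (ℤ × A)} {Φ Ψ : List (ℤ × A) → List (ℤ × A) → M}
    (h : ∀ f s, f ⊆ L → s ⊆ L → Φ f s = Ψ f s) : splitSum L Φ = splitSum L Ψ := by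
  induction L generalizing Φ Ψ with
  | nil => exact h [] [] (List.Subset.refl _) (List.Subset.refl _)
  | cons a L ih =>
    refine ih fun f s hf hs => ?_
    rw [h _ _ (List.cons_subset_cons a hf) (List.subset_cons_of_subset a hs),
      h _ _ (List.subset_cons_of_subset a hf) (List.cons_subset_cons a hs)]

theorem splitSum_add (L : List (ℤ × A)) (Φ Ψ : List (ℤ × A) → List (ℤ × A) → M) :
    splitSum L (fun f s => Φ f s + Ψ f s) = splitSum L Φ + splitSum L Ψ := by
  induction L generalizing Φ Ψ with
  | nil => rfl
  | cons a L ih => simp only [splitSum, smul_add, ← ih, add_add_add_comm]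

theorem map_splitSum (φ : M →+ N) (L : List (ℤ × A)) (Φ : List (ℤ × A) → List (ℤ × A) → M) :
    φ (splitSum L Φ) = splitSum L fun f s => φ (Φ f s) := by
  induction L generalizing Φ with
  | nil => rfl
  | cons a L ih => simp only [splitSum, ih, map_add, Units.smul_def, map_zsmul]

theorem splitSum_swap (L : List (ℤ × A)) (Φ : List (ℤ × A) → List (ℤ × A) → M) :
    splitSum L (fun f s => (totalDegree f * totalDegree s).negOnePow • Φ s f) = splitSum L Φ := by
  induction L generalizing Φ with
  | nil => simp [splitSum, totalDegree]
  | cons a L ih =>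
    rw [splitSum, splitSum,
      ← ih fun f s => Φ (a :: f) s + (a.1 * totalDegree f).negOnePow • Φ f (a :: s)]
    congr 1
    funext f s
    have move_first : ((a.1 + totalDegree f) * totalDegree s).negOnePow =
        (totalDegree f * totalDegree s).negOnePow * (a.1 * totalDegree s).negOnePow := by
      rw [← Int.negOnePow_add]
      ring_nf
    have move_second : (a.1 * totalDegree f).negOnePow *
        (totalDegree f * (a.1 + totalDegree s)).negOnePow =
          (totalDegree f * totalDegree s).negOnePow := by
      rw [← Int.negOnePow_add, Int.negOnePow_eq_iff]
      exact ⟨a.1 * totalDegree f, by ring⟩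
    rw [totalDegree_cons, totalDegree_cons, smul_smul, move_first, move_second, smul_add, smul_smul,
      add_comm]

end SplitSum

section SumUnshufflesEqSplitSum

variable {n : ℕ}

theorem sum_unshuffles_castSucc_add_succ {M : Type*} [AddCommMonoid M]
    (F : ℕ → Equiv.Perm (Fin (n + 1)) → M) :
    ∑ m ∈ Finset.range (n + 2), ∑ σ ∈ unshuffles (n + 1) m, F m σ =
      ∑ k : Fin (n + 1), ∑ τ ∈ unshuffles n k,
        (F (k + 1) (insertZero 0 τ) + F k (insertZero k τ)) := by
  rw [Finset.sum_range_succ', Finset.sum_range_succ, sum_unshuffles_zero_right,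
    sum_unshuffles_self, Finset.sum_range]
  simp only [Finset.sum_add_distrib]
  rw [Fin.sum_univ_castSucc (fun k : Fin (n + 1) => ∑ τ ∈ unshuffles n k, F (k + 1) _),
    Fin.sum_univ_succ (fun k : Fin (n + 1) => ∑ τ ∈ unshuffles n k, F k _)]
  rw [Finset.sum_congr rfl fun k : Fin n => fun _ =>
    sum_unshuffles_succ (F (k + 1)) (Nat.succ_lt_succ k.isLt)]
  rw [Finset.sum_add_distrib]
  simp only [Fin.val_castSucc, Fin.val_last, Fin.val_zero, Fin.val_succ]
  have regroup : ∀ a b c e : M, a + b + c + e = a + c + (e + b) := fun a b c e => by abel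
  exact regroup _ _ _ _

theorem koszulSign_insertZero (d : Fin (n + 1) → ℤ) (a : Fin (n + 1)) (τ : Equiv.Perm (Fin n)) :
    koszulSign d (insertZero a τ) =
      (d 0 * ((List.ofFn fun i => d (τ i).succ).take a).sum).negOnePow *
        koszulSign (fun i => d i.succ) τ := by
  have row : ∀ i, (∏ j, if a.succAbove i < j ∧ insertZero a τ j < insertZero a τ (a.succAbove i)
        then (d (insertZero a τ (a.succAbove i)) * d (insertZero a τ j)).negOnePow else 1) =
      (if (i : ℕ) < a then d 0 * d (τ i).succ else 0).negOnePow *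
        ∏ j, if i < j ∧ τ j < τ i then (d (τ i).succ * d (τ j).succ).negOnePow else 1 := by
    intro i
    rw [Fin.prod_univ_succAbove _ a]
    simp only [insertZero_self, insertZero_succAbove, Fin.succAbove_lt_succAbove_iff,
      Fin.succ_lt_succ_iff, Fin.succ_pos, and_true, Fin.succAbove_lt_iff_castSucc_lt]
    congr 1
    rw [apply_ite Int.negOnePow, Int.negOnePow_zero, mul_comm (d _)]
    rfl
  rw [koszulSign, Fin.prod_univ_succAbove _ a]
  simp only [row, insertZero_self, Fin.not_lt_zero, and_false, if_false, Finset.prod_const_one,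
    one_mul, Finset.prod_mul_distrib, List.sum_take_ofFn, Finset.mul_sum, koszulSign]
  congr 1
  rw [Finset.sum_filter]
  exact (map_sum (⟨⟨_, Int.negOnePow_zero⟩, Int.negOnePow_add⟩ : ℤ →+ Additive ℤˣ) _ _).symm

theorem ofFn_comp_insertZero {X : Type*} (z : Fin (n + 1) → X) (a : Fin (n + 1))
    (τ : Equiv.Perm (Fin n)) :
    List.ofFn (fun i => z (insertZero a τ i)) =
      (List.ofFn fun i => z (τ i).succ).take a ++
        z 0 :: (List.ofFn fun i => z (τ i).succ).drop a := by
  refine List.ext_getElem (by simp; omega) fun i hi _ => ?_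
  rw [List.length_ofFn] at hi
  simp only [List.getElem_ofFn, List.getElem_append, List.length_take, List.length_ofFn,
    min_eq_left (Nat.le_of_lt_succ a.isLt)]
  rcases lt_trichotomy i a with hlt | rfl | hgt
  · rw [dif_pos hlt, List.getElem_take, List.getElem_ofFn]
    exact congrArg z (insertZero_of_lt a τ ⟨i, by omega⟩ hlt)
  · simp [insertZero_self]
  · obtain ⟨j, rfl⟩ := Nat.exists_eq_add_of_lt hgt
    rw [dif_neg (not_lt_of_gt hgt)]
    simp only [Nat.add_assoc, Nat.add_sub_cancel_left, List.getElem_cons_succ, List.getElem_drop,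
      List.getElem_ofFn]
    exact congrArg z (insertZero_of_le a τ ⟨a + j, by omega⟩ (Nat.le_add_right a j))

theorem sum_unshuffles_eq_splitSum {A M : Type*} [AddCommGroup M] (z : Fin n → ℤ × A)
    (Φ : List (ℤ × A) → List (ℤ × A) → M) :
    ∑ m ∈ Finset.range (n + 1), ∑ σ ∈ unshuffles n m, koszulSign (fun i => (z i).1) σ •
        Φ ((List.ofFn fun i => z (σ i)).take m) ((List.ofFn fun i => z (σ i)).drop m) =
      splitSum (List.ofFn z) Φ := by
  induction n generalizing Φ with
  | zero =>
    have : ∀ σ, σ ∈ unshuffles 0 0 := fun σ => mem_unshuffles.2 ⟨fun i => i.elim0, fun i => i.elim0⟩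
    simp [splitSum, koszulSign, Finset.eq_univ_of_forall this]
  | succ n ih =>
    rw [sum_unshuffles_castSucc_add_succ, List.ofFn_succ, splitSum, ← ih, Finset.sum_range]
    refine Finset.sum_congr rfl fun k _ => Finset.sum_congr rfl fun τ _ => ?_
    set L := List.ofFn fun i => z (τ i).succ with hL
    have length_take : (L.take k).length = k := by simp [L, Nat.le_of_lt_succ k.isLt]
    have degree_take :
        ((List.ofFn fun i => (z (τ i).succ).1).take k).sum = totalDegree (L.take k) := by
      rw [totalDegree, List.map_take, hL, List.map_ofFn]
      rfl
    rw [koszulSign_insertZero, koszulSign_insertZero, ofFn_comp_insertZero, ofFn_comp_insertZero,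
      ← hL, degree_take, List.take_left' length_take, List.drop_left' length_take, smul_add,
      smul_smul, mul_comm (koszulSign _ τ)]
    simp

end SumUnshufflesEqSplitSum

section IterBracket

variable {K A : Type*} [Field K] [AddCommGroup A] [Module K A] {𝒜 : ℤ → Submodule K A}
  {br : A →ₗ[K] A →ₗ[K] A}

/-- The iterated bracket `[⋯[u, a₁], ⋯, aₙ]` along a list; the degrees stored in the list only
enter the signs of the identities below. -/
def iterBracket (br : A →ₗ[K] A →ₗ[K] A) (u : A) (L : List (ℤ × A)) : A :=
  L.foldl (fun v a => br v a.2) u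

theorem iterBracket_cons (u : A) (a : ℤ × A) (L : List (ℤ × A)) :
    iterBracket br u (a :: L) = iterBracket br (br u a.2) L := rfl

theorem iterBracket_append (u : A) (L L' : List (ℤ × A)) :
    iterBracket br u (L ++ L') = iterBracket br (iterBracket br u L) L' := List.foldl_append

theorem iterBracket_add (u v : A) (L : List (ℤ × A)) :
    iterBracket br (u + v) L = iterBracket br u L + iterBracket br v L := by
  induction L generalizing u v with
  | nil => rfl
  | cons a L ih => rw [iterBracket_cons, map_add, LinearMap.add_apply, ih]; rfl

theorem iterBracket_units_smul (c : ℤˣ) (u : A) (L : List (ℤ × A)) :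
    iterBracket br (c • u) L = c • iterBracket br u L := by
  induction L generalizing u with
  | nil => rfl
  | cons a L ih =>
    rw [iterBracket_cons, LinearMap.map_smul_of_tower, LinearMap.smul_apply, ih]; rfl

theorem iterBracket_zero (L : List (ℤ × A)) : iterBracket br 0 L = 0 := by
  induction L with
  | nil => rfl
  | cons a L ih => rwa [iterBracket_cons, map_zero]

theorem iteratedBracket_eq_iterBracket {n : ℕ} (u : A) (z : Fin n → ℤ × A) :
    iteratedBracket br u n (fun i => (z i).2) = iterBracket br u (List.ofFn z) := by
  induction n with
  | zero => rfl
  | succ n ih =>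
    rw [iteratedBracket_succ, ih fun i => z i.castSucc, List.ofFn_succ', List.concat_eq_append,
      iterBracket_append]
    rfl

namespace IsGradedLieAlgebra

theorem leibniz (hL : IsGradedLieAlgebra 𝒜 br) {k l m : ℤ} {u v a : A}
    (hu : u ∈ 𝒜 k) (hv : v ∈ 𝒜 l) (ha : a ∈ 𝒜 m) :
    br (br u v) a = br u (br v a) + (l * m).negOnePow • br (br u a) v := by
  have sign : (k * l + l * (k + m)).negOnePow = (l * m).negOnePow :=
    (Int.negOnePow_eq_iff _ _).2 ⟨k * l, by ring⟩
  rw [hL.jacobi k l m u v a hu hv ha, hL.skew l (k + m) v (br u a) hv (hL.degree k m u a hu ha),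
    smul_neg, smul_smul, ← Int.negOnePow_add, sign, neg_add_cancel_right]

theorem iterBracket_mem (hL : IsGradedLieAlgebra 𝒜 br) {k : ℤ} {u : A} (hu : u ∈ 𝒜 k)
    {L : List (ℤ × A)} (h : ∀ a ∈ L, a.2 ∈ 𝒜 a.1) :
    iterBracket br u L ∈ 𝒜 (k + totalDegree L) := by
  induction L generalizing k u with
  | nil => exact (add_zero k).symm ▸ hu
  | cons a L ih =>
    rw [List.forall_mem_cons] at h
    rw [totalDegree_cons, ← add_assoc]
    exact ih (hL.degree _ _ _ _ hu h.1) h.2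

/-- By the Leibniz rule each `a ∈ L` is absorbed by either `u` or `v`. -/
theorem iterBracket_bracket (hL : IsGradedLieAlgebra 𝒜 br) {k l : ℤ} {u v : A} (hu : u ∈ 𝒜 k)
    (hv : v ∈ 𝒜 l) {L : List (ℤ × A)} (h : ∀ a ∈ L, a.2 ∈ 𝒜 a.1) :
    iterBracket br (br u v) L = splitSum L fun f s =>
      (l * totalDegree f).negOnePow • br (iterBracket br u f) (iterBracket br v s) := by
  induction L generalizing k l u v with
  | nil => simp [iterBracket, splitSum, totalDegree]
  | cons a L ih =>
    rw [List.forall_mem_cons] at h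
    rw [iterBracket_cons, hL.leibniz hu hv h.1, iterBracket_add, iterBracket_units_smul,
      ih hu (hL.degree _ _ _ _ hv h.1) h.2, ih (hL.degree _ _ _ _ hu h.1) hv h.2, add_comm]
    refine (congrArg₂ _ (map_splitSum (DistribSMul.toAddMonoidHom A _) L _) rfl).trans ?_
    rw [← splitSum_add, splitSum]
    congr 1
    funext f s
    simp only [DistribSMul.toAddMonoidHom_apply, smul_smul, ← Int.negOnePow_add, totalDegree_cons,
      mul_add, add_mul, iterBracket_cons, add_comm]

end IsGradedLieAlgebra

end IterBracket

section DerivedBrackets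

variable {K A : Type*} [Field K] [AddCommGroup A] [Module K A] {𝒜 : ℤ → Submodule K A}
  {br : A →ₗ[K] A →ₗ[K] A} {F : Submodule K A} {proj : A →ₗ[K] A} {Δ : A}

namespace IsVData

theorem proj_mem (hV : IsVData 𝒜 br F proj Δ) (x : A) : proj x ∈ F :=
  hV.range_eq ▸ LinearMap.mem_range_self proj x

theorem proj_bracket (hV : IsVData 𝒜 br F proj Δ) (x y : A) :
    proj (br x y) = proj (br (proj x) y) + proj (br x (proj y)) := by
  have sub_proj_mem_ker : ∀ z, z - proj z ∈ LinearMap.ker proj := fun z => by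
    rw [LinearMap.mem_ker, map_sub, sub_eq_zero]
    exact (LinearMap.congr_fun hV.idempotent z).symm
  have h := hV.ker_subalgebra.closed _ (sub_proj_mem_ker x) _ (sub_proj_mem_ker y)
  simp only [LinearMap.mem_ker, map_sub, LinearMap.sub_apply,
    hV.abelian _ (hV.proj_mem x) _ (hV.proj_mem y), sub_zero] at h
  rw [sub_eq_zero, sub_eq_iff_eq_add] at h
  rw [h, add_comm]

theorem bracket_bracket_comm (hV : IsVData 𝒜 br F proj Δ) {k l m : ℤ} {x a b : A} (hx : x ∈ 𝒜 k)
    (ha : a ∈ 𝒜 l) (hb : b ∈ 𝒜 m) (haF : a ∈ F) (hbF : b ∈ F) :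
    br (br x a) b = (l * m).negOnePow • br (br x b) a := by
  rw [hV.lie.leibniz hx ha hb, hV.abelian a haF b hbF, map_zero, zero_add]

theorem bracket_iterBracket (hV : IsVData 𝒜 br F proj Δ) {k m : ℤ} {u y : A} (hu : u ∈ 𝒜 k)
    (hy : y ∈ 𝒜 m) (hyF : y ∈ F) {L : List (ℤ × A)} (h : ∀ a ∈ L, a.2 ∈ 𝒜 a.1 ∧ a.2 ∈ F) :
    br (iterBracket br u L) y = (m * totalDegree L).negOnePow • iterBracket br (br u y) L := by
  induction L generalizing k u with
  | nil => simp [iterBracket, totalDegree]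
  | cons a L ih =>
    rw [List.forall_mem_cons] at h
    rw [iterBracket_cons, iterBracket_cons, ih (hV.lie.degree _ _ _ _ hu h.1.1) h.2,
      hV.bracket_bracket_comm hu h.1.1 hy h.1.2 hyF, iterBracket_units_smul, smul_smul,
      ← Int.negOnePow_add, totalDegree_cons, mul_add, mul_comm a.1, add_comm]

theorem iterBracket_perm (hV : IsVData 𝒜 br F proj Δ) {n : ℕ} {k : ℤ} {u : A} (hu : u ∈ 𝒜 k)
    {z : Fin n → ℤ × A} (hz : ∀ i, (z i).2 ∈ 𝒜 (z i).1 ∧ (z i).2 ∈ F)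
    (σ : Equiv.Perm (Fin n)) :
    iterBracket br u (List.ofFn fun i => z (σ i)) =
      koszulSign (fun i => (z i).1) σ • iterBracket br u (List.ofFn z) := by
  induction n generalizing k u with
  | zero => simp [koszulSign]
  | succ n ih =>
    obtain ⟨a, ha⟩ := σ.surjective 0
    obtain ⟨τ, rfl⟩ := exists_insertZero_eq ha
    set L := List.ofFn fun i => z (τ i).succ with hL
    have degree_take :
        ((List.ofFn fun i => (z (τ i).succ).1).take a).sum = totalDegree (L.take a) := by
      rw [totalDegree, List.map_take, hL, List.map_ofFn]
      rfl
    have mem_take : ∀ b ∈ L.take a, b.2 ∈ 𝒜 b.1 ∧ b.2 ∈ F := fun b hb => by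
      obtain ⟨i, rfl⟩ := List.mem_ofFn.1 (List.mem_of_mem_take hb)
      exact hz _
    rw [ofFn_comp_insertZero, ← hL, iterBracket_append, iterBracket_cons,
      hV.bracket_iterBracket hu (hz 0).1 (hz 0).2 mem_take, iterBracket_units_smul,
      ← iterBracket_append, List.take_append_drop, hL,
      ih (hV.lie.degree _ _ _ _ hu (hz 0).1) (fun i => hz i.succ), smul_smul, List.ofFn_succ,
      iterBracket_cons, koszulSign_insertZero, degree_take]

theorem splitSum_proj_iterBracket_eq_zero [NeZero (2 : K)] (hV : IsVData 𝒜 br F proj Δ)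
    (hproj : ∀ k, ∀ x ∈ 𝒜 k, proj x ∈ 𝒜 k) {L : List (ℤ × A)}
    (h : ∀ a ∈ L, a.2 ∈ 𝒜 a.1 ∧ a.2 ∈ F) :
    splitSum L (fun f s => proj (iterBracket br (br Δ (proj (iterBracket br Δ f))) s)) = 0 := by
  let Ψ : List (ℤ × A) → List (ℤ × A) → A := fun f s =>
    proj (iterBracket br (br Δ (proj (iterBracket br Δ f))) s)
  have proj_bracket_iterBracket : ∀ f s, f ⊆ L → s ⊆ L →
      proj ((1 * totalDegree f).negOnePow • br (iterBracket br Δ f) (iterBracket br Δ s)) =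
        Ψ f s + (totalDegree f * totalDegree s).negOnePow • Ψ s f := by
    intro f s hf hs
    have hΔf := hV.lie.iterBracket_mem hV.mem_degree_one fun a ha => (h a (hf ha)).1
    have hΔs := hV.lie.iterBracket_mem hV.mem_degree_one fun a ha => (h a (hs ha)).1
    have sign_left : (1 * totalDegree f + (1 + totalDegree f) * (1 + totalDegree s) +
        (1 + totalDegree f) * totalDegree s).negOnePow = -1 := by
      rw [← Int.negOnePow_one, Int.negOnePow_eq_iff]
      exact ⟨totalDegree f + totalDegree s + totalDegree f * totalDegree s, by ring⟩
    have sign_right : (1 * totalDegree f + (1 + totalDegree s) * totalDegree f).negOnePow =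
        (totalDegree f * totalDegree s).negOnePow :=
      (Int.negOnePow_eq_iff _ _).2 ⟨totalDegree f, by ring⟩
    rw [LinearMap.map_smul_of_tower, hV.proj_bracket,
      hV.lie.skew _ _ _ _ (hproj _ _ hΔf) hΔs,
      hV.bracket_iterBracket hV.mem_degree_one (hproj _ _ hΔf) (hV.proj_mem _)
        fun a ha => h a (hs ha),
      hV.bracket_iterBracket hV.mem_degree_one (hproj _ _ hΔs) (hV.proj_mem _)
        fun a ha => h a (hf ha), smul_add]
    simp only [map_neg, LinearMap.map_smul_of_tower, smul_neg, smul_smul, ← Int.negOnePow_add]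
    rw [← add_assoc, sign_left, sign_right, Units.neg_smul, one_smul, neg_neg]
  have twice : (2 : K) • splitSum L Ψ = 0 := by
    calc (2 : K) • splitSum L Ψ
        = splitSum L fun f s => Ψ f s + (totalDegree f * totalDegree s).negOnePow • Ψ s f := by
          rw [splitSum_add, splitSum_swap, two_smul]
      _ = proj (iterBracket br (br Δ Δ) L) := by
          rw [hV.lie.iterBracket_bracket hV.mem_degree_one hV.mem_degree_one fun a ha => (h a ha).1]
          refine Eq.trans ?_ (map_splitSum proj.toAddMonoidHom L _).symm
          exact splitSum_congr fun f s hf hs => (proj_bracket_iterBracket f s hf hs).symm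
      _ = 0 := by rw [hV.square_zero, iterBracket_zero, map_zero]
  exact (smul_eq_zero.1 twice).resolve_left two_ne_zero

theorem sum_unshuffles_proj_iterBracket_eq_zero [NeZero (2 : K)] (hV : IsVData 𝒜 br F proj Δ)
    (hproj : ∀ k, ∀ x ∈ 𝒜 k, proj x ∈ 𝒜 k) {n : ℕ} {z : Fin n → ℤ × A}
    (hz : ∀ i, (z i).2 ∈ 𝒜 (z i).1 ∧ (z i).2 ∈ F) :
    ∑ i : Fin n, ∑ σ ∈ unshuffles n (i + 1), koszulSign (fun j => (z j).1) σ •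
      proj (iterBracket br
        (br Δ (proj (iterBracket br Δ ((List.ofFn fun j => z (σ j)).take (i + 1)))))
        ((List.ofFn fun j => z (σ j)).drop (i + 1))) = 0 := by
  have h := hV.splitSum_proj_iterBracket_eq_zero hproj (L := List.ofFn z) fun a ha => by
    obtain ⟨i, rfl⟩ := List.mem_ofFn.1 ha
    exact hz i
  have proj_Δ : proj Δ = 0 := hV.mem_ker
  have empty_inner : ∀ L : List (ℤ × A),
      proj (iterBracket br (br Δ (proj (iterBracket br Δ []))) L) = 0 := fun L => by
    rw [show iterBracket br Δ ([] : List (ℤ × A)) = Δ from rfl, proj_Δ, map_zero,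
      iterBracket_zero, map_zero]
  rw [← sum_unshuffles_eq_splitSum, Finset.sum_range_succ', Finset.sum_range] at h
  simpa only [List.take_zero, empty_inner, smul_zero, Finset.sum_const_zero, add_zero] using h

end IsVData

section LInfty

variable {B : Type*} [AddCommGroup B] [Module K B] {ℬ : ℤ → Submodule K B} {ι : B →ₗ[K] A}
  {r : A →ₗ[K] B}

theorem compMultilinearMap_iteratedBracket_apply {n : ℕ} (d : Fin n → ℤ) (x : Fin n → B) :
    r.compMultilinearMap ((iteratedBracket br Δ n).compLinearMap fun _ => ι) x =
      r (iterBracket br Δ (List.ofFn fun i => (d i, ι (x i)))) :=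
  congrArg r (iteratedBracket_eq_iterBracket Δ fun i => (d i, ι (x i)))

theorem compMultilinearMap_iteratedBracket_take {n : ℕ} (d : Fin n → ℤ) (y : Fin n → B)
    (i : Fin n) :
    r.compMultilinearMap ((iteratedBracket br Δ (i + 1)).compLinearMap fun _ => ι)
        (fun s : Fin (i + 1) => y ⟨s, by omega⟩) =
      r (iterBracket br Δ ((List.ofFn fun j => (d j, ι (y j))).take (i + 1))) := by
  rw [compMultilinearMap_iteratedBracket_apply fun s : Fin (i + 1) => d ⟨s, by omega⟩]
  congr 2
  refine List.ext_getElem (by simp) fun s _ _ => ?_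
  simp only [List.getElem_ofFn, List.getElem_take]

theorem compMultilinearMap_iteratedBracket_drop {n : ℕ} (d : Fin n → ℤ) (y : Fin n → B)
    (i : Fin n) (b : B) :
    r.compMultilinearMap ((iteratedBracket br Δ (n - i)).compLinearMap fun _ => ι)
        (fun s : Fin (n - i) => if (s : ℕ) = 0 then b else y ⟨i + s, by omega⟩) =
      r (iterBracket br (br Δ (ι b)) ((List.ofFn fun j => (d j, ι (y j))).drop (i + 1))) := by
  rw [compMultilinearMap_iteratedBracket_apply fun s : Fin (n - i) =>
    if (s : ℕ) = 0 then 0 else d ⟨i + s, by omega⟩, ← iterBracket_cons Δ (0, ι b)]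
  congr 2
  refine List.ext_getElem (by simp; omega) fun s _ _ => ?_
  cases s with
  | zero => simp
  | succ s => simp [add_assoc, add_comm 1 s]

/-- Voronov's theorem, with the abelian subalgebra presented as the image of `ι` and the projection
as `ι ∘ r`. -/
theorem IsVData.isLInftyAlgebra [NeZero (2 : K)] (hV : IsVData 𝒜 br F (ι ∘ₗ r) Δ)
    (hr : r ∘ₗ ι = LinearMap.id) (hℬ : DirectSum.IsInternal ℬ)
    (hι_mem : ∀ k, ∀ b ∈ ℬ k, ι b ∈ 𝒜 k) (hr_mem : ∀ k, ∀ a ∈ 𝒜 k, r a ∈ ℬ k) :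
    IsLInftyAlgebra ℬ fun k =>
      r.compMultilinearMap ((iteratedBracket br Δ k).compLinearMap fun _ => ι) := by
  have r_ι : ∀ b, r (ι b) = b := LinearMap.congr_fun hr
  have ι_mem_F : ∀ b, ι b ∈ F := fun b => by
    have h := hV.proj_mem (ι b)
    rwa [LinearMap.comp_apply, r_ι] at h
  have mem_ofFn : ∀ {n : ℕ} {d : Fin n → ℤ} {x : Fin n → B}, (∀ i, x i ∈ ℬ (d i)) →
      ∀ a ∈ List.ofFn fun i => (d i, ι (x i)), a.2 ∈ 𝒜 a.1 ∧ a.2 ∈ F := by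
    intro n d x hx a ha
    obtain ⟨i, rfl⟩ := List.mem_ofFn.1 ha
    exact ⟨hι_mem _ _ (hx i), ι_mem_F _⟩
  refine ⟨hℬ, fun n _ d x hx => ?_, fun n _ d x hx σ => ?_, fun n _ d x hx => ?_⟩
  · have h := hV.lie.iterBracket_mem hV.mem_degree_one fun a ha => (mem_ofFn hx a ha).1
    rw [totalDegree, List.map_ofFn, List.sum_ofFn, add_comm] at h
    rw [compMultilinearMap_iteratedBracket_apply d]
    exact hr_mem _ _ h
  · rw [compMultilinearMap_iteratedBracket_apply d x,
      compMultilinearMap_iteratedBracket_apply (fun i => d (σ i)) fun i => x (σ i),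
      ← LinearMap.map_smul_of_tower]
    exact congrArg r (hV.iterBracket_perm (z := fun i => (d i, ι (x i))) hV.mem_degree_one
      (fun i => ⟨hι_mem _ _ (hx i), ι_mem_F _⟩) σ)
  · let z : Fin n → ℤ × A := fun i => (d i, ι (x i))
    have hz := hV.sum_unshuffles_proj_iterBracket_eq_zero
      (fun k a ha => hι_mem _ _ (hr_mem _ _ ha)) (z := z) fun i => ⟨hι_mem _ _ (hx i), ι_mem_F _⟩
    have ι_injective : Function.Injective ι := Function.LeftInverse.injective r_ι
    refine ι_injective ?_
    rw [map_zero, ← hz, map_sum]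
    refine Finset.sum_congr rfl fun i _ => ?_
    rw [map_sum]
    refine Finset.sum_congr rfl fun σ _ => ?_
    rw [LinearMap.map_smul_of_tower, compMultilinearMap_iteratedBracket_take (fun j => d (σ j))
      (fun j => x (σ j)), compMultilinearMap_iteratedBracket_drop (fun j => d (σ j))
      (fun j => x (σ j))]
    rfl

end LInfty

end DerivedBrackets

end ThreeLie

theorem mainTheorem2 {K g h : Type*} [Field K] [CharZero K]
    [AddCommGroup g] [Module K g] [AddCommGroup h] [Module K h]
    (π : g [⋀^Fin 3]→ₗ[K] g) (μ : h [⋀^Fin 3]→ₗ[K] h) (ρ : g [⋀^Fin 2]→ₗ[K] Module.End K h)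
    (hπ : ThreeLie.IsThreeLieBracket π) (hμ : ThreeLie.IsThreeLieBracket μ)
    (hρ : ThreeLie.IsAction π μ ρ) :
    -- the V-data
    ThreeLie.IsVData (ThreeLie.grading K (g × h) (g × h)) (ThreeLie.bracket (g × h))
      (LinearMap.range (ThreeLie.embed K g h)) (ThreeLie.projection K g h)
      (ThreeLie.delta π ρ μ) ∧
    -- its higher derived brackets make `C^*(g, h)` an `L_∞`-algebra
    ThreeLie.IsLInftyAlgebra (ThreeLie.grading K g h) (ThreeLie.derivedBracket π ρ μ) ∧
    -- `l₁(P) = 𝒫[Δ, P]`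
    (∀ P : ThreeLie.CochainSum K g h,
      ThreeLie.embed K g h (ThreeLie.derivedBracket π ρ μ 1 ![P]) =
        ThreeLie.projection K g h
          (ThreeLie.bracket (g × h) (ThreeLie.delta π ρ μ) (ThreeLie.embed K g h P))) ∧
    -- `l₁(P)` and `[Δ, P]` are equal on arguments in `g`
    (∀ (P : ThreeLie.CochainSum K g h) (n : ℕ) (X : Fin n → ⋀[K]^2 g) (x : g),
      (ThreeLie.bracket (g × h) (ThreeLie.delta π ρ μ) (ThreeLie.embed K g h P) n).1
          (fun i => exteriorPower.map 2 (LinearMap.inl K g h) (X i)) (x, 0) =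
        (0, (ThreeLie.derivedBracket π ρ μ 1 ![P] n).1 X x)) ∧
    -- `l₃(P, Q, R) = [[[Δ, P], Q], R]`
    (∀ P Q R : ThreeLie.CochainSum K g h,
      ThreeLie.embed K g h (ThreeLie.derivedBracket π ρ μ 3 ![P, Q, R]) =
        ThreeLie.bracket (g × h)
          (ThreeLie.bracket (g × h)
            (ThreeLie.bracket (g × h) (ThreeLie.delta π ρ μ) (ThreeLie.embed K g h P))
            (ThreeLie.embed K g h Q))
          (ThreeLie.embed K g h R)) ∧
    -- all other brackets vanish
    (∀ k : ℕ, k ≠ 1 → k ≠ 3 → ThreeLie.derivedBracket π ρ μ k = 0) := by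
  have hV := ThreeLie.isVData_delta hπ hμ hρ
  refine ⟨hV, ?_, fun P => rfl, ThreeLie.bracket_delta_embed_apply_inl π ρ μ,
    ThreeLie.embed_derivedBracket_three π ρ μ,
    fun k hk₁ hk₃ => ThreeLie.derivedBracket_eq_zero π ρ μ hk₁ hk₃⟩
  exact hV.isLInftyAlgebra (LinearMap.ext (ThreeLie.restrict_embed K g h))
    (ThreeLie.grading_internal K g h) (fun _ _ => ThreeLie.embed_mem_grading)
    (fun _ _ => ThreeLie.restrict_mem_grading)
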